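/- **Setting.** Let $\mathcal C_0$ be a Barr exact category (finite limits, coequalisers of kernel pairs, pullback-stable regular epimorphisms, every internal equivalence relation is a kernel pair) and let $\mathcal E_1$ be its class of regular epimorphisms. For a category $\mathcal Y$ with a class $\mathcal E$ of morphisms (the *extensions*), a commutative square $\alpha=(\alpha_\top,\alpha_\bot)\colon f_A\to f_B$, where $f_A\colon A_\top\to A_\bot$ and $f_B\colon B_\top\to B_\bot$, is an *$\mathcal E$-double extension* if $f_A,f_B,\alpha_\top,\alpha_\bot$, the two projections of the pullback $A_\bot\times_{B_\bot}B_\top$ and the comparison $A_\top\to A_\bot\times_{B_\bot}B_\top$ all lie in $\mathcal E$. Inductively, $\mathcal C_{n+1}$ is the full subcategory of the arrow category of $\mathcal C_n$ on the arrows in $\mathcal E_{n+1}$, and $\mathcal E_{n+2}$ is the class of $\mathcal E_{n+1}$-double extensions, viewed as morphisms of $\mathcal C_{n+1}$. The objects of $\mathcal C_n$ are the *$n$-fold extensions*; the underlying $n$-cubical diagram $\{0\to1\}^n\to\mathcal C_0$ of such an object is called an *$n$-cubical extension*. A *tower of strongly Birkhoff Galois structures* over $\mathcal C_0$ consists, for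 each $n\ge 0$, of a full replete reflective subcategory $\mathcal B_n\subseteq\mathcal C_n$ with reflector $F_n$ and unit $\eta^n$ (the Galois structure $\Gamma_n$), such that all $\eta^n_A$ lie in $\mathcal E_{n+1}$; such that for each $f\colon A\to B$ in $\mathcal E_{n+1}$ the reflection square $(\eta^n_A,\eta^n_B)\colon f\to F_n(f)$ is an $\mathcal E_{n+1}$-double extension; and such that $\mathcal B_{n+1}$ consists of the $\Gamma_n$-coverings. Here a *trivial $\Gamma_n$-covering* is a morphism in $\mathcal E_{n+1}$ whose reflection square is a pullback, and a *$\Gamma_n$-covering* is a morphism in $\mathcal E_{n+1}$ whose pullback along some morphism in $\mathcal E_{n+1}$ is a trivial $\Gamma_n$-covering. A *discrete fibration of order $n+1$* from $\tau$ to $\alpha$, for $n$-fold extensions $\tau$ and $\alpha$, is an $(n+1)$-fold extension $\tau\to\alpha$ whose underlying $(n+1)$-cube in $\mathcal C_0$ is a limit cube: the cone out of its initial vertex is a limit of the diagram without that vertex. An $n$-cubical extension *lies in $\mathcal B_0$* if all its vertices do. An $n$-fold extension $\tau$ is a *symmetrically trivial covering* if there is a discrete fibration $\tau\to\beta$ of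 order $n+1$ with $\beta$ in $\mathcal B_0$; an $n$-fold extension $\alpha$ is a *symmetric covering* if there is a discrete fibration $\tau\to\alpha$ of order $n+1$ with $\tau$ a symmetrically trivial covering. **Theorem.** Let a tower of strongly Birkhoff Galois structures over a Barr exact category $\mathcal C_0$ be given, let $n\ge 2$, and let $\alpha$ be an $n$-fold extension. 1. $\alpha$ is a $\Gamma_{n-1}$-covering if and only if it is a symmetric covering. 2. $\alpha$ is a $\Gamma_{n-1}$-covering if and only if there is a span of discrete fibrations $\beta\leftarrow\tau\to\alpha$ of order $n+1$ in which $\beta$ is an $n$-cubical extension lying in $\mathcal B_0$. 3. Being a higher covering does not depend on the way the $n$-cube is read as an arrow between $(n-1)$-cubes: for every permutation $\sigma$ of the $n$ directions, the $n$-cube obtained from that of $\alpha$ by permuting its directions by $\sigma$ is (up to isomorphism) the underlying cube of an $n$-fold extension $\alpha'$, and for each such $\alpha'$, $\alpha$ is a $\Gamma_{n-1}$-covering if and only if $\alpha'$ is. -/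

import Mathlib

universe v u

namespace HigherCoverings

open CategoryTheory CategoryTheory.Limits

/-! ### Barr exact categories -/

section BarrExact

variable {C : Type u} [Category.{v} C]

/-- A pair `r₁, r₂ : R ⟶ X` is an (internal) equivalence relation on `X`: it is jointly monic, and
for each object `T` the induced relation on the set of morphisms `T ⟶ X` is an equivalence
relation. -/
structure IsEquivalenceRelation {R X : C} (r₁ r₂ : R ⟶ X) : Prop where
  jointly_mono : ∀ {T : C} (a b : T ⟶ R), a ≫ r₁ = b ≫ r₁ → a ≫ r₂ = b ≫ r₂ → a = b
  equivalence : ∀ T : C,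
    Equivalence fun a b : T ⟶ X => ∃ r : T ⟶ R, r ≫ r₁ = a ∧ r ≫ r₂ = b

variable (C) in
/-- A Barr exact category: a regular category in which every equivalence relation is effective,
i.e. is the kernel pair of some morphism. -/
class BarrExact : Prop extends Regular C where
  effective : ∀ {R X : C} (r₁ r₂ : R ⟶ X), IsEquivalenceRelation r₁ r₂ →
    ∃ (Y : C) (f : X ⟶ Y), IsKernelPair f r₁ r₂

end BarrExact

/-! ### Double extensions and the tower of extensions -/

section DoubleExtension

variable {Y : Type u} [Category.{v} Y]

/-- A morphism `α : f ⟶ g` of arrows, viewed as a commutative square with top `α.left` and bottom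
`α.right`, is an `E`-double extension if the four sides of the square, the projections of the
pullback `P` of `α.right` and `g.hom`, and the comparison map `p` to this pullback are all
in `E`. -/
structure IsDoubleExtension (E : MorphismProperty Y) {f g : Arrow Y} (α : f ⟶ g) : Prop where
  dom : E f.hom
  cod : E g.hom
  top : E α.left
  bottom : E α.right
  comparison : ∃ (P : Y) (π₁ : P ⟶ f.right) (π₂ : P ⟶ g.left) (p : f.left ⟶ P),
    IsPullback π₁ π₂ α.right g.hom ∧ p ≫ π₁ = f.hom ∧ p ≫ π₂ = α.left ∧
      E π₁ ∧ E π₂ ∧ E p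

/-- The category `Ext(Y)`: the full subcategory of the arrow category of `Y` whose objects are the
arrows in the class `E`. -/
abbrev ExtObj (E : MorphismProperty Y) : Type (max u v) :=
  ObjectProperty.FullSubcategory fun f : Arrow Y => E f.hom

/-- The class of `E`-double extensions, as a class of morphisms in `Ext(Y)`. -/
def doubleExtensions (E : MorphismProperty Y) : MorphismProperty (ExtObj E) :=
  fun _ _ φ => IsDoubleExtension E φ.hom

end DoubleExtension

/-- A category with a chosen class of morphisms, the extensions. -/
structure CatWithExt : Type (max (u + 1) (v + 1)) where
  Obj : Type u
  [cat : Category.{v} Obj]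
  ext : MorphismProperty Obj

attribute [instance] CatWithExt.cat

section Tower

variable (C : Type (max u v)) [Category.{v} C]

/-- The tower of extensions over `C`. At level `0` we have the category `C` with its regular
epimorphisms. At level `n + 1` we have the category of extensions of level `n`, with the double
extensions of level `n`. -/
def extTower : ℕ → CatWithExt.{v, max u v}
  | 0 => ⟨C, MorphismProperty.regularEpi C⟩
  | n + 1 => ⟨ExtObj (extTower n).ext, doubleExtensions (extTower n).ext⟩

/-- The category `Extⁿ(C)` of `n`-fold extensions in `C`, the `n`-th level of the tower. -/
abbrev NExt (n : ℕ) : Type (max u v) := (extTower.{v, u} C n).Obj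

/-- The class of extensions in the category `Extⁿ(C)`, that is, of `(n + 1)`-fold extensions. -/
abbrev extensions (n : ℕ) : MorphismProperty (NExt.{v, u} C n) := (extTower.{v, u} C n).ext

end Tower

section Cubes

variable {C : Type (max u v)} [Category.{v} C]

/-- An `(n + 1)`-fold extension, viewed as an arrow between `n`-fold extensions. -/
def NExt.toArrow {n : ℕ} (α : NExt.{v, u} C (n + 1)) : Arrow (NExt.{v, u} C n) :=
  ObjectProperty.FullSubcategory.obj (P := fun f : Arrow (NExt.{v, u} C n) =>
    extensions.{v, u} C n f.hom) α

/-- An extension in the category of `n`-fold extensions, viewed as an `(n + 1)`-fold extension. -/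
def NExt.ofHom {n : ℕ} {A B : NExt.{v, u} C n} (f : A ⟶ B) (hf : extensions.{v, u} C n f) :
    NExt.{v, u} C (n + 1) :=
  ObjectProperty.FullSubcategory.mk (P := fun f : Arrow (NExt.{v, u} C n) =>
    extensions.{v, u} C n f.hom) (Arrow.mk f) hf

/-- The functor which views an `(n + 1)`-fold extension as an arrow between `n`-fold extensions. -/
def NExt.forget (C : Type (max u v)) [Category.{v} C] (n : ℕ) :
    NExt.{v, u} C (n + 1) ⥤ Arrow (NExt.{v, u} C n) :=
  ObjectProperty.ι fun f : Arrow (NExt.{v, u} C n) => extensions.{v, u} C n f.hom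

/-- An arrow in `D`, viewed as a functor from the ordered set `false < true` to `D`. -/
def arrowToFunctor (D : Type u) [Category.{v} D] : Arrow D ⥤ (Bool ⥤ D) where
  obj f :=
    { obj := fun b => match b with
        | false => f.left
        | true => f.right
      map := fun {b b'} h => match b, b', h with
        | false, false, _ => 𝟙 f.left
        | false, true, _ => f.hom
        | true, true, _ => 𝟙 f.right
        | true, false, h => absurd (leOfHom h) (by decide)
      map_id := by rintro (_ | _) <;> rfl
      map_comp := by
        rintro (_ | _) (_ | _) (_ | _) h k
        all_goals first
          | exact absurd (leOfHom h) (by decide)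
          | exact absurd (leOfHom k) (by decide)
          | simp }
  map {f g} φ :=
    { app := fun b => match b with
        | false => φ.left
        | true => φ.right
      naturality := by
        rintro (_ | _) (_ | _) h
        all_goals first
          | exact absurd (leOfHom h) (by decide)
          | simp }
  map_id f := by ext (_ | _) <;> rfl
  map_comp φ ψ := by ext (_ | _) <;> rfl

/-- The category of `n`-cubical diagrams in `C`: functors to `C` from the product
category `{0 → 1}ⁿ`. -/
abbrev Cube (C : Type u) [Category.{v} C] (n : ℕ) := (Fin n → Bool) ⥤ C

/-- The identification of `{0 → 1}ⁿ⁺¹` with `{0 → 1} × {0 → 1}ⁿ`, separating the first coordinate. -/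
def splitFirst (n : ℕ) : (Fin (n + 1) → Bool) ⥤ Bool × (Fin n → Bool) where
  obj x := (x 0, fun i => x i.succ)
  map h := (h 0, fun i => h i.succ)

variable (C) in
/-- The underlying `n`-cubical diagram in `C` of an `n`-fold extension. The first coordinate is the
direction in which an `(n + 1)`-fold extension is an arrow between `n`-fold extensions. -/
def cube : ∀ n : ℕ, NExt.{v, u} C n ⥤ Cube C n
  | 0 => Functor.const (Fin 0 → Bool)
  | n + 1 => NExt.forget.{v, u} C n ⋙ (cube n).mapArrow ⋙ arrowToFunctor (Cube C n) ⋙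
      Functor.uncurry ⋙ (Functor.whiskeringLeft _ _ _).obj (splitFirst n)

end Cubes

section LimitCubes

variable {C : Type u} [Category.{v} C] {n : ℕ}

/-- The cone out of the initial object of an `n`-cubical diagram, on the diagram without that
initial object. -/
def Cube.initialCone (X : Cube C n) :
    Cone ((ObjectProperty.ι fun x : Fin n → Bool => x ≠ ⊥) ⋙ X) where
  pt := X.obj ⊥
  π :=
    { app := fun x => X.map (fun i => homOfLE (bot_le : ⊥ ≤ x.obj i))
      naturality := fun x y f => by
        dsimp
        rw [Category.id_comp, ← X.map_comp]
        rfl }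

/-- A limit cube: the cone out of the initial object is a limit of the rest of the diagram. -/
def Cube.IsLimitCube (X : Cube C n) : Prop := Nonempty (IsLimit X.initialCone)

/-- The `n`-cubical diagram obtained by permuting the directions: the `i`-th direction of the new
cube is the `σ i`-th direction of `X`. -/
def Cube.permute (σ : Equiv.Perm (Fin n)) (X : Cube C n) : Cube C n :=
  { obj := fun x i => x (σ.symm i)
    map := fun h i => h (σ.symm i) : (Fin n → Bool) ⥤ (Fin n → Bool) } ⋙ X

end LimitCubes

/-! ### Galois structures and coverings -/

/-- A Galois structure on a category `Y` with class of extensions `E`: a full replete reflective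
subcategory `X` of `Y` all of whose units are extensions. (The usual further requirements on `E`
are not imposed here: the class of `(n + 1)`-fold extensions over a Barr exact category contains
the isomorphisms, is closed under composition, has the needed pullbacks, is stable under them, and
consists of morphisms of effective descent. That the reflector preserves extensions is part of the
strong Birkhoff condition below.) -/
structure GaloisStructure (Y : Type u) [Category.{v} Y] (E : MorphismProperty Y) where
  /-- the objects of the reflective subcategory -/
  X : ObjectProperty Y
  replete : X.IsClosedUnderIsomorphisms
  /-- the reflector -/
  L : Y ⥤ X.FullSubcategory
  /-- the adjunction between the reflector and the inclusion -/
  adj : L ⊣ X.ι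
  unit_mem : ∀ A : Y, E (adj.unit.app A)

namespace GaloisStructure

variable {Y : Type u} [Category.{v} Y] {E : MorphismProperty Y} (Γ : GaloisStructure Y E)

/-- The reflection of an object, seen in `Y`. -/
def refl (A : Y) : Y := Γ.X.ι.obj (Γ.L.obj A)

/-- The reflection of a morphism, seen in `Y`. -/
def reflMap {A B : Y} (f : A ⟶ B) : Γ.refl A ⟶ Γ.refl B := Γ.X.ι.map (Γ.L.map f)

/-- The unit of the reflection. -/
def unit (A : Y) : A ⟶ Γ.refl A := Γ.adj.unit.app A

/-- The reflection square at `f`, as a morphism of arrows from `f` to its reflection. -/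
def reflectionSquare {A B : Y} (f : A ⟶ B) : Arrow.mk f ⟶ Arrow.mk (Γ.reflMap f) :=
  Arrow.homMk (Γ.unit A) (Γ.unit B) (Γ.adj.unit.naturality f).symm

/-- The strong Birkhoff condition: the reflection square at each extension is a double extension. -/
def StronglyBirkhoff : Prop :=
  ∀ ⦃A B : Y⦄ (f : A ⟶ B), E f → IsDoubleExtension E (Γ.reflectionSquare f)

/-- A trivial covering: an extension whose reflection square is a pullback. -/
def IsTrivialCovering {T S : Y} (t : T ⟶ S) : Prop :=
  E t ∧ IsPullback (Γ.unit T) t (Γ.reflMap t) (Γ.unit S)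

/-- A covering: an extension `c` whose pullback `t` along some extension `e` is a trivial
covering. -/
def IsCovering {A B : Y} (c : A ⟶ B) : Prop :=
  E c ∧ ∃ (S : Y) (e : S ⟶ B), E e ∧
    ∃ (T : Y) (t : T ⟶ S) (a : T ⟶ A), IsPullback a t c e ∧ Γ.IsTrivialCovering t

end GaloisStructure

/-- A tower of strongly Birkhoff Galois structures over `C`: a strongly Birkhoff Galois structure
`Γ n` on the category of `n`-fold extensions, with the `(n + 1)`-fold extensions as its extensions,
for each `n`, such that the reflective subcategory at level `n + 1` is the category of
`Γ n`-coverings. -/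
structure GaloisTower (C : Type (max u v)) [Category.{v} C] where
  Γ : ∀ n : ℕ, GaloisStructure (NExt.{v, u} C n) (extensions.{v, u} C n)
  stronglyBirkhoff : ∀ n : ℕ, (Γ n).StronglyBirkhoff
  mem_succ_iff : ∀ (n : ℕ) (A : NExt.{v, u} C (n + 1)),
    (Γ (n + 1)).X A ↔ (Γ n).IsCovering A.toArrow.hom

/-! ### Discrete fibrations and symmetric coverings -/

section Symmetric

variable {C : Type (max u v)} [Category.{v} C]

/-- A discrete fibration of order `n + 1` from `τ` to `α`: an `(n + 1)`-fold extension, viewed as an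
arrow from `τ` to `α`, whose underlying `(n + 1)`-cubical diagram in `C` is a limit cube. -/
def IsDiscreteFibration {n : ℕ} {τ α : NExt.{v, u} C n} (φ : τ ⟶ α) : Prop :=
  ∃ h : extensions.{v, u} C n φ,
    Cube.IsLimitCube ((cube.{v, u} C (n + 1)).obj (NExt.ofHom φ h))

namespace GaloisTower

variable (T : GaloisTower.{v, u} C)

/-- The `n`-cubical extension `β` lies in the base category `B₀`: all its vertices do. -/
def LiesInBase {n : ℕ} (β : NExt.{v, u} C n) : Prop :=
  ∀ x : Fin n → Bool, (T.Γ 0).X (((cube.{v, u} C n).obj β).obj x)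

/-- The `(n + 1)`-fold extension `α` is a `Γ n`-covering. -/
def IsCovering {n : ℕ} (α : NExt.{v, u} C (n + 1)) : Prop :=
  (T.Γ n).IsCovering α.toArrow.hom

/-- Symmetrically trivial coverings: there is a discrete fibration to an extension in the base. -/
def IsSymmetricallyTrivialCovering {n : ℕ} (τ : NExt.{v, u} C n) : Prop :=
  ∃ (β : NExt.{v, u} C n) (φ : τ ⟶ β), IsDiscreteFibration φ ∧ T.LiesInBase β

/-- Symmetric coverings: there is a discrete fibration from a symmetrically trivial covering. -/
def IsSymmetricCovering {n : ℕ} (α : NExt.{v, u} C n) : Prop :=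
  ∃ (τ : NExt.{v, u} C n) (ψ : τ ⟶ α), IsDiscreteFibration ψ ∧
    T.IsSymmetricallyTrivialCovering τ

end GaloisTower

end Symmetric

end HigherCoverings

namespace HigherCoverings

open CategoryTheory CategoryTheory.Limits

/-! ### Classes of extensions -/

section Nice

variable {Y : Type u} [Category.{v} Y]

/-- The closure properties of a class of extensions that are used below. -/
structure IsExtensionClass (E : MorphismProperty Y) : Prop where
  of_isIso : ∀ {A B : Y} (f : A ⟶ B) [IsIso f], E f
  comp : ∀ {A B D : Y} {f : A ⟶ B} {g : B ⟶ D}, E f → E g → E (f ≫ g)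
  exists_pullback : ∀ {A B S : Y} {f : A ⟶ B} (_ : E f) (g : S ⟶ B),
    ∃ (P : Y) (a : P ⟶ A) (b : P ⟶ S), IsPullback a b f g
  stable : ∀ {A B S P : Y} {a : P ⟶ A} {b : P ⟶ S} {f : A ⟶ B} {g : S ⟶ B},
    IsPullback a b f g → E f → E b
  cancel : ∀ {A B D : Y} {f : A ⟶ B} {g : B ⟶ D}, E f → E (f ≫ g) → E g
  isIso_of_isPullback : ∀ {A B S P : Y} {a : P ⟶ A} {b : P ⟶ S} {f : A ⟶ B} {g : S ⟶ B},
    IsPullback a b f g → E g → IsIso b → IsIso f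
  epi : ∀ {A B : Y} {f : A ⟶ B}, E f → Epi f

variable {E : MorphismProperty Y} (hE : IsExtensionClass E)
include hE

/-- The kernel pair of a monic extension is trivial, so the pullback of `f` along itself is an
identity, and invertibility descends along extensions. -/
lemma IsExtensionClass.isIso_of_mono {A B : Y} {f : A ⟶ B} (hf : E f)
    (hm : ∀ {R : Y} (a b : R ⟶ A), a ≫ f = b ≫ f → a = b) : IsIso f :=
  hE.isIso_of_isPullback (a := 𝟙 A) (b := 𝟙 A)
    (IsPullback.mk' rfl (fun _ _ _ h _ => by simpa using h)
      (fun _ a b h => ⟨a, by simp, by simpa using hm _ _ h⟩)) hf inferInstance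

end Nice

section Regular

variable {C : Type u} [Category.{v} C] [Regular C]

lemma isRegularEpi_iff_strongEpi {A B : C} (f : A ⟶ B) : IsRegularEpi f ↔ StrongEpi f :=
  ⟨fun _ => inferInstance, fun _ => inferInstance⟩

theorem isExtensionClass_regularEpi : IsExtensionClass (MorphismProperty.regularEpi C) where
  of_isIso f _ := (isRegularEpi_iff_strongEpi f).2 inferInstance
  comp {_ _ _ f g} hf hg := by
    have := (isRegularEpi_iff_strongEpi f).1 hf
    have := (isRegularEpi_iff_strongEpi g).1 hg
    exact (isRegularEpi_iff_strongEpi _).2 (strongEpi_comp f g)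
  exists_pullback {_ _ _ f} _ g := ⟨_, _, _, IsPullback.of_hasPullback f g⟩
  stable h hf := Regular.regularEpiIsStableUnderBaseChange.of_isPullback h hf
  cancel {_ _ _ f g} _ hfg := by
    have := (isRegularEpi_iff_strongEpi (f ≫ g)).1 hfg
    exact (isRegularEpi_iff_strongEpi _).2 (strongEpi_of_strongEpi f g)
  isIso_of_isPullback {A B S P a b f g} h hg _ := by
    have := (isRegularEpi_iff_strongEpi g).1 hg
    have : StrongEpi ((inv b ≫ a) ≫ f) := by
      rw [Category.assoc, h.w, IsIso.inv_hom_id_assoc]; infer_instance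
    have : StrongEpi f := strongEpi_of_strongEpi (inv b ≫ a) f
    have : Mono f := ⟨fun {R} x y hxy => by
      -- Two maps `x`, `y` with `x ≫ f = y ≫ f` are compared on a cover of `R` by a pullback of `g`:
      -- there both lift to `P`, and the lifts agree because `b` is invertible.
      have hg' : IsRegularEpi (pullback.snd g (x ≫ f)) :=
        Regular.regularEpiIsStableUnderBaseChange.of_isPullback (IsPullback.of_hasPullback g (x ≫ f)) hg
      have : Epi (pullback.snd g (x ≫ f)) := inferInstance
      rw [← cancel_epi (pullback.snd g (x ≫ f))]
      have e1 := h.lift_fst (pullback.snd g (x ≫ f) ≫ x) (pullback.fst g (x ≫ f))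
        (by rw [Category.assoc, pullback.condition])
      have e2 := h.lift_fst (pullback.snd g (x ≫ f) ≫ y) (pullback.fst g (x ≫ f))
        (by rw [Category.assoc, ← hxy, pullback.condition])
      rw [← e1, ← e2]
      congr 1
      rw [← cancel_mono b, h.lift_snd, h.lift_snd]⟩
    exact isIso_of_mono_of_strongEpi f
  epi {_ _ f} hf := by
    have := (isRegularEpi_iff_strongEpi f).1 hf
    infer_instance

end Regular

/-! ### Higher extensions as arrows -/

namespace NExt

variable {C : Type (max u v)} [Category.{v} C]

section Basic

variable {n : ℕ}

/-- The domain of an `(n + 1)`-fold extension. -/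
def top (κ : NExt.{v, u} C (n + 1)) : NExt.{v, u} C n := (NExt.toArrow.{v, u} κ).left

/-- The codomain of an `(n + 1)`-fold extension. -/
def bot (κ : NExt.{v, u} C (n + 1)) : NExt.{v, u} C n := (NExt.toArrow.{v, u} κ).right

/-- An `(n + 1)`-fold extension as a morphism of `n`-fold extensions. -/
def arr (κ : NExt.{v, u} C (n + 1)) : top.{v, u} κ ⟶ bot.{v, u} κ := (NExt.toArrow.{v, u} κ).hom

lemma arr_mem (κ : NExt.{v, u} C (n + 1)) : extensions.{v, u} C n (arr.{v, u} κ) :=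
  ObjectProperty.FullSubcategory.property (P := fun f : Arrow (NExt.{v, u} C n) =>
    extensions.{v, u} C n f.hom) κ

/-- The upper component of a morphism of `(n + 1)`-fold extensions. -/
def topMap {κ μ : NExt.{v, u} C (n + 1)} (f : κ ⟶ μ) : top.{v, u} κ ⟶ top.{v, u} μ :=
  ((NExt.forget.{v, u} C n).map f).left

/-- The lower component of a morphism of `(n + 1)`-fold extensions. -/
def botMap {κ μ : NExt.{v, u} C (n + 1)} (f : κ ⟶ μ) : bot.{v, u} κ ⟶ bot.{v, u} μ :=
  ((NExt.forget.{v, u} C n).map f).right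

lemma w {κ μ : NExt.{v, u} C (n + 1)} (f : κ ⟶ μ) :
    topMap.{v, u} f ≫ arr.{v, u} μ = arr.{v, u} κ ≫ botMap.{v, u} f :=
  ((NExt.forget.{v, u} C n).map f).w

/-- The morphism of `(n + 1)`-fold extensions with given components. -/
def homMk {κ μ : NExt.{v, u} C (n + 1)} (t : top.{v, u} κ ⟶ top.{v, u} μ)
    (b : bot.{v, u} κ ⟶ bot.{v, u} μ) (h : t ≫ arr.{v, u} μ = arr.{v, u} κ ≫ b) : κ ⟶ μ :=
  ObjectProperty.homMk (P := fun f : Arrow (NExt.{v, u} C n) => extensions.{v, u} C n f.hom)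
    (Arrow.homMk t b h)

@[simp]
lemma topMap_homMk {κ μ : NExt.{v, u} C (n + 1)} (t : top.{v, u} κ ⟶ top.{v, u} μ)
    (b : bot.{v, u} κ ⟶ bot.{v, u} μ) (h : t ≫ arr.{v, u} μ = arr.{v, u} κ ≫ b) :
    topMap.{v, u} (homMk.{v, u} t b h) = t := rfl

@[simp]
lemma botMap_homMk {κ μ : NExt.{v, u} C (n + 1)} (t : top.{v, u} κ ⟶ top.{v, u} μ)
    (b : bot.{v, u} κ ⟶ bot.{v, u} μ) (h : t ≫ arr.{v, u} μ = arr.{v, u} κ ≫ b) :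
    botMap.{v, u} (homMk.{v, u} t b h) = b := rfl

@[simp]
lemma topMap_id (κ : NExt.{v, u} C (n + 1)) : topMap.{v, u} (𝟙 κ) = 𝟙 _ := rfl

@[simp]
lemma botMap_id (κ : NExt.{v, u} C (n + 1)) : botMap.{v, u} (𝟙 κ) = 𝟙 _ := rfl

@[simp]
lemma topMap_comp {κ μ ν : NExt.{v, u} C (n + 1)} (f : κ ⟶ μ) (g : μ ⟶ ν) :
    topMap.{v, u} (f ≫ g) = topMap.{v, u} f ≫ topMap.{v, u} g := rfl

@[simp]
lemma botMap_comp {κ μ ν : NExt.{v, u} C (n + 1)} (f : κ ⟶ μ) (g : μ ⟶ ν) :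
    botMap.{v, u} (f ≫ g) = botMap.{v, u} f ≫ botMap.{v, u} g := rfl

lemma hom_ext {κ μ : NExt.{v, u} C (n + 1)} {f g : κ ⟶ μ}
    (ht : topMap.{v, u} f = topMap.{v, u} g) (hb : botMap.{v, u} f = botMap.{v, u} g) : f = g :=
  ObjectProperty.hom_ext (P := fun f : Arrow (NExt.{v, u} C n) => extensions.{v, u} C n f.hom)
    (Arrow.hom_ext _ _ ht hb)

/-- The isomorphism of `(n + 1)`-fold extensions with given components. -/
def isoMk {κ μ : NExt.{v, u} C (n + 1)} (t : top.{v, u} κ ≅ top.{v, u} μ)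
    (b : bot.{v, u} κ ≅ bot.{v, u} μ) (h : t.hom ≫ arr.{v, u} μ = arr.{v, u} κ ≫ b.hom) :
    κ ≅ μ where
  hom := homMk.{v, u} t.hom b.hom h
  inv := homMk.{v, u} t.inv b.inv (by
    rw [Iso.inv_comp_eq, ← Category.assoc, h, Category.assoc, Iso.hom_inv_id, Category.comp_id])
  hom_inv_id := hom_ext.{v, u} (by simp) (by simp)
  inv_hom_id := hom_ext.{v, u} (by simp) (by simp)

instance {κ μ : NExt.{v, u} C (n + 1)} (f : κ ⟶ μ) [IsIso f] : IsIso (topMap.{v, u} f) :=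
  ⟨topMap.{v, u} (inv f), by rw [← topMap_comp, IsIso.hom_inv_id, topMap_id],
    by rw [← topMap_comp, IsIso.inv_hom_id, topMap_id]⟩

instance {κ μ : NExt.{v, u} C (n + 1)} (f : κ ⟶ μ) [IsIso f] : IsIso (botMap.{v, u} f) :=
  ⟨botMap.{v, u} (inv f), by rw [← botMap_comp, IsIso.hom_inv_id, botMap_id],
    by rw [← botMap_comp, IsIso.inv_hom_id, botMap_id]⟩

lemma isIso_of_components {κ μ : NExt.{v, u} C (n + 1)} (f : κ ⟶ μ)
    (ht : IsIso (topMap.{v, u} f)) (hb : IsIso (botMap.{v, u} f)) : IsIso f := by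
  have : f = (isoMk.{v, u} (asIso (topMap.{v, u} f)) (asIso (botMap.{v, u} f)) (w.{v, u} f)).hom :=
    hom_ext.{v, u} rfl rfl
  rw [this]; infer_instance

lemma topMap_comm {κ μ ν π : NExt.{v, u} C (n + 1)} {a : π ⟶ κ} {b : π ⟶ ν} {f : κ ⟶ μ}
    {g : ν ⟶ μ} (h : a ≫ f = b ≫ g) :
    topMap.{v, u} a ≫ topMap.{v, u} f = topMap.{v, u} b ≫ topMap.{v, u} g := by
  rw [← topMap_comp, h, topMap_comp]

lemma botMap_comm {κ μ ν π : NExt.{v, u} C (n + 1)} {a : π ⟶ κ} {b : π ⟶ ν} {f : κ ⟶ μ}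
    {g : ν ⟶ μ} (h : a ≫ f = b ≫ g) :
    botMap.{v, u} a ≫ botMap.{v, u} f = botMap.{v, u} b ≫ botMap.{v, u} g := by
  rw [← botMap_comp, h, botMap_comp]

lemma isPullback_of_components {κ μ ν π : NExt.{v, u} C (n + 1)} {a : π ⟶ κ} {b : π ⟶ ν}
    {f : κ ⟶ μ} {g : ν ⟶ μ}
    (ht : IsPullback (topMap.{v, u} a) (topMap.{v, u} b) (topMap.{v, u} f) (topMap.{v, u} g))
    (hb : IsPullback (botMap.{v, u} a) (botMap.{v, u} b) (botMap.{v, u} f) (botMap.{v, u} g)) :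
    IsPullback a b f g :=
  IsPullback.mk' (hom_ext.{v, u} ht.w hb.w)
    (fun _ φ ψ h₁ h₂ => hom_ext.{v, u}
      (ht.hom_ext (topMap_comm.{v, u} h₁) (topMap_comm.{v, u} h₂))
      (hb.hom_ext (botMap_comm.{v, u} h₁) (botMap_comm.{v, u} h₂)))
    (fun τ x y h => ⟨homMk.{v, u}
      (ht.lift (topMap.{v, u} x) (topMap.{v, u} y) (topMap_comm.{v, u} h))
      (hb.lift (botMap.{v, u} x) (botMap.{v, u} y) (botMap_comm.{v, u} h))
      (by
        apply hb.hom_ext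
        · rw [Category.assoc, Category.assoc, ← w, ht.lift_fst_assoc, hb.lift_fst, w]
        · rw [Category.assoc, Category.assoc, ← w, ht.lift_snd_assoc, hb.lift_snd, w]),
      hom_ext.{v, u} (by simp) (by simp), hom_ext.{v, u} (by simp) (by simp)⟩)

lemma mem_succ_iff {κ μ : NExt.{v, u} C (n + 1)} (f : κ ⟶ μ) :
    extensions.{v, u} C (n + 1) f ↔ IsDoubleExtension (extensions.{v, u} C n)
      ((NExt.forget.{v, u} C n).map f) := Iff.rfl

lemma topMap_mem {κ μ : NExt.{v, u} C (n + 1)} {f : κ ⟶ μ} (hf : extensions.{v, u} C (n + 1) f) :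
    extensions.{v, u} C n (topMap.{v, u} f) := ((mem_succ_iff.{v, u} f).1 hf).top

lemma botMap_mem {κ μ : NExt.{v, u} C (n + 1)} {f : κ ⟶ μ} (hf : extensions.{v, u} C (n + 1) f) :
    extensions.{v, u} C n (botMap.{v, u} f) := ((mem_succ_iff.{v, u} f).1 hf).bottom

lemma exists_comparison {κ μ : NExt.{v, u} C (n + 1)} {f : κ ⟶ μ}
    (hf : extensions.{v, u} C (n + 1) f) :
    ∃ (P : NExt.{v, u} C n) (π₁ : P ⟶ bot.{v, u} κ) (π₂ : P ⟶ top.{v, u} μ)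
      (p : top.{v, u} κ ⟶ P), IsPullback π₁ π₂ (botMap.{v, u} f) (arr.{v, u} μ) ∧
      p ≫ π₁ = arr.{v, u} κ ∧ p ≫ π₂ = topMap.{v, u} f ∧ extensions.{v, u} C n p := by
  obtain ⟨P, π₁, π₂, p, hP, h₁, h₂, -, -, hp⟩ := ((mem_succ_iff.{v, u} f).1 hf).comparison
  exact ⟨P, π₁, π₂, p, hP, h₁, h₂, hp⟩

end Basic

section Step

variable {n : ℕ} (hE : IsExtensionClass (extensions.{v, u} C n))
include hE

lemma mem_of_comparison' {κ μ : NExt.{v, u} C (n + 1)} {f : κ ⟶ μ}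
    (hb : extensions.{v, u} C n (botMap.{v, u} f)) {P : NExt.{v, u} C n} {π₁ : P ⟶ bot.{v, u} κ}
    {π₂ : P ⟶ top.{v, u} μ} {p : top.{v, u} κ ⟶ P}
    (hP : IsPullback π₁ π₂ (botMap.{v, u} f) (arr.{v, u} μ)) (h₁ : p ≫ π₁ = arr.{v, u} κ)
    (h₂ : p ≫ π₂ = topMap.{v, u} f) (hp : extensions.{v, u} C n p) :
    extensions.{v, u} C (n + 1) f :=
  (mem_succ_iff.{v, u} f).2
    { dom := arr_mem.{v, u} κ
      cod := arr_mem.{v, u} μ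
      top := by
        change extensions.{v, u} C n (topMap.{v, u} f)
        rw [← h₂]; exact hE.comp hp (hE.stable hP hb)
      bottom := hb
      comparison := ⟨P, π₁, π₂, p, hP, h₁, h₂, hE.stable hP.flip (arr_mem.{v, u} μ),
        hE.stable hP hb, hp⟩ }

lemma comparison_mem' {κ μ : NExt.{v, u} C (n + 1)} {f : κ ⟶ μ}
    (hf : extensions.{v, u} C (n + 1) f) {P : NExt.{v, u} C n} {π₁ : P ⟶ bot.{v, u} κ}
    {π₂ : P ⟶ top.{v, u} μ} {p : top.{v, u} κ ⟶ P}
    (hP : IsPullback π₁ π₂ (botMap.{v, u} f) (arr.{v, u} μ)) (h₁ : p ≫ π₁ = arr.{v, u} κ)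
    (h₂ : p ≫ π₂ = topMap.{v, u} f) : extensions.{v, u} C n p := by
  obtain ⟨Q, q₁, q₂, q, hQ, e₁, e₂, hq⟩ := exists_comparison.{v, u} hf
  have : p = q ≫ (hQ.isoIsPullback _ _ hP).hom := by
    apply hP.hom_ext
    · rw [h₁, Category.assoc, IsPullback.isoIsPullback_hom_fst]; exact e₁.symm
    · rw [h₂, Category.assoc, IsPullback.isoIsPullback_hom_snd]; exact e₂.symm
  rw [this]
  exact hE.comp hq (hE.of_isIso _)

/-- Pullbacks are formed separately at domains and codomains; the point is that the induced arrow
`Pt ⟶ Pb` is an extension. It factors through `V`, the pullback of `bot κ` and `top ν` over `bot μ`,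
as a pullback of the comparison map of `f` followed by a pullback of the arrow of `ν`. -/
lemma exists_pullback_components {κ μ ν : NExt.{v, u} C (n + 1)} {f : κ ⟶ μ}
    (hf : extensions.{v, u} C (n + 1) f) (g : ν ⟶ μ) :
    ∃ (π : NExt.{v, u} C (n + 1)) (a : π ⟶ κ) (b : π ⟶ ν),
      IsPullback (topMap.{v, u} a) (topMap.{v, u} b) (topMap.{v, u} f) (topMap.{v, u} g) ∧
      IsPullback (botMap.{v, u} a) (botMap.{v, u} b) (botMap.{v, u} f) (botMap.{v, u} g) ∧
      extensions.{v, u} C (n + 1) b := by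
  obtain ⟨Pt, at', bt, hPt⟩ := hE.exists_pullback (topMap_mem.{v, u} hf) (topMap.{v, u} g)
  obtain ⟨Pb, ab, bb, hPb⟩ := hE.exists_pullback (botMap_mem.{v, u} hf) (botMap.{v, u} g)
  obtain ⟨K, k₁, k₂, hK⟩ := hE.exists_pullback (botMap_mem.{v, u} hf) (arr.{v, u} μ)
  obtain ⟨V, v₁, v₂, hV⟩ := hE.exists_pullback (hE.stable hK (botMap_mem.{v, u} hf))
    (topMap.{v, u} g)
  let k : top.{v, u} κ ⟶ K := hK.lift (arr.{v, u} κ) (topMap.{v, u} f) (w.{v, u} f).symm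
  have hk : extensions.{v, u} C n k :=
    comparison_mem'.{v, u} hE hf hK (hK.lift_fst _ _ _) (hK.lift_snd _ _ _)
  have hV' : IsPullback (v₁ ≫ k₁) v₂ (botMap.{v, u} f) (arr.{v, u} ν ≫ botMap.{v, u} g) := by
    rw [← w]; exact hV.paste_horiz hK
  let r : Pt ⟶ V := hV.lift (at' ≫ k) bt (by
    rw [Category.assoc, hK.lift_snd, hPt.w])
  have hr : IsPullback at' r k v₁ := by
    refine IsPullback.of_bot (v₂₁ := v₂) (v₂₂ := k₂) (h₃₁ := topMap.{v, u} g) ?_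
      (hV.lift_fst _ _ _).symm hV
    rw [hV.lift_snd, hK.lift_snd]
    exact hPt
  have hr' : extensions.{v, u} C n r := hE.stable hr hk
  let q : V ⟶ Pb := hPb.lift (v₁ ≫ k₁) (v₂ ≫ arr.{v, u} ν) (by
    rw [hV'.w, Category.assoc])
  have hq : IsPullback q v₂ bb (arr.{v, u} ν) := by
    refine IsPullback.of_right (h₁₂ := ab) (v₁₃ := botMap.{v, u} f) (h₂₂ := botMap.{v, u} g)
      ?_ (hPb.lift_snd _ _ _) hPb
    rw [hPb.lift_fst]
    exact hV'
  have hq' : extensions.{v, u} C n q := hE.stable hq.flip (arr_mem.{v, u} ν)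
  have ha : at' ≫ arr.{v, u} κ = (r ≫ q) ≫ ab := by
    rw [Category.assoc, hPb.lift_fst, hV.lift_fst_assoc, Category.assoc, hK.lift_fst]
  have hb : bt ≫ arr.{v, u} ν = (r ≫ q) ≫ bb := by
    rw [Category.assoc, hPb.lift_snd, hV.lift_snd_assoc]
  refine ⟨ofHom.{v, u} (r ≫ q) (hE.comp hr' hq'), homMk.{v, u} at' ab ha, homMk.{v, u} bt bb hb,
    hPt, hPb, ?_⟩
  exact mem_of_comparison'.{v, u} hE (P := V) (π₁ := q) (π₂ := v₂) (p := r)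
    (hE.stable hPb (botMap_mem.{v, u} hf)) hq rfl (hV.lift_snd _ _ _) hr'

lemma isPullback_components' {κ μ ν π : NExt.{v, u} C (n + 1)} {a : π ⟶ κ} {b : π ⟶ ν}
    {f : κ ⟶ μ} {g : ν ⟶ μ} (h : IsPullback a b f g) (hf : extensions.{v, u} C (n + 1) f) :
    (IsPullback (topMap.{v, u} a) (topMap.{v, u} b) (topMap.{v, u} f) (topMap.{v, u} g) ∧
      IsPullback (botMap.{v, u} a) (botMap.{v, u} b) (botMap.{v, u} f) (botMap.{v, u} g)) ∧
      (∃ (π' : NExt.{v, u} C (n + 1)) (e : π ⟶ π') (b' : π' ⟶ ν), IsIso e ∧ b = e ≫ b' ∧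
        extensions.{v, u} C (n + 1) b') := by
  obtain ⟨π', a', b', ht, hb, hb'⟩ := exists_pullback_components.{v, u} hE hf g
  have h' := isPullback_of_components.{v, u} ht hb
  let e := h.isoIsPullback _ _ h'
  have ea : a = e.hom ≫ a' := (h.isoIsPullback_hom_fst _ _ h').symm
  have eb : b = e.hom ≫ b' := (h.isoIsPullback_hom_snd _ _ h').symm
  refine ⟨⟨?_, ?_⟩, π', e.hom, b', inferInstance, eb, hb'⟩
  · exact ht.of_iso' (asIso (topMap.{v, u} e.hom)) (Iso.refl _) (Iso.refl _) (Iso.refl _)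
      (by simp [ea]) (by simp [eb]) (by simp) (by simp)
  · exact hb.of_iso' (asIso (botMap.{v, u} e.hom)) (Iso.refl _) (Iso.refl _) (Iso.refl _)
      (by simp [ea]) (by simp [eb]) (by simp) (by simp)

theorem isExtensionClass_succ : IsExtensionClass (extensions.{v, u} C (n + 1)) := by
  have hiso : ∀ {κ μ : NExt.{v, u} C (n + 1)} (f : κ ⟶ μ) [IsIso f],
      extensions.{v, u} C (n + 1) f := fun {κ μ} f _ =>
    mem_of_comparison'.{v, u} hE (hE.of_isIso (botMap.{v, u} f)) (P := top.{v, u} κ)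
      (π₁ := arr.{v, u} κ) (π₂ := topMap.{v, u} f) (p := 𝟙 _)
      (IsPullback.of_vert_isIso ⟨(w.{v, u} f).symm⟩) (by simp) (by simp) (hE.of_isIso _)
  have hcomp : ∀ {κ μ ν : NExt.{v, u} C (n + 1)} {f : κ ⟶ μ} {g : μ ⟶ ν},
      extensions.{v, u} C (n + 1) f → extensions.{v, u} C (n + 1) g →
      extensions.{v, u} C (n + 1) (f ≫ g) := by
    intro κ μ ν f g hf hg
    obtain ⟨Q, q₁, q₂, hQ⟩ := hE.exists_pullback (botMap_mem.{v, u} hg) (arr.{v, u} ν)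
    let q : top.{v, u} μ ⟶ Q := hQ.lift (arr.{v, u} μ) (topMap.{v, u} g) (w.{v, u} g).symm
    have hq : extensions.{v, u} C n q :=
      comparison_mem'.{v, u} hE hg hQ (hQ.lift_fst _ _ _) (hQ.lift_snd _ _ _)
    obtain ⟨R, r₁, r₂, hR⟩ := hE.exists_pullback (botMap_mem.{v, u} hf) q₁
    obtain ⟨P, p₁, p₂, hP⟩ := hE.exists_pullback (botMap_mem.{v, u} hf) (arr.{v, u} μ)
    let p : top.{v, u} κ ⟶ P := hP.lift (arr.{v, u} κ) (topMap.{v, u} f) (w.{v, u} f).symm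
    have hp : extensions.{v, u} C n p :=
      comparison_mem'.{v, u} hE hf hP (hP.lift_fst _ _ _) (hP.lift_snd _ _ _)
    let s : P ⟶ R := hR.lift p₁ (p₂ ≫ q) (by rw [hP.w, Category.assoc, hQ.lift_fst])
    -- `R` is the comparison object of `f ≫ g`, and the passage from `P` to `R` is a pullback of the
    -- comparison map of `g`.
    have hs : IsPullback p₂ s q r₂ := by
      refine IsPullback.of_bot (v₂₁ := r₁) (v₂₂ := q₁) (h₃₁ := botMap.{v, u} f) ?_
        (hR.lift_snd _ _ _).symm hR.flip
      rw [hR.lift_fst, hQ.lift_fst]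
      exact hP.flip
    have hPQ : IsPullback r₁ (r₂ ≫ q₂) (botMap.{v, u} (f ≫ g)) (arr.{v, u} ν) := by
      rw [botMap_comp]
      exact (hR.flip.paste_horiz hQ.flip).flip
    refine mem_of_comparison'.{v, u} hE (hE.comp (botMap_mem.{v, u} hf) (botMap_mem.{v, u} hg))
      hPQ (p := p ≫ s) ?_ ?_ (hE.comp hp (hE.stable hs hq))
    · rw [Category.assoc, hR.lift_fst, hP.lift_fst]
    · rw [Category.assoc, hR.lift_snd_assoc, Category.assoc, hQ.lift_snd, hP.lift_snd_assoc,
        topMap_comp]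
  refine ⟨hiso, hcomp, ?_, ?_, ?_, ?_, ?_⟩
  · intro κ μ ν f hf g
    obtain ⟨π, a, b, ht, hb, -⟩ := exists_pullback_components.{v, u} hE hf g
    exact ⟨π, a, b, isPullback_of_components.{v, u} ht hb⟩
  · intro κ μ ν π a b f g h hf
    obtain ⟨-, π', e, b', he, rfl, hb'⟩ := isPullback_components'.{v, u} hE h hf
    exact hcomp (hiso e) hb'
  · intro κ μ ν f g hf hfg
    have hb : extensions.{v, u} C n (botMap.{v, u} g) :=
      hE.cancel (botMap_mem.{v, u} hf) (botMap_mem.{v, u} hfg)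
    obtain ⟨Q, q₁, q₂, hQ⟩ := hE.exists_pullback hb (arr.{v, u} ν)
    let q : top.{v, u} μ ⟶ Q := hQ.lift (arr.{v, u} μ) (topMap.{v, u} g) (w.{v, u} g).symm
    refine mem_of_comparison'.{v, u} hE hb hQ (p := q) (hQ.lift_fst _ _ _) (hQ.lift_snd _ _ _) ?_
    obtain ⟨R, r₁, r₂, hR⟩ := hE.exists_pullback (botMap_mem.{v, u} hf) q₁
    have hPQ : IsPullback r₁ (r₂ ≫ q₂) (botMap.{v, u} (f ≫ g)) (arr.{v, u} ν) := by
      rw [botMap_comp]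
      exact (hR.flip.paste_horiz hQ.flip).flip
    let r : top.{v, u} κ ⟶ R := hR.lift (arr.{v, u} κ) (topMap.{v, u} f ≫ q) (by
      rw [Category.assoc, hQ.lift_fst, w])
    have hr : extensions.{v, u} C n r := by
      refine comparison_mem'.{v, u} hE hfg hPQ (hR.lift_fst _ _ _) ?_
      rw [hR.lift_snd_assoc, Category.assoc, hQ.lift_snd, topMap_comp]
    -- The comparison map `r` of `f ≫ g`, followed by the pullback `r₂` of `botMap f`, equals
    -- `topMap f ≫ q`; cancelling `topMap f` leaves `q`.
    refine hE.cancel (topMap_mem.{v, u} hf) ?_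
    rw [← hR.lift_snd (arr.{v, u} κ) (topMap.{v, u} f ≫ q) (by rw [Category.assoc, hQ.lift_fst, w])]
    exact hE.comp hr (hE.stable hR (botMap_mem.{v, u} hf))
  · intro κ μ ν π a b f g h hg _
    obtain ⟨⟨ht, hb⟩, -⟩ := isPullback_components'.{v, u} hE h.flip hg
    exact isIso_of_components.{v, u} f
      (hE.isIso_of_isPullback ht.flip (topMap_mem.{v, u} hg) inferInstance)
      (hE.isIso_of_isPullback hb.flip (botMap_mem.{v, u} hg) inferInstance)
  · intro κ μ f hf
    have := hE.epi (topMap_mem.{v, u} hf)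
    have := hE.epi (botMap_mem.{v, u} hf)
    refine ⟨fun g h e => hom_ext.{v, u} ?_ ?_⟩
    · rw [← cancel_epi (topMap.{v, u} f)]
      simpa using congrArg topMap.{v, u} e
    · rw [← cancel_epi (botMap.{v, u} f)]
      simpa using congrArg botMap.{v, u} e

end Step

variable [Regular C]

/-- The class of `(n + 1)`-fold extensions over a regular category has good closure properties. -/
theorem isExtensionClass : ∀ n : ℕ, IsExtensionClass (extensions.{v, u} C n)
  | 0 => isExtensionClass_regularEpi (C := C)
  | n + 1 => isExtensionClass_succ.{v, u} (isExtensionClass n)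

end NExt

/-! ### Trivial coverings and coverings -/

namespace GaloisStructure

variable {Y : Type u} [Category.{v} Y] {E : MorphismProperty Y} (Γ : GaloisStructure Y E)

/-- A reflection of `c` in the reflective subcategory. -/
def IsReflection {c e : Y} (f : c ⟶ e) : Prop :=
  Γ.X e ∧ ∀ ⦃b : Y⦄, Γ.X b → ∀ g : c ⟶ b, ∃! h : e ⟶ b, f ≫ h = g

lemma X_refl (A : Y) : Γ.X (Γ.refl A) := (Γ.L.obj A).property

lemma unit_naturality {A B : Y} (f : A ⟶ B) : Γ.unit A ≫ Γ.reflMap f = f ≫ Γ.unit B :=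
  (Γ.adj.unit.naturality f).symm

lemma unit_naturality_assoc {A B D : Y} (f : A ⟶ B) (g : Γ.refl B ⟶ D) :
    Γ.unit A ≫ Γ.reflMap f ≫ g = f ≫ Γ.unit B ≫ g := by
  rw [← Category.assoc, unit_naturality, Category.assoc]

lemma reflMap_comp {A B D : Y} (f : A ⟶ B) (g : B ⟶ D) :
    Γ.reflMap (f ≫ g) = Γ.reflMap f ≫ Γ.reflMap g := by
  simp only [reflMap, Functor.map_comp]
  rfl

lemma isReflection_unit (A : Y) : Γ.IsReflection (Γ.unit A) := by
  refine ⟨Γ.X_refl A, fun b hb g => ?_⟩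
  let e := Γ.adj.homEquiv A (⟨b, hb⟩ : Γ.X.FullSubcategory)
  have he : ∀ k : Γ.L.obj A ⟶ ⟨b, hb⟩, Γ.unit A ≫ Γ.X.ι.map k = e k := fun k =>
    (Γ.adj.homEquiv_unit _ _ k).symm
  refine ⟨Γ.X.ι.map (e.symm g), (he _).trans (e.apply_symm_apply g), fun h hh => ?_⟩
  have h1 : e (ObjectProperty.homMk h) = g := (he _).symm.trans hh
  rw [← h1, Equiv.symm_apply_apply]
  rfl

variable {Γ}

lemma IsReflection.hom_ext {c e b : Y} {f : c ⟶ e} (hf : Γ.IsReflection f) (hb : Γ.X b)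
    {h k : e ⟶ b} (hk : f ≫ h = f ≫ k) : h = k :=
  (hf.2 hb (f ≫ k)).unique hk rfl

lemma IsReflection.exists_iso {c e e' : Y} {f : c ⟶ e} {f' : c ⟶ e'} (hf : Γ.IsReflection f)
    (hf' : Γ.IsReflection f') : ∃ θ : e ≅ e', f ≫ θ.hom = f' := by
  obtain ⟨h, hh, -⟩ := hf.2 hf'.1 f'
  obtain ⟨k, hk, -⟩ := hf'.2 hf.1 f
  exact ⟨⟨h, k, hf.hom_ext hf.1 (by rw [reassoc_of% hh, hk, Category.comp_id]),
    hf'.hom_ext hf'.1 (by rw [reassoc_of% hk, hh, Category.comp_id])⟩, hh⟩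

lemma IsReflection.of_isIso {c : Y} {e : Y} (f : c ⟶ e) [IsIso f] (he : Γ.X e) :
    Γ.IsReflection f :=
  ⟨he, fun _ _ g => ⟨inv f ≫ g, by simp, fun h hh => by simp [← hh]⟩⟩

lemma IsReflection.isIso {c e : Y} {f : c ⟶ e} (hf : Γ.IsReflection f) (hc : Γ.X c) :
    IsIso f := by
  obtain ⟨θ, hθ⟩ := hf.exists_iso (IsReflection.of_isIso (𝟙 c) hc)
  rw [(Iso.comp_hom_eq_id θ).1 hθ]; infer_instance

lemma IsReflection.iso_comp {b c e : Y} {f : c ⟶ e} (hf : Γ.IsReflection f) (i : b ⟶ c) [IsIso i] :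
    Γ.IsReflection (i ≫ f) :=
  ⟨hf.1, fun _ hb g => by
    obtain ⟨h, hh, hu⟩ := hf.2 hb (inv i ≫ g)
    exact ⟨h, by simp only [Category.assoc, hh, IsIso.hom_inv_id_assoc],
      fun k hk => hu k (by simp only [← hk, Category.assoc, IsIso.inv_hom_id_assoc])⟩⟩

section

variable (hE : IsExtensionClass E)
include hE

lemma IsReflection.mem {c e : Y} {f : c ⟶ e} (hf : Γ.IsReflection f) : E f := by
  obtain ⟨θ, hθ⟩ := (Γ.isReflection_unit c).exists_iso hf
  rw [← hθ]
  exact hE.comp (Γ.unit_mem c) (hE.of_isIso _)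

end

section

variable (hΓ : Γ.StronglyBirkhoff)
include hΓ

lemma reflMap_mem {A B : Y} {f : A ⟶ B} (hf : E f) : E (Γ.reflMap f) := (hΓ f hf).cod

lemma exists_reflection_comparison {A S : Y} {t : A ⟶ S} (ht : E t) :
    ∃ (P : Y) (π₁ : P ⟶ S) (π₂ : P ⟶ Γ.refl A) (p : A ⟶ P),
      IsPullback π₁ π₂ (Γ.unit S) (Γ.reflMap t) ∧ p ≫ π₁ = t ∧ p ≫ π₂ = Γ.unit A ∧ E p := by
  obtain ⟨P, π₁, π₂, p, hP, h₁, h₂, -, -, hp⟩ := (hΓ t ht).comparison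
  exact ⟨P, π₁, π₂, p, hP, h₁, h₂, hp⟩

variable (hE : IsExtensionClass E)
include hE

/-- An extension is a trivial covering as soon as it is jointly monic with some morphism to the
reflective subcategory. -/
lemma isTrivialCovering_of_jointly_mono {A S X : Y} {t : A ⟶ S} (ht : E t) (x : A ⟶ X) (hX : Γ.X X)
    (hm : ∀ {R : Y} (a b : R ⟶ A), a ≫ t = b ≫ t → a ≫ x = b ≫ x → a = b) :
    Γ.IsTrivialCovering t := by
  obtain ⟨P, π₁, π₂, p, hP, h₁, h₂, hp⟩ := exists_reflection_comparison hΓ ht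
  obtain ⟨y, hy, -⟩ := (Γ.isReflection_unit A).2 hX x
  -- Since `x` factors through the unit, the comparison map `p` is monic, and a monic extension is
  -- invertible.
  have : IsIso p := hE.isIso_of_mono hp fun a b hab => hm a b
    (by rw [← h₁, reassoc_of% hab]) (by rw [← hy, ← h₂, Category.assoc, reassoc_of% hab])
  exact ⟨ht, (hP.of_iso' (asIso p) (Iso.refl _) (Iso.refl _) (Iso.refl _) (by simp [h₁])
    (by simp [h₂]) (by simp) (by simp)).flip⟩

lemma isTrivialCovering_of_mem {A B : Y} {f : A ⟶ B} (hf : E f) (hA : Γ.X A) :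
    Γ.IsTrivialCovering f :=
  isTrivialCovering_of_jointly_mono hΓ hE hf (𝟙 A) hA fun a b _ h => by simpa using h

lemma isTrivialCovering_of_isIso {A B : Y} (f : A ⟶ B) [IsIso f] : Γ.IsTrivialCovering f :=
  isTrivialCovering_of_jointly_mono hΓ hE (hE.of_isIso f) (Γ.unit A) (Γ.X_refl A)
    fun _ _ h _ => (cancel_mono f).1 h

lemma IsTrivialCovering.of_isPullback {A B A' B' : Y} {f : A ⟶ B} {f' : A' ⟶ B'} {a : A' ⟶ A}
    {b : B' ⟶ B} (h : IsPullback a f' f b) (hf : Γ.IsTrivialCovering f) :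
    Γ.IsTrivialCovering f' :=
  isTrivialCovering_of_jointly_mono hΓ hE (hE.stable h hf.1) (a ≫ Γ.unit A) (Γ.X_refl A)
    fun x y h₁ h₂ => h.hom_ext (hf.2.hom_ext (by simpa using h₂)
      (by rw [Category.assoc, Category.assoc, h.w, reassoc_of% h₁])) h₁

lemma IsTrivialCovering.comp {A B D : Y} {f : A ⟶ B} {g : B ⟶ D} (hf : Γ.IsTrivialCovering f)
    (hg : Γ.IsTrivialCovering g) : Γ.IsTrivialCovering (f ≫ g) :=
  isTrivialCovering_of_jointly_mono hΓ hE (hE.comp hf.1 hg.1) (Γ.unit A) (Γ.X_refl A)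
    fun x y h₁ h₂ => hf.2.hom_ext h₂ (hg.2.hom_ext
      (by rw [Category.assoc, Category.assoc, ← unit_naturality, reassoc_of% h₂])
      (by simpa using h₁))

/-- Let `j` compare `B` with the pullback `Q` that tests triviality of `g`. Triviality of `f`
exhibits `b` as the pullback of `j` along `W ⟶ Q`, and triviality of `f ≫ g` makes `b` invertible.
As `W ⟶ Q` is a pullback of the reflection of `f`, it is an extension, so `j` is invertible too. -/
lemma IsTrivialCovering.of_comp {A B D : Y} {f : A ⟶ B} {g : B ⟶ D} (hf : Γ.IsTrivialCovering f)
    (hfg : Γ.IsTrivialCovering (f ≫ g)) : Γ.IsTrivialCovering g := by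
  have hg : E g := hE.cancel hf.1 hfg.1
  obtain ⟨Q, q₁, q₂, hQ⟩ := hE.exists_pullback (reflMap_mem hΓ hg) (Γ.unit D)
  let j : B ⟶ Q := hQ.lift (Γ.unit B) g (Γ.unit_naturality g)
  obtain ⟨W, w₁, w₂, hW⟩ := hE.exists_pullback (reflMap_mem hΓ hf.1) q₁
  let b : A ⟶ W := hW.lift (Γ.unit A) (f ≫ j) (by
    rw [unit_naturality, Category.assoc, hQ.lift_fst])
  have h₁ : IsPullback b f w₂ j := by
    refine IsPullback.of_right (h₁₂ := w₁) (v₁₃ := Γ.reflMap f) (h₂₂ := q₁) ?_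
      (hW.lift_snd _ _ _) hW
    rw [hW.lift_fst, hQ.lift_fst]
    exact hf.2
  have h₂ : IsPullback w₁ (w₂ ≫ q₂) (Γ.reflMap (f ≫ g)) (Γ.unit D) := by
    rw [reflMap_comp]
    exact hW.paste_vert hQ
  have h₃ : b = (hfg.2.isoIsPullback _ _ h₂).hom := by
    apply h₂.hom_ext
    · rw [hW.lift_fst, IsPullback.isoIsPullback_hom_fst]
    · rw [hW.lift_snd_assoc, Category.assoc, hQ.lift_snd, IsPullback.isoIsPullback_hom_snd]
  have : IsIso b := by rw [h₃]; infer_instance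
  have : IsIso j := hE.isIso_of_isPullback h₁.flip (hE.stable hW (reflMap_mem hΓ hf.1)) this
  exact ⟨hg, hQ.of_iso' (asIso j) (Iso.refl _) (Iso.refl _) (Iso.refl _)
    (by simpa using hQ.lift_fst _ _ _) (by simpa using hQ.lift_snd _ _ _) (by simp) (by simp)⟩

omit hΓ hE in
lemma IsTrivialCovering.isPullback {A B A' B' : Y} {f : A ⟶ B} (hf : Γ.IsTrivialCovering f)
    {a : A ⟶ A'} {b : B ⟶ B'} {f' : A' ⟶ B'} (ha : Γ.IsReflection a) (hb : Γ.IsReflection b)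
    (h : a ≫ f' = f ≫ b) : IsPullback a f f' b := by
  obtain ⟨θ, hθ⟩ := (Γ.isReflection_unit A).exists_iso ha
  obtain ⟨χ, hχ⟩ := (Γ.isReflection_unit B).exists_iso hb
  refine hf.2.of_iso (Iso.refl _) θ (Iso.refl _) χ (by simp [hθ]) (by simp) ?_ (by simp [hχ])
  refine (Γ.isReflection_unit A).hom_ext hb.1 ?_
  rw [unit_naturality_assoc, hχ, reassoc_of% hθ, h]

omit hΓ in
lemma IsTrivialCovering.isCovering {A B : Y} {f : A ⟶ B}
    (hf : Γ.IsTrivialCovering f) : Γ.IsCovering f :=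
  ⟨hf.1, B, 𝟙 B, hE.of_isIso _, A, f, 𝟙 A, IsPullback.of_horiz_isIso ⟨by simp⟩, hf⟩

lemma IsCovering.of_isPullback {A B A' B' : Y} {f : A ⟶ B} {f' : A' ⟶ B'} {a : A' ⟶ A}
    {b : B' ⟶ B} (h : IsPullback a f' f b) (hf : Γ.IsCovering f) : Γ.IsCovering f' := by
  obtain ⟨hf₀, S, e, he, P, t, x, hP, ht⟩ := hf
  have hf' := hE.stable h hf₀
  obtain ⟨S', s₁, s₂, hS⟩ := hE.exists_pullback he b
  obtain ⟨P', x', t', hP'⟩ := hE.exists_pullback hf' s₂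
  refine ⟨hf', S', s₂, hE.stable hS he, P', t', x', hP', ?_⟩
  have h₁ : IsPullback (x' ≫ a) t' f (s₁ ≫ e) := by
    rw [hS.w]; exact hP'.paste_horiz h
  exact IsTrivialCovering.of_isPullback hΓ hE (IsPullback.of_right' h₁ hP) ht

omit hΓ in
lemma IsCovering.of_isPullback_of_mem {A B A' B' : Y} {f : A ⟶ B} {f' : A' ⟶ B'} {a : A' ⟶ A}
    {b : B' ⟶ B} (h : IsPullback a f' f b) (hf : E f) (hb : E b) (hf' : Γ.IsCovering f') :
    Γ.IsCovering f := by
  obtain ⟨-, S, e, he, P, t, x, hP, ht⟩ := hf'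
  exact ⟨hf, S, e ≫ b, hE.comp he hb, P, t, x ≫ a, hP.paste_horiz h, ht⟩

lemma IsTrivialCovering.comp_isCovering {A B D : Y} {f : A ⟶ B} {g : B ⟶ D}
    (hf : Γ.IsTrivialCovering f) (hg : Γ.IsCovering g) : Γ.IsCovering (f ≫ g) := by
  obtain ⟨hg₀, S, e, he, P, t, x, hP, ht⟩ := hg
  obtain ⟨Q, q₁, q₂, hQ⟩ := hE.exists_pullback hf.1 x
  exact ⟨hE.comp hf.1 hg₀, S, e, he, Q, q₂ ≫ t, q₁, hQ.paste_vert hP,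
    IsTrivialCovering.comp hΓ hE (IsTrivialCovering.of_isPullback hΓ hE hQ hf) ht⟩

lemma IsTrivialCovering.isCovering_of_comp {A B D : Y} {f : A ⟶ B} {g : B ⟶ D}
    (hf : Γ.IsTrivialCovering f) (hfg : Γ.IsCovering (f ≫ g)) : Γ.IsCovering g := by
  obtain ⟨hfg₀, S, e, he, P, t, x, hP, ht⟩ := hfg
  have hg : E g := hE.cancel hf.1 hfg₀
  obtain ⟨Q, q₁, q₂, hQ⟩ := hE.exists_pullback hg e
  refine ⟨hg, S, e, he, Q, q₂, q₁, hQ, ?_⟩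
  have h₁ : IsPullback x (hQ.lift (x ≫ f) t (by rw [Category.assoc, hP.w])) f q₁ :=
    IsPullback.of_bot' hP hQ
  refine IsTrivialCovering.of_comp hΓ hE (IsTrivialCovering.of_isPullback hΓ hE h₁ hf) ?_
  rwa [hQ.lift_snd]

/-- The reflection square at an extension, for arbitrary choices of the reflections. -/
lemma isDoubleExtension_of_isReflection {A B A' B' : Y} {f : A ⟶ B} (hf : E f)
    {a : A ⟶ A'} {b : B ⟶ B'} {f' : A' ⟶ B'} (ha : Γ.IsReflection a) (hb : Γ.IsReflection b)
    (h : a ≫ f' = f ≫ b) :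
    E f' ∧ ∃ (P : Y) (π₁ : P ⟶ B) (π₂ : P ⟶ A') (p : A ⟶ P),
      IsPullback π₁ π₂ b f' ∧ p ≫ π₁ = f ∧ p ≫ π₂ = a ∧ E p := by
  obtain ⟨θ, hθ⟩ := (Γ.isReflection_unit A).exists_iso ha
  obtain ⟨χ, hχ⟩ := (Γ.isReflection_unit B).exists_iso hb
  have hf' : f' = θ.inv ≫ Γ.reflMap f ≫ χ.hom := by
    rw [Iso.eq_inv_comp]
    refine (Γ.isReflection_unit A).hom_ext hb.1 ?_
    rw [unit_naturality_assoc, hχ, reassoc_of% hθ, h]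
  refine ⟨?_, ?_⟩
  · rw [hf']
    exact hE.comp (hE.of_isIso _) (hE.comp (reflMap_mem hΓ hf) (hE.of_isIso _))
  · obtain ⟨P, π₁, π₂, p, hP, h₁, h₂, hp⟩ := exists_reflection_comparison hΓ hf
    refine ⟨P, π₁, π₂ ≫ θ.hom, p, ?_, h₁, by rw [reassoc_of% h₂, hθ], hp⟩
    exact hP.of_iso (Iso.refl _) (Iso.refl _) θ χ (by simp) (by simp) (by simp [hχ]) (by simp [hf'])

end

end GaloisStructure

/-! ### Comparison maps of composites and of pullbacks -/

namespace NExt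

variable {C : Type (max u v)} [Category.{v} C]


section Comparison

variable [Regular C] {n : ℕ}

lemma mem_of_comparison {κ μ : NExt.{v, u} C (n + 1)} {f : κ ⟶ μ}
    (hb : extensions.{v, u} C n (botMap f)) {P : NExt.{v, u} C n} {π₁ : P ⟶ bot κ} {π₂ : P ⟶ top μ} {p : top κ ⟶ P}
    (hP : IsPullback π₁ π₂ (botMap f) (arr μ)) (h₁ : p ≫ π₁ = arr κ) (h₂ : p ≫ π₂ = topMap f)
    (hp : extensions.{v, u} C n p) : extensions.{v, u} C (n + 1) f :=
  mem_of_comparison'.{v, u} (isExtensionClass n) hb hP h₁ h₂ hp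

lemma comparison_mem {κ μ : NExt.{v, u} C (n + 1)} {f : κ ⟶ μ} (hf : extensions.{v, u} C (n + 1) f)
    {P : NExt.{v, u} C n} {π₁ : P ⟶ bot κ} {π₂ : P ⟶ top μ} {p : top κ ⟶ P}
    (hP : IsPullback π₁ π₂ (botMap f) (arr μ)) (h₁ : p ≫ π₁ = arr κ) (h₂ : p ≫ π₂ = topMap f) :
    extensions.{v, u} C n p :=
  comparison_mem'.{v, u} (isExtensionClass n) hf hP h₁ h₂

lemma isPullback_topMap {κ μ ν π : NExt.{v, u} C (n + 1)} {a : π ⟶ κ} {b : π ⟶ ν}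
    {f : κ ⟶ μ} {g : ν ⟶ μ} (h : IsPullback a b f g) (hf : extensions.{v, u} C (n + 1) f) :
    IsPullback (topMap a) (topMap b) (topMap f) (topMap g) :=
  (isPullback_components'.{v, u} (isExtensionClass n) h hf).1.1

lemma isPullback_botMap {κ μ ν π : NExt.{v, u} C (n + 1)} {a : π ⟶ κ} {b : π ⟶ ν}
    {f : κ ⟶ μ} {g : ν ⟶ μ} (h : IsPullback a b f g) (hf : extensions.{v, u} C (n + 1) f) :
    IsPullback (botMap a) (botMap b) (botMap f) (botMap g) :=
  (isPullback_components'.{v, u} (isExtensionClass n) h hf).1.2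

/-- The comparison map of a composite. -/
lemma exists_comparison_comp {κ μ ν : NExt.{v, u} C (n + 1)} {f : κ ⟶ μ} {g : μ ⟶ ν} (hf : extensions.{v, u} C n (botMap f))
    {P : NExt.{v, u} C n} {p₁ : P ⟶ bot κ} {p₂ : P ⟶ top μ} {p : top κ ⟶ P}
    (hP : IsPullback p₁ p₂ (botMap f) (arr μ)) (hp₁ : p ≫ p₁ = arr κ) (hp₂ : p ≫ p₂ = topMap f)
    {Q : NExt.{v, u} C n} {q₁ : Q ⟶ bot μ} {q₂ : Q ⟶ top ν} {q : top μ ⟶ Q}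
    (hQ : IsPullback q₁ q₂ (botMap g) (arr ν)) (hq₁ : q ≫ q₁ = arr μ) (hq₂ : q ≫ q₂ = topMap g) :
    ∃ (R : NExt.{v, u} C n) (r₁ : R ⟶ bot κ) (r₂ : R ⟶ top ν) (s : P ⟶ R) (y : R ⟶ Q),
      IsPullback r₁ r₂ (botMap (f ≫ g)) (arr ν) ∧ (p ≫ s) ≫ r₁ = arr κ ∧
      (p ≫ s) ≫ r₂ = topMap (f ≫ g) ∧ IsPullback p₂ s q y := by
  obtain ⟨R, r₁, r₂, hR⟩ := (isExtensionClass n).exists_pullback hf q₁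
  let s : P ⟶ R := hR.lift p₁ (p₂ ≫ q) (by rw [hP.w, Category.assoc, hq₁])
  refine ⟨R, r₁, r₂ ≫ q₂, s, r₂, ?_, ?_, ?_, ?_⟩
  · rw [botMap_comp]
    exact (hR.flip.paste_horiz hQ.flip).flip
  · rw [Category.assoc, hR.lift_fst, hp₁]
  · rw [Category.assoc, hR.lift_snd_assoc, Category.assoc, hq₂, reassoc_of% hp₂, topMap_comp]
  · refine IsPullback.of_bot (v₂₁ := r₁) (v₂₂ := q₁) (h₃₁ := botMap f) ?_
      (hR.lift_snd _ _ _).symm hR.flip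
    rw [hR.lift_fst, hq₁]
    exact hP.flip

/-- The comparison map of a pullback. -/
lemma exists_comparison_pullback {κ μ ν π : NExt.{v, u} C (n + 1)} {a : π ⟶ κ} {b : π ⟶ ν}
    {f : κ ⟶ μ} {g : ν ⟶ μ} (h : IsPullback a b f g) (hf : extensions.{v, u} C (n + 1) f)
    {K : NExt.{v, u} C n} {k₁ : K ⟶ bot κ} {k₂ : K ⟶ top μ} {k : top κ ⟶ K}
    (hK : IsPullback k₁ k₂ (botMap f) (arr μ)) (hk₁ : k ≫ k₁ = arr κ) (hk₂ : k ≫ k₂ = topMap f) :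
    ∃ (V : NExt.{v, u} C n) (q₁ : V ⟶ bot π) (q₂ : V ⟶ top ν) (r : top π ⟶ V) (z : V ⟶ K),
      IsPullback q₁ q₂ (botMap b) (arr ν) ∧ r ≫ q₁ = arr π ∧ r ≫ q₂ = topMap b ∧
      IsPullback (topMap a) r k z ∧ IsPullback z q₂ k₂ (topMap g) := by
  have hPt := isPullback_topMap h hf
  have hPb := isPullback_botMap h hf
  obtain ⟨V, v₁, v₂, hV⟩ := (isExtensionClass n).exists_pullback
    ((isExtensionClass n).stable hK (botMap_mem hf)) (topMap g)
  have hV' : IsPullback (v₁ ≫ k₁) v₂ (botMap f) (arr ν ≫ botMap g) := by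
    rw [← w]; exact hV.paste_horiz hK
  let r : top π ⟶ V := hV.lift (topMap a ≫ k) (topMap b) (by
    rw [Category.assoc, hk₂, hPt.w])
  let q : V ⟶ bot π := hPb.lift (v₁ ≫ k₁) (v₂ ≫ arr ν) (by rw [hV'.w, Category.assoc])
  refine ⟨V, q, v₂, r, v₁, ?_, ?_, hV.lift_snd _ _ _, ?_, hV⟩
  · refine IsPullback.of_right (h₁₂ := botMap a) (v₁₃ := botMap f) (h₂₂ := botMap g)
      ?_ (hPb.lift_snd _ _ _) hPb
    rw [hPb.lift_fst]
    exact hV'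
  · apply hPb.hom_ext
    · rw [Category.assoc, hPb.lift_fst, hV.lift_fst_assoc, Category.assoc, hk₁, w]
    · rw [Category.assoc, hPb.lift_snd, hV.lift_snd_assoc, w]
  · refine IsPullback.of_bot (v₂₁ := v₂) (v₂₂ := k₂) (h₃₁ := topMap g) ?_
      (hV.lift_fst _ _ _).symm hV
    rw [hV.lift_snd, hk₂]
    exact hPt

end Comparison

/-! ### Discrete fibrations, inductively -/

variable (C) in
/-- The class of discrete fibrations of order `n + 1`, described inductively: a morphism of
`(n + 1)`-fold extensions is a discrete fibration if it is an extension, and its comparison map is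
a discrete fibration. -/
def discFib : ∀ n : ℕ, MorphismProperty (NExt.{v, u} C n)
  | 0 => MorphismProperty.isomorphisms (NExt.{v, u} C 0)
  | n + 1 => fun κ μ f => extensions.{v, u} C (n + 1) f ∧
      ∃ (P : NExt.{v, u} C n) (π₁ : P ⟶ bot κ) (π₂ : P ⟶ top μ) (p : top κ ⟶ P),
        IsPullback π₁ π₂ (botMap f) (arr μ) ∧ p ≫ π₁ = arr κ ∧ p ≫ π₂ = topMap f ∧ discFib n p


/-- The closure properties of discrete fibrations. -/
structure DiscFibProps (C : Type (max u v)) [Category.{v} C] (n : ℕ) : Prop where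
  of_isIso : ∀ {κ μ : NExt.{v, u} C n} (f : κ ⟶ μ) [IsIso f], discFib.{v, u} C n f
  mem : ∀ {κ μ : NExt.{v, u} C n} {f : κ ⟶ μ}, discFib.{v, u} C n f → extensions.{v, u} C n f
  comp : ∀ {κ μ ν : NExt.{v, u} C n} {f : κ ⟶ μ} {g : μ ⟶ ν}, discFib.{v, u} C n f → discFib.{v, u} C n g → discFib.{v, u} C n (f ≫ g)
  stable : ∀ {κ μ ν π : NExt.{v, u} C n} {a : π ⟶ κ} {b : π ⟶ ν} {f : κ ⟶ μ} {g : ν ⟶ μ},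
    IsPullback a b f g → discFib.{v, u} C n f → discFib.{v, u} C n b
  cancel : ∀ {κ μ ν : NExt.{v, u} C n} {f : κ ⟶ μ} {g : μ ⟶ ν}, discFib.{v, u} C n (f ≫ g) → discFib.{v, u} C n g → extensions.{v, u} C n f → discFib.{v, u} C n f
  descend : ∀ {κ μ ν π : NExt.{v, u} C n} {a : π ⟶ κ} {b : π ⟶ ν} {f : κ ⟶ μ} {g : ν ⟶ μ},
    IsPullback a b f g → extensions.{v, u} C n g → extensions.{v, u} C n f → discFib.{v, u} C n b → discFib.{v, u} C n f

variable [Regular C]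

/-- The comparison map of a composite is that of `f` followed by a pullback of that of `g`, and the
comparison map of a pullback of `f` is a pullback of that of `f`. So each closure property follows
from the closure properties one dimension lower. -/
theorem discFibProps : ∀ n : ℕ, DiscFibProps.{v, u} C n
  | 0 =>
    { of_isIso := fun f hf => hf
      mem := fun {_ _ f} hf => by
        have : IsIso f := hf
        exact (isExtensionClass 0).of_isIso f
      comp := fun {_ _ _ f g} hf hg => by
        have : IsIso f := hf
        have : IsIso g := hg
        exact (inferInstance : IsIso (f ≫ g))
      stable := fun {_ _ _ _ a b f g} h hf => by
        have : IsIso f := hf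
        exact (h.isIso_snd_of_isIso : IsIso b)
      cancel := fun {_ _ _ f g} hfg hg _ => by
        have : IsIso g := hg
        have : IsIso (f ≫ g) := hfg
        exact IsIso.of_isIso_comp_right f g
      descend := fun h hg _ hb => (isExtensionClass 0).isIso_of_isPullback h hg hb }
  | n + 1 => by
    have ih := discFibProps n
    have hE := isExtensionClass.{v, u} (C := C) n
    have hE' := isExtensionClass.{v, u} (C := C) (n + 1)
    have hcmp : ∀ {κ μ : NExt.{v, u} C (n + 1)} {f : κ ⟶ μ} (_ : discFib.{v, u} C (n + 1) f) {P : NExt.{v, u} C n} {π₁ : P ⟶ bot κ}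
        {π₂ : P ⟶ top μ} {p : top κ ⟶ P} (_ : IsPullback π₁ π₂ (botMap f) (arr μ))
        (_ : p ≫ π₁ = arr κ) (_ : p ≫ π₂ = topMap f), discFib.{v, u} C n p := by
      rintro κ μ f ⟨hf, Q, q₁, q₂, q, hQ, e₁, e₂, hq⟩ P π₁ π₂ p hP h₁ h₂
      have : p = q ≫ (hQ.isoIsPullback _ _ hP).hom := by
        apply hP.hom_ext
        · rw [h₁, Category.assoc, IsPullback.isoIsPullback_hom_fst, e₁]
        · rw [h₂, Category.assoc, IsPullback.isoIsPullback_hom_snd, e₂]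
      rw [this]
      exact ih.comp hq (ih.of_isIso _)
    refine ⟨?_, ?_, ?_, ?_, ?_, ?_⟩
    · intro κ μ f _
      exact ⟨hE'.of_isIso f, top κ, arr κ, topMap f, 𝟙 _,
        IsPullback.of_vert_isIso ⟨(w f).symm⟩, by simp, by simp, ih.of_isIso _⟩
    · exact fun hf => hf.1
    · rintro κ μ ν f g ⟨hf, P, p₁, p₂, p, hP, hp₁, hp₂, hp⟩ ⟨hg, Q, q₁, q₂, q, hQ, hq₁, hq₂, hq⟩
      obtain ⟨R, r₁, r₂, s, y, hR, e₁, e₂, hs⟩ :=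
        exists_comparison_comp (botMap_mem hf) hP hp₁ hp₂ hQ hq₁ hq₂
      exact ⟨hE'.comp hf hg, R, r₁, r₂, p ≫ s, hR, e₁, e₂, ih.comp hp (ih.stable hs hq)⟩
    · rintro κ μ ν π a b f g h ⟨hf, K, k₁, k₂, k, hK, hk₁, hk₂, hk⟩
      obtain ⟨V, q₁, q₂, r, z, hV, e₁, e₂, hr, -⟩ := exists_comparison_pullback h hf hK hk₁ hk₂
      exact ⟨hE'.stable h hf, V, q₁, q₂, r, hV, e₁, e₂, ih.stable hr hk⟩
    · rintro κ μ ν f g hfg ⟨hg, Q, q₁, q₂, q, hQ, hq₁, hq₂, hq⟩ hf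
      obtain ⟨P, p₁, p₂, p, hP, hp₁, hp₂, hp⟩ := exists_comparison hf
      obtain ⟨R, r₁, r₂, s, y, hR, e₁, e₂, hs⟩ :=
        exists_comparison_comp (botMap_mem hf) hP hp₁ hp₂ hQ hq₁ hq₂
      exact ⟨hf, P, p₁, p₂, p, hP, hp₁, hp₂,
        ih.cancel (hcmp hfg hR e₁ e₂) (ih.stable hs hq) hp⟩
    · intro κ μ ν π a b f g h hg hf hb
      obtain ⟨K, k₁, k₂, k, hK, hk₁, hk₂, hk⟩ := exists_comparison hf
      obtain ⟨V, q₁, q₂, r, z, hV, e₁, e₂, hr, hz⟩ := exists_comparison_pullback h hf hK hk₁ hk₂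
      exact ⟨hf, K, k₁, k₂, k, hK, hk₁, hk₂,
        ih.descend hr (hE.stable hz.flip (topMap_mem hg)) hk (hcmp hb hV e₁ e₂)⟩

lemma discFib_comparison {n : ℕ} {κ μ : NExt.{v, u} C (n + 1)} {f : κ ⟶ μ} (hf : discFib.{v, u} C (n + 1) f) {P : NExt.{v, u} C n}
    {π₁ : P ⟶ bot κ} {π₂ : P ⟶ top μ} {p : top κ ⟶ P}
    (hP : IsPullback π₁ π₂ (botMap f) (arr μ)) (h₁ : p ≫ π₁ = arr κ) (h₂ : p ≫ π₂ = topMap f) :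
    discFib.{v, u} C n p := by
  obtain ⟨hf, Q, q₁, q₂, q, hQ, e₁, e₂, hq⟩ := hf
  have : p = q ≫ (hQ.isoIsPullback _ _ hP).hom := by
    apply hP.hom_ext
    · rw [h₁, Category.assoc, IsPullback.isoIsPullback_hom_fst, e₁]
    · rw [h₂, Category.assoc, IsPullback.isoIsPullback_hom_snd, e₂]
  rw [this]
  exact (discFibProps n).comp hq ((discFibProps n).of_isIso _)

end NExt

/-! ### Reflections in a tower of Galois structures -/

namespace GaloisTower

open NExt GaloisStructure

variable {C : Type (max u v)} [Category.{v} C] (T : GaloisTower.{v, u} C)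


lemma X_succ_iff {n : ℕ} (κ : NExt.{v, u} C (n + 1)) :
    (T.Γ (n + 1)).X κ ↔ (T.Γ n).IsCovering (arr κ) := T.mem_succ_iff n κ

variable {T} [Regular C] {n : ℕ}

/-- The identity on `bot κ` is a covering, and `κ` maps to it identically on codomains. Factoring
this map through the reflection makes `botMap f` a split monomorphism, and it is also an extension.
-/
lemma isIso_botMap_of_isReflection {κ μ : NExt.{v, u} C (n + 1)} {f : κ ⟶ μ}
    (hf : (T.Γ (n + 1)).IsReflection f) : IsIso (botMap f) := by
  have hE := isExtensionClass.{v, u} (C := C) n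
  let ι : NExt.{v, u} C (n + 1) := ofHom.{v, u} (𝟙 (bot κ)) (hE.of_isIso _)
  have hι : (T.Γ (n + 1)).X ι := (T.X_succ_iff ι).2
    (IsTrivialCovering.isCovering hE
      (isTrivialCovering_of_isIso (T.stronglyBirkhoff n) hE (𝟙 (bot κ))))
  let g : κ ⟶ ι := homMk (arr κ) (𝟙 (bot κ)) rfl
  obtain ⟨h, hh, -⟩ := hf.2 hι g
  let h' : bot μ ⟶ bot κ := botMap (μ := ι) h
  have e : botMap f ≫ h' = 𝟙 (bot κ) := congrArg (botMap (μ := ι)) hh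
  have hfm := botMap_mem (hf.mem (isExtensionClass (n + 1)))
  exact hE.isIso_of_mono hfm fun a b hab => by
    simpa [e] using congrArg (· ≫ h') hab

/-- The pullback `z₂` of the reflected arrow of `κ` along the unit of `bot κ` is a trivial covering,
so `κ ⟶ ζ` factors through the reflection. The unit of `top κ` factors through `Z`, and every map to
the subcategory factors through that unit. -/
lemma exists_topMap_factor {κ μ : NExt.{v, u} C (n + 1)} {f : κ ⟶ μ}
    (hf : (T.Γ (n + 1)).IsReflection f) {b : NExt.{v, u} C n} (hb : (T.Γ n).X b) (g : top κ ⟶ b) :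
    ∃ h : top μ ⟶ b, topMap f ≫ h = g := by
  have hE := isExtensionClass.{v, u} (C := C) n
  have hΓ := T.stronglyBirkhoff n
  obtain ⟨Z, z₁, z₂, hZ⟩ := hE.exists_pullback (reflMap_mem hΓ (arr_mem κ)) ((T.Γ n).unit (bot κ))
  have hz : (T.Γ n).IsTrivialCovering z₂ := IsTrivialCovering.of_isPullback hΓ hE hZ
    (isTrivialCovering_of_mem hΓ hE (reflMap_mem hΓ (arr_mem κ)) ((T.Γ n).X_refl _))
  let ζ : NExt.{v, u} C (n + 1) := ofHom.{v, u} z₂ hz.1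
  have hζ : (T.Γ (n + 1)).X ζ := (T.X_succ_iff ζ).2 (hz.isCovering hE)
  let k : κ ⟶ ζ := homMk (hZ.lift ((T.Γ n).unit _) (arr κ) (unit_naturality _ _)) (𝟙 (bot κ))
    ((hZ.lift_snd _ _ _).trans (Category.comp_id _).symm)
  obtain ⟨h, hh, -⟩ := hf.2 hζ k
  obtain ⟨g', hg', -⟩ := ((T.Γ n).isReflection_unit (top κ)).2 hb g
  let h' : top μ ⟶ Z := topMap h
  have e : topMap f ≫ h' = hZ.lift ((T.Γ n).unit _) (arr κ) (unit_naturality _ _) :=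
    congrArg topMap hh
  exact ⟨h' ≫ z₁ ≫ g', by rw [reassoc_of% e, hZ.lift_fst_assoc, hg']⟩

variable (T) in
-- By induction, `f` is jointly monic with the unit of `κ`. Maps equalised by both agree on
-- codomains, where the unit is invertible. On domains they agree after the comparison map `p`, a
-- trivial covering by induction, and after the unit of `top κ`, which factors through the upper
-- component of the unit of `κ`.
lemma isTrivialCovering_of_discFib : ∀ {n : ℕ} {κ μ : NExt.{v, u} C n} {f : κ ⟶ μ}, discFib.{v, u} C n f →
    (T.Γ n).IsTrivialCovering f
  | 0, _, _, f, hf => by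
    have : IsIso f := hf
    exact isTrivialCovering_of_isIso (T.stronglyBirkhoff 0) (isExtensionClass 0) f
  | n + 1, κ, μ, f, ⟨hf, P, p₁, p₂, p, hP, hp₁, hp₂, hp⟩ => by
    have ih := isTrivialCovering_of_discFib hp
    have hu := (T.Γ (n + 1)).isReflection_unit κ
    refine isTrivialCovering_of_jointly_mono (T.stronglyBirkhoff _) (isExtensionClass _) hf
      ((T.Γ (n + 1)).unit κ)
      ((T.Γ (n + 1)).X_refl κ) fun a b h₁ h₂ => ?_
    have hb : botMap a = botMap b := by
      have := isIso_botMap_of_isReflection hu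
      rw [← cancel_mono (botMap ((T.Γ (n + 1)).unit κ))]
      exact botMap_comm h₂
    refine hom_ext (ih.2.hom_ext ?_ (hP.hom_ext ?_ ?_)) hb
    · obtain ⟨h, hh⟩ := exists_topMap_factor hu ((T.Γ n).X_refl _) ((T.Γ n).unit (top κ))
      rw [← hh, ← Category.assoc, ← Category.assoc]
      exact congrArg (· ≫ h) (topMap_comm h₂)
    · rw [Category.assoc, Category.assoc, hp₁, w, w, hb]
    · rw [Category.assoc, Category.assoc, hp₂]
      exact topMap_comm h₁

/-- Discrete fibrations preserve and reflect coverings. -/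
lemma isCovering_iff_of_discFib {κ μ : NExt.{v, u} C (n + 1)} {f : κ ⟶ μ} (hf : discFib.{v, u} C (n + 1) f) :
    T.IsCovering κ ↔ T.IsCovering μ := by
  have hE := isExtensionClass.{v, u} (C := C) n
  have hΓ := T.stronglyBirkhoff n
  obtain ⟨hf, P, p₁, p₂, p, hP, hp₁, hp₂, hp⟩ := hf
  have ht := T.isTrivialCovering_of_discFib hp
  change (T.Γ n).IsCovering (arr κ) ↔ (T.Γ n).IsCovering (arr μ)
  rw [← hp₁]
  refine ⟨fun h => ?_, fun h => ht.comp_isCovering hΓ hE (h.of_isPullback hΓ hE hP.flip)⟩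
  -- The trivial covering `p` is cancelled first; then the remaining factor `p₁`, a pullback of the
  -- arrow of `μ` along the extension `botMap f`, descends.
  exact (ht.isCovering_of_comp hΓ hE h).of_isPullback_of_mem hE hP.flip (arr_mem μ) (botMap_mem hf)

end GaloisTower

namespace NExt

variable {C : Type (max u v)} [Category.{v} C]

/-! ### Properties of the faces of a cube -/

section Vert

/-- For a property `Q` of morphisms of multiple extensions, the property of a morphism of
`n`-fold extensions that its restrictions to the faces obtained by fixing the first `i`
coordinates have property `Q`. (If `n < i`, then all coordinates are fixed.) -/
def vert (Q : ∀ n, MorphismProperty (NExt.{v, u} C n)) : ℕ → ∀ n, MorphismProperty (NExt.{v, u} C n)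
  | 0, n => Q n
  | _ + 1, 0 => Q 0
  | i + 1, n + 1 => fun _ _ f => vert Q i n (topMap f) ∧ vert Q i n (botMap f)

/-- For a property `Q` of multiple extensions, the property of an `n`-fold extension that the faces
obtained by fixing the first `i` coordinates have property `Q`. -/
def vertObj (Q : ∀ n, NExt.{v, u} C n → Prop) : ℕ → ∀ n, NExt.{v, u} C n → Prop
  | 0, n => Q n
  | _ + 1, 0 => Q 0
  | i + 1, n + 1 => fun κ => vertObj Q i n (top κ) ∧ vertObj Q i n (bot κ)

variable {Q : ∀ n, MorphismProperty (NExt.{v, u} C n)}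

lemma vert_of_isIso (hQ : ∀ {n} {κ μ : NExt.{v, u} C n} (f : κ ⟶ μ) [IsIso f], Q n f) :
    ∀ {i n : ℕ} {κ μ : NExt.{v, u} C n} (f : κ ⟶ μ) [IsIso f], vert Q i n f
  | 0, _, _, _, f, _ => hQ f
  | _ + 1, 0, _, _, f, _ => hQ f
  | _ + 1, _ + 1, _, _, f, _ => ⟨vert_of_isIso hQ (topMap f), vert_of_isIso hQ (botMap f)⟩

lemma vert_comp
    (hQ : ∀ {n} {κ μ ν : NExt.{v, u} C n} {f : κ ⟶ μ} {g : μ ⟶ ν}, Q n f → Q n g → Q n (f ≫ g)) :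
    ∀ {i n : ℕ} {κ μ ν : NExt.{v, u} C n} {f : κ ⟶ μ} {g : μ ⟶ ν}, vert Q i n f → vert Q i n g →
      vert Q i n (f ≫ g)
  | 0, _, _, _, _, _, _, hf, hg => hQ hf hg
  | _ + 1, 0, _, _, _, _, _, hf, hg => hQ hf hg
  | _ + 1, _ + 1, _, _, _, _, _, hf, hg => ⟨vert_comp hQ hf.1 hg.1, vert_comp hQ hf.2 hg.2⟩

lemma vert_cancel
    (hQ : ∀ {n} {κ μ ν : NExt.{v, u} C n} {f : κ ⟶ μ} {g : μ ⟶ ν}, Q n (f ≫ g) → Q n g → Q n f) :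
    ∀ {i n : ℕ} {κ μ ν : NExt.{v, u} C n} {f : κ ⟶ μ} {g : μ ⟶ ν}, vert Q i n (f ≫ g) → vert Q i n g →
      vert Q i n f
  | 0, _, _, _, _, _, _, hf, hg => hQ hf hg
  | _ + 1, 0, _, _, _, _, _, hf, hg => hQ hf hg
  | _ + 1, _ + 1, _, _, _, _, _, hf, hg => ⟨vert_cancel hQ hf.1 hg.1, vert_cancel hQ hf.2 hg.2⟩

lemma vert_stable [Regular C]
    (hQ : ∀ {n} {κ μ ν π : NExt.{v, u} C n} {a : π ⟶ κ} {b : π ⟶ ν} {f : κ ⟶ μ} {g : ν ⟶ μ},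
      IsPullback a b f g → extensions.{v, u} C n f → Q n f → Q n b) :
    ∀ {i n : ℕ} {κ μ ν π : NExt.{v, u} C n} {a : π ⟶ κ} {b : π ⟶ ν} {f : κ ⟶ μ} {g : ν ⟶ μ},
      IsPullback a b f g → extensions.{v, u} C n f → vert Q i n f → vert Q i n b
  | 0, _, _, _, _, _, _, _, _, _, h, hf, h' => hQ h hf h'
  | _ + 1, 0, _, _, _, _, _, _, _, _, h, hf, h' => hQ h hf h'
  | _ + 1, _ + 1, _, _, _, _, _, _, _, _, h, hf, h' =>
    ⟨vert_stable hQ (isPullback_topMap h hf) (topMap_mem hf) h'.1,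
      vert_stable hQ (isPullback_botMap h hf) (botMap_mem hf) h'.2⟩

lemma vert_mono {Q' : ∀ n, MorphismProperty (NExt.{v, u} C n)}
    (hQ : ∀ {n} {κ μ : NExt.{v, u} C n} {f : κ ⟶ μ}, extensions.{v, u} C n f → Q n f → Q' n f) :
    ∀ {i n : ℕ} {κ μ : NExt.{v, u} C n} {f : κ ⟶ μ}, extensions.{v, u} C n f → vert Q i n f → vert Q' i n f
  | 0, _, _, _, _, hf, h => hQ hf h
  | _ + 1, 0, _, _, _, hf, h => hQ hf h
  | _ + 1, _ + 1, _, _, _, hf, h =>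
    ⟨vert_mono hQ (topMap_mem hf) h.1, vert_mono hQ (botMap_mem hf) h.2⟩

lemma vertObj_dom {P P' : ∀ n, NExt.{v, u} C n → Prop}
    (hQ : ∀ {n} {κ μ : NExt.{v, u} C n} {f : κ ⟶ μ}, Q n f → P n μ → P' n κ) :
    ∀ {i n : ℕ} {κ μ : NExt.{v, u} C n} {f : κ ⟶ μ}, vert Q i n f → vertObj P i n μ → vertObj P' i n κ
  | 0, _, _, _, _, hf, h => hQ hf h
  | _ + 1, 0, _, _, _, hf, h => hQ hf h
  | _ + 1, _ + 1, _, _, _, hf, h => ⟨vertObj_dom hQ hf.1 h.1, vertObj_dom hQ hf.2 h.2⟩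

lemma vertObj_cod {P P' : ∀ n, NExt.{v, u} C n → Prop}
    (hQ : ∀ {n} {κ μ : NExt.{v, u} C n} {f : κ ⟶ μ}, Q n f → P n κ → P' n μ) :
    ∀ {i n : ℕ} {κ μ : NExt.{v, u} C n} {f : κ ⟶ μ}, vert Q i n f → vertObj P i n κ → vertObj P' i n μ
  | 0, _, _, _, _, hf, h => hQ hf h
  | _ + 1, 0, _, _, _, hf, h => hQ hf h
  | _ + 1, _ + 1, _, _, _, hf, h => ⟨vertObj_cod hQ hf.1 h.1, vertObj_cod hQ hf.2 h.2⟩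

end Vert

section DiscFib

variable [Regular C]

/-- The comparison map followed by `p₂`, a pullback of `botMap f`, is `topMap f`; discrete
fibrations cancel on the right among extensions. -/
lemma discFib_of_components {n : ℕ} {κ μ : NExt.{v, u} C (n + 1)} {f : κ ⟶ μ} (hf : extensions.{v, u} C (n + 1) f)
    (ht : discFib.{v, u} C n (topMap f)) (hb : discFib.{v, u} C n (botMap f)) : discFib.{v, u} C (n + 1) f := by
  obtain ⟨P, p₁, p₂, p, hP, hp₁, hp₂, hp⟩ := exists_comparison hf
  refine ⟨hf, P, p₁, p₂, p, hP, hp₁, hp₂, ?_⟩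
  exact (discFibProps n).cancel (by rwa [hp₂]) ((discFibProps n).stable hP hb) hp

lemma discFib_of_vert : ∀ {i n : ℕ} {κ μ : NExt.{v, u} C n} {f : κ ⟶ μ}, extensions.{v, u} C n f →
    vert (discFib.{v, u} C) i n f → discFib.{v, u} C n f
  | 0, _, _, _, _, _, h => h
  | _ + 1, 0, _, _, _, _, h => h
  | _ + 1, _ + 1, _, _, _, hf, h => discFib_of_components hf
      (discFib_of_vert (topMap_mem hf) h.1) (discFib_of_vert (botMap_mem hf) h.2)

lemma vert_discFib_of_succ : ∀ {i n : ℕ} {κ μ : NExt.{v, u} C n} {f : κ ⟶ μ}, extensions.{v, u} C n f →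
    vert (discFib.{v, u} C) (i + 1) n f → vert (discFib.{v, u} C) i n f
  | 0, _, _, _, _, hf, h => discFib_of_vert hf h
  | _ + 1, 0, _, _, _, _, h => h
  | _ + 1, _ + 1, _, _, _, hf, h =>
    ⟨vert_discFib_of_succ (topMap_mem hf) h.1, vert_discFib_of_succ (botMap_mem hf) h.2⟩

end DiscFib

/-! ### Cartesian morphisms -/

section Cart

variable (C) in
/-- The morphisms of multiple extensions which are pullback squares. -/
def cart : ∀ n : ℕ, MorphismProperty (NExt.{v, u} C n)
  | 0 => MorphismProperty.isomorphisms (NExt.{v, u} C 0)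
  | _ + 1 => fun κ μ f => IsPullback (topMap f) (arr κ) (arr μ) (botMap f)

lemma cart_comp : ∀ {n : ℕ} {κ μ ν : NExt.{v, u} C n} {f : κ ⟶ μ} {g : μ ⟶ ν},
    cart.{v, u} C n f → cart.{v, u} C n g → cart.{v, u} C n (f ≫ g)
  | 0, _, _, _, f, g, hf, hg => by
    have : IsIso f := hf
    have : IsIso g := hg
    exact (inferInstance : IsIso (f ≫ g))
  | _ + 1, _, _, _, _, _, hf, hg => IsPullback.paste_horiz hf hg

lemma cart_cancel : ∀ {n : ℕ} {κ μ ν : NExt.{v, u} C n} {f : κ ⟶ μ} {g : μ ⟶ ν},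
    cart.{v, u} C n (f ≫ g) → cart.{v, u} C n g → cart.{v, u} C n f
  | 0, _, _, _, f, g, hf, hg => by
    have : IsIso (f ≫ g) := hf
    have : IsIso g := hg
    exact IsIso.of_isIso_comp_right f g
  | _ + 1, _, _, _, f, _, hf, hg => IsPullback.of_right hf (w f) hg

variable [Regular C]

lemma cart_stable : ∀ {n : ℕ} {κ μ ν π : NExt.{v, u} C n} {a : π ⟶ κ} {b : π ⟶ ν} {f : κ ⟶ μ} {g : ν ⟶ μ},
    IsPullback a b f g → extensions.{v, u} C n f → cart.{v, u} C n f → cart.{v, u} C n b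
  | 0, _, _, _, _, _, b, f, _, h, _, hc => by
    have : IsIso f := hc
    exact (h.isIso_snd_of_isIso : IsIso b)
  | n + 1, κ, _, ν, π, a, b, f, g, h, hf, hc => by
    have h₁ : IsPullback (topMap a ≫ arr κ) (topMap b) (botMap f) (topMap g ≫ arr _) :=
      (isPullback_topMap h hf).paste_horiz (IsPullback.flip hc)
    rw [w, w] at h₁
    exact (IsPullback.of_right h₁ (w b).symm (isPullback_botMap h hf)).flip

lemma mem_of_cart {n : ℕ} {κ μ : NExt.{v, u} C (n + 1)} {f : κ ⟶ μ} (hf : cart.{v, u} C (n + 1) f)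
    (hb : extensions.{v, u} C n (botMap f)) : extensions.{v, u} C (n + 1) f :=
  mem_of_comparison hb (IsPullback.flip hf) (p := 𝟙 _) (Category.id_comp _) (Category.id_comp _)
    ((isExtensionClass n).of_isIso _)

lemma discFib_of_cart : ∀ {n : ℕ} {κ μ : NExt.{v, u} C n} {f : κ ⟶ μ}, extensions.{v, u} C n f → cart.{v, u} C n f → discFib.{v, u} C n f
  | 0, _, _, _, _, h => h
  | n + 1, κ, _, f, hf, h => ⟨hf, top κ, arr κ, topMap f, 𝟙 _, IsPullback.flip h,
      Category.id_comp _, Category.id_comp _, (discFibProps n).of_isIso _⟩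

lemma vert_discFib_of_vert_cart {i n : ℕ} {κ μ : NExt.{v, u} C n} {f : κ ⟶ μ} (hf : extensions.{v, u} C n f)
    (h : vert (cart.{v, u} C) i n f) : vert (discFib.{v, u} C) i n f :=
  vert_mono discFib_of_cart hf h

end Cart

/-! ### Functors between categories of multiple extensions -/

/-- A functor between categories of multiple extensions which preserves extensions and pullbacks of
extensions. -/
structure ExtFunctor (C : Type (max u v)) [Category.{v} C] (m n : ℕ) where
  /-- the underlying functor -/
  F : NExt.{v, u} C m ⥤ NExt.{v, u} C n
  mem : ∀ {κ μ : NExt.{v, u} C m} {f : κ ⟶ μ}, extensions.{v, u} C m f → extensions.{v, u} C n (F.map f)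
  isPullback : ∀ {κ μ ν π : NExt.{v, u} C m} {a : π ⟶ κ} {b : π ⟶ ν} {f : κ ⟶ μ} {g : ν ⟶ μ},
    IsPullback a b f g → extensions.{v, u} C m f → IsPullback (F.map a) (F.map b) (F.map f) (F.map g)

variable [Regular C]

/-- The functor between categories of multiple extensions obtained by applying a functor in the
vertices of an arrow. -/
def ExtFunctor.lift {m n : ℕ} (G : ExtFunctor.{v, u} C m n) :
    ExtFunctor.{v, u} C (m + 1) (n + 1) where
  F :=
    { obj := fun κ => ofHom (G.F.map (arr κ)) (G.mem (arr_mem κ))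
      map := fun f => homMk (G.F.map (topMap f)) (G.F.map (botMap f))
        (((G.F.map_comp _ _).symm.trans (congrArg G.F.map (w f))).trans (G.F.map_comp _ _))
      map_id := fun κ => hom_ext (G.F.map_id _) (G.F.map_id _)
      map_comp := fun f g => hom_ext (G.F.map_comp _ _) (G.F.map_comp _ _) }
  mem {κ μ f} hf := by
    obtain ⟨P, p₁, p₂, p, hP, hp₁, hp₂, hp⟩ := exists_comparison hf
    refine mem_of_comparison (P := G.F.obj P) (π₁ := G.F.map p₁) (π₂ := G.F.map p₂)
      (p := G.F.map p) (G.mem (botMap_mem hf)) (G.isPullback hP (botMap_mem hf)) ?_ ?_ (G.mem hp)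
    · exact (G.F.map_comp _ _).symm.trans (congrArg G.F.map hp₁)
    · exact (G.F.map_comp _ _).symm.trans (congrArg G.F.map hp₂)
  isPullback h hf := isPullback_of_components
    (G.isPullback (isPullback_topMap h hf) (topMap_mem hf))
    (G.isPullback (isPullback_botMap h hf) (botMap_mem hf))

/-- The codomain functor. -/
def botFunctor (n : ℕ) : ExtFunctor.{v, u} C (n + 1) n where
  F := { obj := bot, map := botMap }
  mem := botMap_mem
  isPullback := isPullback_botMap

/-- The functor which restricts an `(n + 1)`-cube to the face on which the coordinate with index `i`
is `1`. (If `n < i`, then the last coordinate is meant.) -/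
def face : ∀ _ n : ℕ, ExtFunctor.{v, u} C (n + 1) n
  | 0, n => botFunctor n
  | _ + 1, 0 => botFunctor 0
  | i + 1, n + 1 => (face i n).lift

lemma vert_face {Q : ∀ n, MorphismProperty (NExt.{v, u} C n)} : ∀ {i n : ℕ} {κ μ : NExt.{v, u} C (n + 1)} {f : κ ⟶ μ},
    vert Q (i + 1) (n + 1) f → vert Q i n ((face i n).F.map f)
  | 0, _, _, _, _, h => h.2
  | _ + 1, 0, _, _, _, h => h.2
  | _ + 1, _ + 1, _, _, _, h => ⟨vert_face h.1, vert_face h.2⟩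

/-- A morphism which is cartesian in the direction `i` is an extension if its restriction to the
corresponding face is. -/
lemma mem_of_vert_cart : ∀ {i n : ℕ} (_ : i ≤ n) {κ μ : NExt.{v, u} C (n + 1)} {f : κ ⟶ μ},
    vert (cart.{v, u} C) i (n + 1) f → extensions.{v, u} C n ((face i n).F.map f) → extensions.{v, u} C (n + 1) f
  | 0, _, _, _, _, _, hc, hf => mem_of_cart hc hf
  | i + 1, n + 1, hi, κ, μ, f, hc, hf => by
    have hb : extensions.{v, u} C (n + 1) (botMap f) :=
      mem_of_vert_cart (Nat.le_of_succ_le_succ hi) hc.2 (botMap_mem hf)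
    obtain ⟨P, p₁, p₂, hP⟩ := (isExtensionClass (n + 1)).exists_pullback hb (arr μ)
    let p : top κ ⟶ P := hP.lift (arr κ) (topMap f) (w f).symm
    have hp₁ : p ≫ p₁ = arr κ := hP.lift_fst _ _ _
    have hp₂ : p ≫ p₂ = topMap f := hP.lift_snd _ _ _
    refine mem_of_comparison hb hP hp₁ hp₂ ?_
    -- The comparison map `p` is cartesian in direction `i` by cancellation, since `p ≫ p₂ = topMap
    -- f` and the pullback `p₂` of `botMap f` are. Its restriction to the face is the comparison map
    -- of the restriction of `f`.
    refine mem_of_vert_cart (Nat.le_of_succ_le_succ hi)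
      (vert_cancel cart_cancel (by rw [hp₂]; exact hc.1) (vert_stable cart_stable hP hb hc.2)) ?_
    refine comparison_mem hf ((face i n).isPullback hP hb) ?_ ?_
    · exact ((face i n).F.map_comp _ _).symm.trans (congrArg (face i n).F.map hp₁)
    · exact ((face i n).F.map_comp _ _).symm.trans (congrArg (face i n).F.map hp₂)

/-- An extension of a face of a cube is the restriction of an extension which is cartesian in
the direction of the face. -/
lemma exists_vert_cart_of_face : ∀ {i n : ℕ} (_ : i ≤ n) (κ : NExt.{v, u} C (n + 1)) {s : NExt.{v, u} C n}
    (g : s ⟶ (face i n).F.obj κ), extensions.{v, u} C n g →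
    ∃ (κ' : NExt.{v, u} C (n + 1)) (f : κ' ⟶ κ) (θ : (face i n).F.obj κ' ≅ s),
      vert (cart.{v, u} C) i (n + 1) f ∧ θ.hom ≫ g = (face i n).F.map f
  | 0, n, _, κ, s, g, hg => by
    obtain ⟨P, p₁, p₂, hP⟩ := (isExtensionClass n).exists_pullback (arr_mem κ) g
    exact ⟨ofHom p₂ ((isExtensionClass n).stable hP (arr_mem κ)), homMk p₁ g hP.w, Iso.refl _,
      hP, Category.id_comp _⟩
  | i + 1, n + 1, hi, κ, s, g, hg => by
    have hi' := Nat.le_of_succ_le_succ hi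
    obtain ⟨κb, fb, θb, hcb, hθb⟩ := exists_vert_cart_of_face hi' (bot κ) (botMap g)
      (botMap_mem hg)
    have hmb : extensions.{v, u} C n ((face i n).F.map fb) := by
      rw [← hθb]
      exact (isExtensionClass n).comp ((isExtensionClass n).of_isIso _) (botMap_mem hg)
    have hfb := mem_of_vert_cart hi' hcb hmb
    obtain ⟨P, p₁, p₂, hP⟩ := (isExtensionClass (n + 1)).exists_pullback hfb (arr κ)
    have hP' : IsPullback ((face i n).F.map p₁ ≫ θb.hom) ((face i n).F.map p₂) (botMap g)
        ((face i n).F.map (arr κ)) :=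
      ((face i n).isPullback hP hfb).of_iso (Iso.refl _) θb (Iso.refl _) (Iso.refl _)
        (by simp) (by simp) ((Category.comp_id _).trans hθb.symm)
        ((Category.comp_id _).trans (Category.id_comp _).symm)
    -- Here `t` is the comparison map of `g`, with target rewritten as the face of `P`. The
    -- induction hypothesis extends it to a cartesian `k` over `P`, and `k ≫ p₁` is the arrow of the
    -- new cube.
    let t : top s ⟶ (face i n).F.obj P := hP'.lift (arr s) (topMap g) (w g).symm
    have ht : extensions.{v, u} C n t := comparison_mem hg hP' (hP'.lift_fst _ _ _) (hP'.lift_snd _ _ _)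
    obtain ⟨κt, k, θt, hct, hθt⟩ := exists_vert_cart_of_face hi' P t ht
    have hk : extensions.{v, u} C (n + 1) k := mem_of_vert_cart hi' hct (by
      rw [← hθt]
      exact (isExtensionClass n).comp ((isExtensionClass n).of_isIso _) ht)
    have hkw : (k ≫ p₂) ≫ arr κ = (k ≫ p₁) ≫ fb := by
      rw [Category.assoc, Category.assoc, hP.w]
    refine ⟨ofHom (k ≫ p₁) ((isExtensionClass (n + 1)).comp hk
      ((isExtensionClass (n + 1)).stable hP.flip (arr_mem κ))),
      homMk (k ≫ p₂) fb hkw, isoMk θt θb ?_, ⟨?_, hcb⟩,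
      hom_ext ?_ hθb⟩
    · change θt.hom ≫ arr s = (face i n).F.map (k ≫ p₁) ≫ θb.hom
      rw [Functor.map_comp, Category.assoc, ← hθt, Category.assoc]
      congr 1
      exact (hP'.lift_fst _ _ _).symm
    · exact vert_comp cart_comp hct (vert_stable cart_stable hP hfb hcb)
    · change θt.hom ≫ topMap g = (face i n).F.map (k ≫ p₂)
      rw [Functor.map_comp, ← hθt, Category.assoc]
      congr 1
      exact (hP'.lift_snd _ _ _).symm

end NExt

namespace GaloisTower

open NExt GaloisStructure

variable {C : Type (max u v)} [Category.{v} C] [Regular C] {T : GaloisTower.{v, u} C}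

/-! ### Extensions whose reflection is a trivial covering -/

section Normal

variable {n : ℕ}

/-- A discrete fibration is a trivial covering, so it is the pullback of its reflection along a
unit, and being a discrete fibration descends along extensions. -/
lemma exists_discFib_of_isReflection {κ μ κ' μ' : NExt.{v, u} C n} {f : κ ⟶ μ} (hf : discFib.{v, u} C n f) {r : κ ⟶ κ'}
    {s : μ ⟶ μ'} (hr : (T.Γ n).IsReflection r) (hs : (T.Γ n).IsReflection s) :
    ∃ g : κ' ⟶ μ', r ≫ g = f ≫ s ∧ discFib.{v, u} C n g := by
  obtain ⟨g, hg, -⟩ := hr.2 hs.1 (f ≫ s)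
  refine ⟨g, hg, (discFibProps n).descend
    ((T.isTrivialCovering_of_discFib hf).isPullback hr hs hg) (hs.mem (isExtensionClass n)) ?_ hf⟩
  exact (isDoubleExtension_of_isReflection (T.stronglyBirkhoff n) (isExtensionClass n)
    ((discFibProps n).mem hf) hr hs hg).1

/-- The arrow of `κ` is the comparison map, which is a discrete fibration and so a trivial covering,
followed by the projection `k₁`. -/
lemma isTrivialCovering_arr_of_discFib {κ μ : NExt.{v, u} C (n + 1)} {f : κ ⟶ μ} (hf : discFib.{v, u} C (n + 1) f)
    (h : ∀ {K : NExt.{v, u} C n} {k₁ : K ⟶ bot κ} {k₂ : K ⟶ top μ}, IsPullback k₁ k₂ (botMap f) (arr μ) →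
      (T.Γ n).IsTrivialCovering k₁) : (T.Γ n).IsTrivialCovering (arr κ) := by
  obtain ⟨-, K, k₁, k₂, k, hK, hk₁, -, hk⟩ := hf
  rw [← hk₁]
  exact IsTrivialCovering.comp (T.stronglyBirkhoff n) (isExtensionClass n)
    (T.isTrivialCovering_of_discFib hk) (h hK)

variable (T)

/-- An `(n + 1)`-fold extension which is a trivial covering. -/
def IsTrivial : ∀ n : ℕ, NExt.{v, u} C n → Prop
  | 0, _ => True
  | n + 1, κ => (T.Γ n).IsTrivialCovering (arr κ)

/-- An `(n + 1)`-fold extension whose reflection among the coverings is a trivial covering. -/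
def HasTrivialReflection (n : ℕ) (κ : NExt.{v, u} C n) : Prop :=
  ∀ ⦃μ : NExt.{v, u} C n⦄ (r : κ ⟶ μ), (T.Γ n).IsReflection r → T.IsTrivial n μ

variable {T}

/-- The reflection of `f` is again a discrete fibration, and along it triviality passes from the
reflection of `μ` to that of `κ`. -/
lemma HasTrivialReflection.of_discFib : ∀ {n : ℕ} {κ μ : NExt.{v, u} C n} {f : κ ⟶ μ}, discFib.{v, u} C n f →
    T.HasTrivialReflection n μ → T.HasTrivialReflection n κ
  | 0, _, _, _, _, _ => fun _ _ _ => trivial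
  | n + 1, κ, μ, f, hf, h => fun κ' r hr => by
    obtain ⟨g, -, hg⟩ := exists_discFib_of_isReflection hf hr ((T.Γ _).isReflection_unit μ)
    exact isTrivialCovering_arr_of_discFib hg fun hK => IsTrivialCovering.of_isPullback
      (T.stronglyBirkhoff n) (isExtensionClass n) hK.flip (h _ ((T.Γ _).isReflection_unit μ))

variable (T) in
/-- Locally in the direction `i`, the reflections in the direction `i` are trivial coverings. -/
lemma exists_vertObj_hasTrivialReflection : ∀ {i n : ℕ} (_ : i ≤ n) (κ : NExt.{v, u} C (n + 1)),
    ∃ (κ' : NExt.{v, u} C (n + 1)) (f : κ' ⟶ κ), extensions.{v, u} C (n + 1) f ∧ vert (cart.{v, u} C) i (n + 1) f ∧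
      vertObj T.HasTrivialReflection i (n + 1) κ'
  | 0, n, _, κ => by
    have hE := isExtensionClass.{v, u} (C := C) n
    let r := (T.Γ (n + 1)).unit κ
    have hr : (T.Γ (n + 1)).IsReflection r := (T.Γ (n + 1)).isReflection_unit κ
    have := isIso_botMap_of_isReflection hr
    obtain ⟨-, S, e, he, P, t, x, hP, ht⟩ := (T.X_succ_iff _).1 hr.1
    -- The extension `e` splits the covering that reflects `κ`. Since the reflection is invertible
    -- on codomains, `κ` itself can be pulled back along the corresponding `c`.
    let c : S ⟶ bot κ := e ≫ inv (botMap r)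
    have hc : extensions.{v, u} C n c := hE.comp he (hE.of_isIso _)
    have hce : c ≫ botMap r = e := by
      rw [Category.assoc, IsIso.inv_hom_id, Category.comp_id]
    obtain ⟨K, k₁, k₂, hK⟩ := hE.exists_pullback (arr_mem κ) c
    let κ' : NExt.{v, u} C (n + 1) := ofHom k₂ (hE.stable hK (arr_mem κ))
    let f : κ' ⟶ κ := homMk k₁ c hK.w
    have hf : cart.{v, u} C (n + 1) f := hK
    refine ⟨κ', f, mem_of_cart hf hc, hf, fun κ'' r' hr' => ?_⟩
    obtain ⟨g, hg, hgD⟩ :=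
      exists_discFib_of_isReflection (discFib_of_cart (mem_of_cart hf hc) hf) hr' hr
    let q : S ⟶ bot κ'' := botMap r'
    have : IsIso q := isIso_botMap_of_isReflection hr'
    -- Up to an isomorphism `g` lies over the splitting extension `e`, so pulling the reflection of
    -- `κ` back along `botMap g` gives a pullback of the trivial covering `t`.
    have hq : botMap g = inv q ≫ e := by
      rw [← hce]
      exact (IsIso.eq_inv_comp q).2 (botMap_comm hg)
    refine isTrivialCovering_arr_of_discFib hgD fun {L l₁ l₂} hL => ?_
    rw [hq] at hL
    exact IsTrivialCovering.of_isPullback (T.stronglyBirkhoff n) hE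
      (IsPullback.of_right' hL.flip hP) ht
  | i + 1, n + 1, hi, κ => by
    have hE := isExtensionClass.{v, u} (C := C) (n + 1)
    have hi' := Nat.le_of_succ_le_succ hi
    obtain ⟨κb, fb, hb, hcb, hTb⟩ := exists_vertObj_hasTrivialReflection hi' (bot κ)
    -- The domain is first pulled back along the replacement of the codomain and only then replaced
    -- itself, so that both replacements form one extension.
    obtain ⟨P, p₁, p₂, hP⟩ := hE.exists_pullback hb (arr κ)
    obtain ⟨κt, k, hk, hck, hTt⟩ := exists_vertObj_hasTrivialReflection hi' P
    have hkw : (k ≫ p₂) ≫ arr κ = (k ≫ p₁) ≫ fb := by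
      rw [Category.assoc, Category.assoc, hP.w]
    exact ⟨ofHom (k ≫ p₁) (hE.comp hk (hE.stable hP.flip (arr_mem κ))), homMk (k ≫ p₂) fb hkw,
      mem_of_comparison hb hP rfl rfl hk,
      ⟨vert_comp cart_comp hck (vert_stable cart_stable hP hb hcb), hcb⟩, hTt, hTb⟩

variable (T) in
/-- An inductive condition on multiple extensions under which the reflection can be computed in the
first `i` directions one after another. -/
def IsNormal : ∀ _ n : ℕ, NExt.{v, u} C n → Prop
  | 0, _, _ => True
  | _ + 1, 0, _ => True
  | i + 1, n + 1, κ => IsNormal i (n + 1) κ ∧ vertObj T.HasTrivialReflection i (n + 1) κ ∧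
      IsNormal i n ((face i n).F.obj κ)

/-- The first two clauses need only faces with `i` coordinates fixed; the clause about the face in
direction `i` uses that `i + 1` coordinates are fixed in `hD`. -/
lemma IsNormal.of_vert_discFib : ∀ {i n : ℕ} {κ μ : NExt.{v, u} C n} {f : κ ⟶ μ}, extensions.{v, u} C n f →
    vert (discFib.{v, u} C) i n f → T.IsNormal i n μ → T.IsNormal i n κ
  | 0, _, _, _, _, _, _, _ => trivial
  | _ + 1, 0, _, _, _, _, _, _ => trivial
  | i + 1, n + 1, _, _, _, hf, hD, h =>
    have hD' := vert_discFib_of_succ hf hD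
    ⟨IsNormal.of_vert_discFib hf hD' h.1, vertObj_dom HasTrivialReflection.of_discFib hD' h.2.1,
      IsNormal.of_vert_discFib ((face i n).mem hf) (vert_face hD) h.2.2⟩

variable (T) in
-- The three clauses of normality are achieved one after another. The second and third modifications
-- are cartesian in direction `i`, hence discrete fibrations on the faces, so they preserve what was
-- achieved before.
lemma exists_discFib_isNormal : ∀ {i n : ℕ} (_ : i ≤ n) (κ : NExt.{v, u} C n),
    ∃ (κ' : NExt.{v, u} C n) (f : κ' ⟶ κ), discFib.{v, u} C n f ∧ T.IsNormal i n κ'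
  | 0, n, _, κ => ⟨κ, 𝟙 κ, (discFibProps n).of_isIso _, trivial⟩
  | i + 1, n + 1, hi, κ => by
    have hi' := Nat.le_of_succ_le_succ hi
    obtain ⟨κ₁, f₁, hf₁, h₁⟩ := exists_discFib_isNormal (Nat.le_of_succ_le hi) κ
    obtain ⟨κ₂, f₂, hf₂, hc₂, h₂⟩ := T.exists_vertObj_hasTrivialReflection hi' κ₁
    -- The last clause concerns only a face of lower dimension: a discrete fibration making that
    -- face normal exists by induction and is extended to the whole cube.
    obtain ⟨s, g, hg, hs⟩ := exists_discFib_isNormal hi' ((face i n).F.obj κ₂)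
    obtain ⟨κ₃, f₃, θ, hc₃, hθ⟩ := exists_vert_cart_of_face hi' κ₂ g ((discFibProps n).mem hg)
    have hf₃ : extensions.{v, u} C (n + 1) f₃ := mem_of_vert_cart hi' hc₃ (by
      rw [← hθ]
      exact (isExtensionClass n).comp ((isExtensionClass n).of_isIso _) ((discFibProps n).mem hg))
    have hD₂ := vert_discFib_of_vert_cart hf₂ hc₂
    have hD₃ := vert_discFib_of_vert_cart hf₃ hc₃
    refine ⟨κ₃, f₃ ≫ f₂ ≫ f₁, (discFibProps _).comp (discFib_of_vert hf₃ hD₃)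
      ((discFibProps _).comp (discFib_of_vert hf₂ hD₂) hf₁),
      IsNormal.of_vert_discFib hf₃ hD₃ (IsNormal.of_vert_discFib hf₂ hD₂ h₁),
      vertObj_dom HasTrivialReflection.of_discFib hD₃ h₂,
      IsNormal.of_vert_discFib ((isExtensionClass n).of_isIso θ.hom)
        (vert_of_isIso (fun {m} _ _ f _ => (discFibProps m).of_isIso f) θ.hom) hs⟩

end Normal

/-! ### Reflections of the faces of a cube -/

section Reflections

variable (T) in
/-- The reflections in a tower of Galois structures. -/
def reflections (n : ℕ) : MorphismProperty (NExt.{v, u} C n) := fun _ _ f => (T.Γ n).IsReflection f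

variable (T) in
/-- The reflective subcategories in a tower of Galois structures. -/
def base (n : ℕ) : NExt.{v, u} C n → Prop := (T.Γ n).X

omit [Regular C] in
lemma vertObj_base_of_vert_reflections : ∀ {i n : ℕ} {κ μ : NExt.{v, u} C n} {f : κ ⟶ μ},
    vert T.reflections i n f → vertObj T.base i n μ
  | 0, _, _, _, _, hf => hf.1
  | _ + 1, 0, _, _, _, hf => hf.1
  | _ + 1, _ + 1, _, _, _, hf =>
    ⟨vertObj_base_of_vert_reflections hf.1, vertObj_base_of_vert_reflections hf.2⟩

omit [Regular C] in
-- The factorisations on domain and codomain exist by induction; they form a square because maps out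
-- of `top μ` into `bot b` are determined by their composite with the reflection.
lemma existsUnique_of_vert_reflections : ∀ {i n : ℕ} {κ μ b : NExt.{v, u} C n} {f : κ ⟶ μ},
    vert T.reflections i n f → vertObj T.base i n b → ∀ g : κ ⟶ b, ∃! h : μ ⟶ b, f ≫ h = g
  | 0, _, _, _, _, _, hf, hb, g => hf.2 hb g
  | _ + 1, 0, _, _, _, _, hf, hb, g => hf.2 hb g
  | _ + 1, _ + 1, κ, μ, b, f, hf, hb, g => by
    obtain ⟨t, ht, ht'⟩ := existsUnique_of_vert_reflections hf.1 hb.1 (topMap g)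
    obtain ⟨s, hs, hs'⟩ := existsUnique_of_vert_reflections hf.2 hb.2 (botMap g)
    have hts : t ≫ arr b = arr μ ≫ s := by
      refine (existsUnique_of_vert_reflections hf.1 hb.2 (topMap g ≫ arr b)).unique ?_ ?_
      · rw [← Category.assoc, ht]
      · rw [← Category.assoc, w, Category.assoc, hs, w]
    exact ⟨homMk t s hts, hom_ext ht hs, fun h hh =>
      hom_ext (ht' _ (by rw [← hh, topMap_comp])) (hs' _ (by rw [← hh, botMap_comp]))⟩

omit [Regular C] in
lemma hom_ext_of_vert_reflections {i n : ℕ} {κ μ b : NExt.{v, u} C n} {f : κ ⟶ μ}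
    (hf : vert T.reflections i n f) (hb : vertObj T.base i n b) {h k : μ ⟶ b}
    (hk : f ≫ h = f ≫ k) : h = k :=
  (existsUnique_of_vert_reflections hf hb (f ≫ k)).unique hk rfl

omit [Regular C] in
lemma exists_iso_of_vert_reflections {i n : ℕ} {κ μ μ' : NExt.{v, u} C n} {f : κ ⟶ μ} {f' : κ ⟶ μ'}
    (hf : vert T.reflections i n f) (hf' : vert T.reflections i n f') :
    ∃ θ : μ ≅ μ', f ≫ θ.hom = f' := by
  have hμ := vertObj_base_of_vert_reflections hf
  have hμ' := vertObj_base_of_vert_reflections hf'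
  obtain ⟨h, hh, -⟩ := existsUnique_of_vert_reflections hf hμ' f'
  obtain ⟨k, hk, -⟩ := existsUnique_of_vert_reflections hf' hμ f
  exact ⟨⟨h, k, hom_ext_of_vert_reflections hf hμ (by rw [reassoc_of% hh, hk, Category.comp_id]),
    hom_ext_of_vert_reflections hf' hμ' (by rw [reassoc_of% hk, hh, Category.comp_id])⟩, hh⟩

omit [Regular C] in
lemma vert_reflections_iso_comp : ∀ {i n : ℕ} {κ μ ν : NExt.{v, u} C n} {f : κ ⟶ μ} (_ : IsIso f) {g : μ ⟶ ν},
    vert T.reflections i n g → vert T.reflections i n (f ≫ g)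
  | 0, _, _, _, _, f, _, _, hg => IsReflection.iso_comp hg f
  | _ + 1, 0, _, _, _, f, _, _, hg => IsReflection.iso_comp hg f
  | _ + 1, _ + 1, _, _, _, f, _, _, hg =>
    ⟨vert_reflections_iso_comp (inferInstanceAs (IsIso (topMap f))) hg.1,
      vert_reflections_iso_comp (inferInstanceAs (IsIso (botMap f))) hg.2⟩

/-- The face with `i`-th coordinate 1 is made of the codomains of the faces being reflected, and
reflection leaves those unchanged. -/
lemma isIso_face_map_of_vert_reflections : ∀ {i n : ℕ} (_ : i ≤ n) {κ μ : NExt.{v, u} C (n + 1)} {f : κ ⟶ μ},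
    vert T.reflections i (n + 1) f → IsIso ((face i n).F.map f)
  | 0, _, _, _, _, _, hf => isIso_botMap_of_isReflection hf
  | _ + 1, _ + 1, hi, _, _, _, hf => isIso_of_components _
      (isIso_face_map_of_vert_reflections (Nat.le_of_succ_le_succ hi) hf.1)
      (isIso_face_map_of_vert_reflections (Nat.le_of_succ_le_succ hi) hf.2)

/-- The reflection `f` is invertible on codomains. On domains, every map to the subcategory one
level below factors through `topMap f`, uniquely since extensions are epic; so nothing is lost by
applying `f` before reflecting. -/
lemma vert_reflections_comp : ∀ {i n : ℕ} (_ : i ≤ n) {κ μ ν : NExt.{v, u} C (n + 1)} {f : κ ⟶ μ} {g : μ ⟶ ν},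
    vert T.reflections i (n + 1) f → vert T.reflections (i + 1) (n + 1) g →
      vert T.reflections (i + 1) (n + 1) (f ≫ g)
  | 0, n, _, _, _, _, f, g, hf, hg => by
    have := isIso_botMap_of_isReflection hf
    have := (isExtensionClass n).epi (topMap_mem (hf.mem (isExtensionClass _)))
    refine ⟨⟨hg.1.1, fun b hb x => ?_⟩, IsReflection.iso_comp hg.2 (botMap f)⟩
    obtain ⟨y, hy⟩ := exists_topMap_factor hf hb x
    obtain ⟨z, hz, -⟩ := hg.1.2 hb y
    have hfz : (topMap f ≫ topMap g) ≫ z = x := by rw [Category.assoc, hz, hy]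
    refine ⟨z, hfz, fun z' hz' => ?_⟩
    refine hg.1.hom_ext hb ?_
    rw [← cancel_epi (topMap f), hz, hy, ← hz', topMap_comp, Category.assoc]
  | _ + 1, _ + 1, hi, _, _, _, _, _, hf, hg =>
    ⟨vert_reflections_comp (Nat.le_of_succ_le_succ hi) hf.1 hg.1,
      vert_reflections_comp (Nat.le_of_succ_le_succ hi) hf.2 hg.2⟩

/-- A reflection of a face of a cube which is trivial in the direction of that face extends to the
whole cube. -/
lemma exists_vert_reflections_of_face : ∀ {i n : ℕ} (_ : i ≤ n) {μ : NExt.{v, u} C (n + 1)},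
    vertObj T.IsTrivial i (n + 1) μ → ∀ {σ : NExt.{v, u} C n} (w : (face i n).F.obj μ ⟶ σ), extensions.{v, u} C n w →
    vert T.reflections i n w → ∃ (lam : NExt.{v, u} C (n + 1)) (p : μ ⟶ lam), extensions.{v, u} C (n + 1) p ∧
      vert (cart.{v, u} C) i (n + 1) p ∧ vert T.reflections (i + 1) (n + 1) p
  | 0, n, _, μ, hμ, σ, w, hw, hr => by
    let t := (T.Γ n).unit (top μ)
    have ht : (T.Γ n).IsReflection t := (T.Γ n).isReflection_unit (top μ)
    let w' : bot μ ⟶ σ := w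
    have hw' : (T.Γ n).IsReflection w' := hr
    obtain ⟨f, hf, -⟩ := ht.2 hw'.1 (arr μ ≫ w')
    have hfm := (isDoubleExtension_of_isReflection (T.stronglyBirkhoff n) (isExtensionClass n)
      (arr_mem μ) ht hw' hf).1
    -- Triviality enters here: the reflection square of `μ` is a pullback, so the morphism `p` it
    -- defines is cartesian.
    have hP : IsPullback t (arr μ) f w' := IsTrivialCovering.isPullback hμ ht hw' hf
    let p : μ ⟶ ofHom f hfm := homMk t w' hP.w
    have hp : cart.{v, u} C (n + 1) p := hP
    exact ⟨_, p, mem_of_cart hp hw, hp, ht, hw'⟩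
  | i + 1, n + 1, hi, μ, hμ, σ, x, hx, hr => by
    have hi' := Nat.le_of_succ_le_succ hi
    have hE := isExtensionClass.{v, u} (C := C) (n + 1)
    obtain ⟨lt, pt, hpt, hct, hrt⟩ :=
      exists_vert_reflections_of_face hi' hμ.1 (topMap x) (topMap_mem hx) hr.1
    obtain ⟨lb, pb, hpb, hcb, hrb⟩ :=
      exists_vert_reflections_of_face hi' hμ.2 (botMap x) (botMap_mem hx) hr.2
    obtain ⟨h, hh, -⟩ := existsUnique_of_vert_reflections hrt
      (vertObj_base_of_vert_reflections hrb) (arr μ ≫ pb)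
    have hhm : extensions.{v, u} C (n + 1) h := hE.cancel hpt (by rw [hh]; exact hE.comp (arr_mem μ) hpb)
    obtain ⟨P, p₁, p₂, hP⟩ := hE.exists_pullback hpb h
    let k : top μ ⟶ P := hP.lift (arr μ) pt hh.symm
    have hk₁ : k ≫ p₁ = arr μ := hP.lift_fst _ _ _
    have hk₂ : k ≫ p₂ = pt := hP.lift_snd _ _ _
    have hck : vert (cart.{v, u} C) i (n + 1) k :=
      vert_cancel cart_cancel (by rw [hk₂]; exact hct) (vert_stable cart_stable hP hpb hcb)
    obtain ⟨θt, hθt⟩ := exists_iso_of_vert_reflections hr.1 (vert_face hrt)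
    obtain ⟨θb, hθb⟩ := exists_iso_of_vert_reflections hr.2 (vert_face hrb)
    have hθ : θt.hom ≫ (face i n).F.map h = arr σ ≫ θb.hom := by
      refine hom_ext_of_vert_reflections hr.1
        (vertObj_base_of_vert_reflections (vert_face hrb)) ?_
      have e₁ := (((face i n).F.map_comp _ _).symm.trans (congrArg (face i n).F.map hh)).trans
        ((face i n).F.map_comp _ _)
      have e₂ := congrArg (· ≫ θb.hom) (NExt.w x)
      rw [← hθt, ← hθb] at e₁
      rw [← Category.assoc, ← Category.assoc]
      exact e₁.trans ((Category.assoc _ _ _).symm.trans e₂.symm)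
    -- The recursive calls choose their own reflections of the two faces. Uniqueness of reflections
    -- identifies `σ` with the face of `h`, so the comparison map of `x`, an extension, becomes the
    -- restriction of `k`.
    let e : σ ≅ ofHom ((face i n).F.map h) ((face i n).mem hhm) := isoMk θt θb hθ
    have hxe : extensions.{v, u} C (n + 1) (x ≫ e.hom) := hE.comp hx (hE.of_isIso _)
    have hP' : IsPullback ((face i n).F.map p₁) ((face i n).F.map p₂) (botMap (x ≫ e.hom))
        ((face i n).F.map h) := by
      have : botMap (x ≫ e.hom) = (face i n).F.map pb := hθb
      rw [this]
      exact (face i n).isPullback hP hpb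
    have hk : extensions.{v, u} C (n + 1) k := mem_of_vert_cart hi' hck (comparison_mem hxe hP'
      (((face i n).F.map_comp _ _).symm.trans (congrArg (face i n).F.map hk₁))
      (((face i n).F.map_comp _ _).symm.trans ((congrArg (face i n).F.map hk₂).trans hθt.symm)))
    exact ⟨ofHom h hhm, homMk pt pb hh, mem_of_comparison hpb hP hk₁ hk₂ hk, ⟨hct, hcb⟩, hrt, hrb⟩

/-- For a multiple extension `κ` which is normal in the first `i` directions, the reflection
of `κ` is a pullback of the reflection of its faces in these directions. -/
lemma IsNormal.exists_reflection : ∀ {i n : ℕ} (_ : i ≤ n) {κ : NExt.{v, u} C n}, T.IsNormal i n κ →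
    ∃ (κ' lam : NExt.{v, u} C n) (r : κ ⟶ κ') (d : κ' ⟶ lam), (T.Γ n).IsReflection r ∧ discFib.{v, u} C n d ∧
      vert T.reflections i n (r ≫ d)
  | 0, n, _, κ, _ => ⟨_, _, (T.Γ n).unit κ, 𝟙 _, (T.Γ n).isReflection_unit κ,
      (discFibProps n).of_isIso _, by
        rw [Category.comp_id]; exact (T.Γ n).isReflection_unit κ⟩
  | i + 1, n + 1, hi, κ, h => by
    have hi' := Nat.le_of_succ_le_succ hi
    have hE := isExtensionClass.{v, u} (C := C) n
    obtain ⟨κ', μ, r, d, hr, hd, hu⟩ := IsNormal.exists_reflection (Nat.le_of_succ_le hi) h.1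
    obtain ⟨s, σ, r', d', hr', hd', hw⟩ := IsNormal.exists_reflection hi' h.2.2
    -- The faces of `μ` are the reflections of the faces of `κ`, which the second clause of
    -- normality declares trivial.
    have hμ : vertObj T.IsTrivial i (n + 1) μ :=
      vertObj_cod (Q := T.reflections) (fun hf hκ => hκ _ hf) hu h.2.1
    -- `r ≫ d` does not change the face in direction `i`, so the facewise reflection `r' ≫ d'` of
    -- that face of `κ` also reflects the face of `μ`. It is an extension, being a reflection
    -- followed by a discrete fibration.
    have := isIso_face_map_of_vert_reflections hi' hu
    obtain ⟨lam, p, hp, hcp, hrp⟩ := exists_vert_reflections_of_face hi' hμ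
      (inv ((face i n).F.map (r ≫ d)) ≫ r' ≫ d')
      (hE.comp (hE.of_isIso _) (hE.comp (hr'.mem hE) ((discFibProps n).mem hd')))
      (vert_reflections_iso_comp inferInstance hw)
    refine ⟨κ', lam, r, d ≫ p, hr, (discFibProps _).comp hd
      (discFib_of_vert hp (vert_discFib_of_vert_cart hp hcp)), ?_⟩
    rw [← Category.assoc]
    exact vert_reflections_comp hi' hu hrp

variable (T) in
/-- The property that all vertices of a cube belong to the base, described inductively. -/
def VerticesInBase : ∀ n : ℕ, NExt.{v, u} C n → Prop
  | 0, κ => (T.Γ 0).X κ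
  | n + 1, κ => VerticesInBase n (top κ) ∧ VerticesInBase n (bot κ)

/-- An extension is a trivial covering once its domain lies in the reflective subcategory, so the
induction runs along domains. -/
lemma VerticesInBase.X : ∀ {n : ℕ} {κ : NExt.{v, u} C n}, T.VerticesInBase n κ → (T.Γ n).X κ
  | 0, _, h => h
  | n + 1, κ, h => (T.X_succ_iff κ).2 (IsTrivialCovering.isCovering (isExtensionClass n)
      (isTrivialCovering_of_mem (T.stronglyBirkhoff n) (isExtensionClass n) (arr_mem κ) h.1.X))

omit [Regular C] in
lemma verticesInBase_of_vertObj : ∀ {n : ℕ} {κ : NExt.{v, u} C n}, vertObj T.base n n κ →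
    T.VerticesInBase n κ
  | 0, _, h => h
  | _ + 1, _, h => ⟨verticesInBase_of_vertObj h.1, verticesInBase_of_vertObj h.2⟩

/-- A multiple extension is a covering if and only if it is connected by a span of discrete
fibrations to a multiple extension in the base. -/
theorem isCovering_iff_exists_span {n : ℕ} (α : NExt.{v, u} C (n + 1)) :
    T.IsCovering α ↔ ∃ (β τ : NExt.{v, u} C (n + 1)) (φ : τ ⟶ β) (ψ : τ ⟶ α),
      discFib.{v, u} C (n + 1) φ ∧ discFib.{v, u} C (n + 1) ψ ∧ T.VerticesInBase (n + 1) β := by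
  refine ⟨fun h => ?_, ?_⟩
  · obtain ⟨τ, ψ, hψ, hτ⟩ := T.exists_discFib_isNormal le_rfl α
    obtain ⟨κ', β, r, d, hr, hd, hrd⟩ := hτ.exists_reflection le_rfl
    -- With `α`, also `τ` is a covering, so its reflection `r` is invertible and the vertexwise
    -- reflection `r ≫ d` is a discrete fibration.
    have := hr.isIso ((T.X_succ_iff τ).2 ((isCovering_iff_of_discFib hψ).2 h))
    exact ⟨β, τ, r ≫ d, ψ, (discFibProps _).comp ((discFibProps _).of_isIso r) hd, hψ,
      verticesInBase_of_vertObj (vertObj_base_of_vert_reflections hrd)⟩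
  · rintro ⟨β, τ, φ, ψ, hφ, hψ, hβ⟩
    exact (isCovering_iff_of_discFib hψ).1 ((isCovering_iff_of_discFib hφ).2
      ((T.X_succ_iff β).1 hβ.X))

end Reflections

end GaloisTower

/-! ### Limit cubes -/

namespace Cube

variable {C : Type u} [Category.{v} C] {n : ℕ}

/-- The morphism out of the initial vertex of the `n`-cube. -/
def botHom (x : Fin n → Bool) : ⊥ ⟶ x := fun i => homOfLE (bot_le : ⊥ ≤ x i)

instance (x y : Fin n → Bool) : Subsingleton (x ⟶ y) :=
  ⟨fun _ _ => funext fun _ => Subsingleton.elim _ _⟩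

variable (C n) in
/-- The `(n + 1)`-cube given by a morphism of `n`-cubes. -/
def ofArrow : Arrow (Cube C n) ⥤ Cube C (n + 1) :=
  arrowToFunctor (Cube C n) ⋙ Functor.uncurry ⋙ (Functor.whiskeringLeft _ _ _).obj (splitFirst n)

section OfArrow

variable (a : Arrow (Cube C n)) {x y : Fin n → Bool}

lemma ofArrow_map_false (h : (Fin.cons false x : Fin (n + 1) → Bool) ⟶ Fin.cons false y) :
    ((ofArrow C n).obj a).map h = a.left.map (fun i => h i.succ) := Category.id_comp _

lemma ofArrow_map_true (h : (Fin.cons true x : Fin (n + 1) → Bool) ⟶ Fin.cons true y) :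
    ((ofArrow C n).obj a).map h = a.right.map (fun i => h i.succ) := Category.id_comp _

/-- A morphism in a face of the cube. -/
def consHom (c : Bool) (h : x ⟶ y) : (Fin.cons c x : Fin (n + 1) → Bool) ⟶ Fin.cons c y :=
  Fin.cases (𝟙 c) h

variable (x) in
/-- A morphism between opposite faces of the cube. -/
def falseTrue : (Fin.cons false x : Fin (n + 1) → Bool) ⟶ Fin.cons true x :=
  Fin.cases (homOfLE (Bool.false_le _)) (fun i => 𝟙 (x i))

variable (x) in
lemma ofArrow_map_falseTrue : ((ofArrow C n).obj a).map (falseTrue x) = a.hom.app x := by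
  refine (congrArg (a.hom.app x ≫ ·) ?_).trans (Category.comp_id _)
  exact (congrArg a.right.map (Subsingleton.elim _ (𝟙 x))).trans (a.right.map_id x)

end OfArrow

/-- The morphism of `n`-cubes `f` is a limit cube when viewed as an `(n + 1)`-cube. -/
def IsLimitMap {A B : Cube C n} (f : A ⟶ B) : Prop :=
  ∀ ⦃T : C⦄ (b : T ⟶ B.obj ⊥) (t : ∀ x : Fin n → Bool, x ≠ ⊥ → (T ⟶ A.obj x)),
    (∀ ⦃x y : Fin n → Bool⦄ (hx : x ≠ ⊥) (hy : y ≠ ⊥) (h : x ⟶ y), t x hx ≫ A.map h = t y hy) →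
    (∀ x hx, t x hx ≫ f.app x = b ≫ B.map (botHom x)) →
    ∃! s : T ⟶ A.obj ⊥, s ≫ f.app ⊥ = b ∧ ∀ x hx, s ≫ A.map (botHom x) = t x hx

/-- When the vertices of `B` are terminal, `b` and the compatibility with `f` carry no information,
and only the universal property of the initial cone of `A` remains. -/
lemma isLimitCube_iff {A B : Cube C n} (f : A ⟶ B) (hB : ∀ x, Nonempty (IsTerminal (B.obj x))) :
    A.IsLimitCube ↔ IsLimitMap f := by
  have hB' : ∀ {x} {T : C} (k l : T ⟶ B.obj x), k = l := fun k l => (hB _).some.hom_ext k l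
  constructor
  · rintro ⟨hA⟩ T b t ht -
    let c : Cone ((ObjectProperty.ι fun x : Fin n → Bool => x ≠ ⊥) ⋙ A) :=
      { pt := T
        π :=
          { app := fun x => t x.obj x.property
            naturality := fun x y h => (Category.id_comp _).trans
              (ht x.property y.property h.hom).symm } }
    refine ⟨hA.lift c, ⟨hB' _ _, fun x hx => hA.fac c ⟨x, hx⟩⟩, fun s hs => ?_⟩
    exact hA.uniq c s fun x => hs.2 x.obj x.property
  · intro H
    have H' := fun s : Cone ((ObjectProperty.ι fun x : Fin n → Bool => x ≠ ⊥) ⋙ A) =>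
      H ((hB ⊥).some.from s.pt) (fun x hx => s.π.app ⟨x, hx⟩)
        (fun x y hx hy h => s.w (ObjectProperty.homMk h : (⟨x, hx⟩ : ObjectProperty.FullSubcategory
          fun x : Fin n → Bool => x ≠ ⊥) ⟶ ⟨y, hy⟩)) (fun _ _ => hB' _ _)
    choose l hl hu using H'
    exact ⟨{ lift := l
             fac := fun s x => (hl s).2 x.obj x.property
             uniq := fun s m hm => hu s m ⟨hB' _ _, fun x hx => hm ⟨x, hx⟩⟩ }⟩

lemma cons_false_ne_bot {x : Fin n → Bool} (hx : x ≠ ⊥) :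
    (Fin.cons false x : Fin (n + 1) → Bool) ≠ ⊥ :=
  fun h => hx (funext fun i => congrFun h i.succ)

lemma cons_true_ne_bot (x : Fin n → Bool) : (Fin.cons true x : Fin (n + 1) → Bool) ≠ ⊥ :=
  fun h => Bool.noConfusion (congrFun h 0)

section

variable {a : Arrow (Cube C n)} {T : C} (t : ∀ y : Fin n → Bool, y ≠ ⊥ → (T ⟶ a.left.obj y))
  (r : T ⟶ a.right.obj ⊥)

/-- The family of morphisms to the vertices of an `(n + 1)`-cube given by a family on one face and
a morphism to the initial vertex of the opposite face. -/
def consFamily : ∀ (c : Bool) (y : Fin n → Bool), (c = false → y ≠ ⊥) →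
    (T ⟶ (((arrowToFunctor (Cube C n)).obj a).obj c).obj y)
  | false, y, h => t y (h rfl)
  | true, y, _ => r ≫ a.right.map (botHom y)

lemma consFamily_comp
    (ht : ∀ ⦃x y : Fin n → Bool⦄ (hx : x ≠ ⊥) (hy : y ≠ ⊥) (h : x ⟶ y),
      t x hx ≫ a.left.map h = t y hy)
    (htr : ∀ x hx, t x hx ≫ a.hom.app x = r ≫ a.right.map (botHom x)) :
    ∀ {c d : Bool} {x y : Fin n → Bool} (hx : c = false → x ≠ ⊥) (hy : d = false → y ≠ ⊥)
      (h : c ⟶ d) (k : x ⟶ y), consFamily t r c x hx ≫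
      (((arrowToFunctor (Cube C n)).obj a).map h).app x ≫
        (((arrowToFunctor (Cube C n)).obj a).obj d).map k = consFamily t r d y hy
  | false, false, _, _, hx, hy, h, k =>
    (congrArg (t _ _ ≫ ·) (Category.id_comp _)).trans (ht (hx rfl) (hy rfl) k)
  | true, true, x, y, hx, hy, h, k => by
    refine (congrArg ((r ≫ a.right.map (botHom x)) ≫ ·) (Category.id_comp _)).trans ?_
    refine (Category.assoc _ _ _).trans (congrArg (r ≫ ·) ?_)
    exact (a.right.map_comp _ _).symm.trans (congrArg a.right.map (Subsingleton.elim _ _))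
  | false, true, x, y, hx, hy, h, k => by
    change t x (hx rfl) ≫ a.hom.app x ≫ a.right.map k = r ≫ a.right.map (botHom y)
    rw [← Category.assoc, htr, Category.assoc]
    refine congrArg (r ≫ ·) ?_
    exact (a.right.map_comp _ _).symm.trans (congrArg a.right.map (Subsingleton.elim _ _))
  | true, false, _, _, _, _, h, _ => absurd (leOfHom h) (by decide)

end

/-- A square of `n`-cubes with pointwise pullback `P` is a limit cube if and only if the
comparison map to `P` is. -/
lemma isLimitMap_ofArrow_iff {a b : Arrow (Cube C n)} (f : a ⟶ b) {P : Cube C n}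
    {π₁ : P ⟶ a.right} {π₂ : P ⟶ b.left} {p : a.left ⟶ P}
    (hP : ∀ x, IsPullback (π₁.app x) (π₂.app x) (f.right.app x) (b.hom.app x))
    (h₁ : p ≫ π₁ = a.hom) (h₂ : p ≫ π₂ = f.left) :
    IsLimitMap ((ofArrow C n).map f) ↔ IsLimitMap p := by
  have e₁ : ∀ x, p.app x ≫ π₁.app x = a.hom.app x := fun x => by rw [← h₁]; rfl
  have e₂ : ∀ x, p.app x ≫ π₂.app x = f.left.app x := fun x => by rw [← h₂]; rfl
  constructor
  · intro H T s t ht hs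
    -- The family `t` on one face and `r`, spread over the opposite face, form a family on the
    -- (n+1)-cube without its initial vertex.
    let r : T ⟶ a.right.obj ⊥ := s ≫ π₁.app ⊥
    have htr : ∀ x hx, t x hx ≫ a.hom.app x = r ≫ a.right.map (botHom x) := fun x hx => by
      rw [← e₁, reassoc_of% (hs x hx), Category.assoc, ← π₁.naturality]
    have hF : ∀ x : Fin (n + 1) → Bool, x ≠ ⊥ → (x 0 = false → (fun i : Fin n => x i.succ) ≠ ⊥) :=
      fun x hx h h' => hx (funext (Fin.cases h (congrFun h')))
    -- Both problems have the same solutions `m`: through the pullback at `⊥`, the equation `m ≫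
    -- p.app ⊥ = s` amounts to the equation for `f.left` together with the condition at the vertex
    -- `(1, ⊥)`.
    have key : ∀ m : T ⟶ a.left.obj ⊥, (m ≫ f.left.app ⊥ = s ≫ π₂.app ⊥ ∧
        ∀ x hx, m ≫ ((ofArrow C n).obj a).map (botHom x) =
          consFamily t r (x 0) (fun i => x i.succ) (hF x hx)) ↔
        (m ≫ p.app ⊥ = s ∧ ∀ x hx, m ≫ a.left.map (botHom x) = t x hx) := by
      intro m
      constructor
      · rintro ⟨hm, hm'⟩
        refine ⟨(hP ⊥).hom_ext ?_ ?_, fun x hx => ?_⟩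
        · have := hm' (Fin.cons true ⊥) (cons_true_ne_bot _)
          change m ≫ a.hom.app ⊥ ≫ a.right.map (botHom ⊥) = r ≫ a.right.map (botHom ⊥) at this
          rwa [Subsingleton.elim (botHom (⊥ : Fin n → Bool)) (𝟙 _), a.right.map_id,
            Category.comp_id, Category.comp_id, ← e₁, ← Category.assoc] at this
        · rw [Category.assoc, e₂, hm]
        · have := hm' (Fin.cons false x) (cons_false_ne_bot hx)
          change m ≫ 𝟙 _ ≫ a.left.map (botHom x) = t x hx at this
          rwa [Category.id_comp] at this
      · rintro ⟨hm, hm'⟩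
        refine ⟨by rw [← e₂, reassoc_of% hm], fun x hx => ?_⟩
        obtain ⟨c, x, rfl⟩ : ∃ c y, x = Fin.cons c y := ⟨x 0, Fin.tail x, (Fin.cons_self_tail x).symm⟩
        cases c with
        | false =>
          have hx' : x ≠ ⊥ := hF _ hx rfl
          exact (congrArg (m ≫ ·) (Category.id_comp _)).trans (hm' x hx')
        | true =>
          change m ≫ a.hom.app ⊥ ≫ a.right.map (botHom x) = (s ≫ π₁.app ⊥) ≫ a.right.map (botHom x)
          rw [← e₁, Category.assoc, reassoc_of% hm, Category.assoc]
    have := H (s ≫ π₂.app ⊥) (fun x hx => consFamily t r (x 0) (fun i => x i.succ) (hF x hx))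
      (fun x y hx hy h => consFamily_comp t r ht htr (hF x hx) (hF y hy) (h 0) (fun i => h i.succ))
      (fun x hx => by
        obtain ⟨c, x, rfl⟩ : ∃ c y, x = Fin.cons c y := ⟨x 0, Fin.tail x, (Fin.cons_self_tail x).symm⟩
        cases c with
        | false =>
          have hx' : x ≠ ⊥ := hF _ hx rfl
          change t x hx' ≫ f.left.app x = (s ≫ π₂.app ⊥) ≫ 𝟙 _ ≫ b.left.map (botHom x)
          rw [← e₂, reassoc_of% (hs x hx'), Category.id_comp, Category.assoc, ← π₂.naturality]
        | true =>
          change ((s ≫ π₁.app ⊥) ≫ a.right.map (botHom x)) ≫ f.right.app x =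
            (s ≫ π₂.app ⊥) ≫ b.hom.app ⊥ ≫ b.right.map (botHom x)
          rw [Category.assoc, Category.assoc, f.right.naturality, ← Category.assoc (π₁.app ⊥),
            (hP ⊥).w, Category.assoc, Category.assoc])
    exact (existsUnique_congr key).1 this
  · intro H T s t ht hs
    let r : T ⟶ a.right.obj ⊥ := t (Fin.cons true ⊥) (cons_true_ne_bot _)
    have hr : r ≫ f.right.app ⊥ = s ≫ b.hom.app ⊥ := by
      have := hs (Fin.cons true ⊥) (cons_true_ne_bot _)
      change r ≫ f.right.app ⊥ = (s : T ⟶ b.left.obj ⊥) ≫ b.hom.app ⊥ ≫ b.right.map (botHom ⊥) at this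
      rw [this, Subsingleton.elim (botHom (⊥ : Fin n → Bool)) (𝟙 _), b.right.map_id]
      exact congrArg (CategoryStruct.comp (Y := b.left.obj ⊥) s) (Category.comp_id _)
    have htrue : ∀ x, t (Fin.cons true x) (cons_true_ne_bot x) = r ≫ a.right.map (botHom x) := by
      intro x
      rw [← ht (cons_true_ne_bot _) (cons_true_ne_bot x) (consHom true (botHom x)),
        ofArrow_map_true]
      rfl
    let t' : ∀ x : Fin n → Bool, x ≠ ⊥ → (T ⟶ a.left.obj x) := fun x hx =>
      t (Fin.cons false x) (cons_false_ne_bot hx)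
    have ht' : ∀ ⦃x y : Fin n → Bool⦄ (hx : x ≠ ⊥) (hy : y ≠ ⊥) (h : x ⟶ y),
        t' x hx ≫ a.left.map h = t' y hy := fun x y hx hy h => by
      have := ht (cons_false_ne_bot hx) (cons_false_ne_bot hy) (consHom false h)
      rwa [ofArrow_map_false] at this
    -- Conversely, the component `r` at the vertex `(1, ⊥)` determines all components on its face
    -- and, with `s`, a map into the pullback.
    let s' : T ⟶ P.obj ⊥ := (hP ⊥).lift r s hr
    have hs₁ : s' ≫ π₁.app ⊥ = r := (hP ⊥).lift_fst _ _ _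
    have hs₂ : s' ≫ π₂.app ⊥ = s := (hP ⊥).lift_snd _ _ _
    have key : ∀ m : T ⟶ a.left.obj ⊥, (m ≫ p.app ⊥ = s' ∧
        ∀ x hx, m ≫ a.left.map (botHom x) = t' x hx) ↔ (m ≫ f.left.app ⊥ = s ∧
        ∀ x hx, m ≫ ((ofArrow C n).obj a).map (botHom x) = t x hx) := by
      intro m
      constructor
      · rintro ⟨hm, hm'⟩
        refine ⟨by rw [← e₂, reassoc_of% hm, hs₂], fun x hx => ?_⟩
        obtain ⟨c, x, rfl⟩ : ∃ c y, x = Fin.cons c y := ⟨x 0, Fin.tail x, (Fin.cons_self_tail x).symm⟩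
        cases c with
        | false =>
          have hx' : x ≠ ⊥ := fun h => hx (h ▸ funext (Fin.cases rfl fun _ => rfl))
          exact (congrArg (m ≫ ·) (Category.id_comp _)).trans (hm' x hx')
        | true =>
          rw [htrue]
          change m ≫ a.hom.app ⊥ ≫ a.right.map (botHom x) = r ≫ a.right.map (botHom x)
          rw [← e₁, Category.assoc, reassoc_of% hm, ← Category.assoc, hs₁]
      · rintro ⟨hm, hm'⟩
        refine ⟨(hP ⊥).hom_ext ?_ ?_, fun x hx => ?_⟩
        · have := hm' (Fin.cons true ⊥) (cons_true_ne_bot _)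
          change m ≫ a.hom.app ⊥ ≫ a.right.map (botHom ⊥) = r at this
          rwa [Subsingleton.elim (botHom (⊥ : Fin n → Bool)) (𝟙 _), a.right.map_id,
            Category.comp_id, ← e₁, ← Category.assoc, ← hs₁] at this
        · rw [Category.assoc, e₂, hm, hs₂]
        · have := hm' (Fin.cons false x) (cons_false_ne_bot hx)
          change m ≫ 𝟙 _ ≫ a.left.map (botHom x) = t' x hx at this
          rwa [Category.id_comp] at this
    refine (existsUnique_congr key).1 (H s' t' ht' fun x hx => ?_)
    have hx' := cons_false_ne_bot hx
    refine (hP x).hom_ext ?_ ?_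
    · rw [Category.assoc, e₁, Category.assoc, π₁.naturality, ← Category.assoc, hs₁, ← htrue x,
        ← ht hx' (cons_true_ne_bot x) (falseTrue x), ofArrow_map_falseTrue]
      rfl
    · rw [Category.assoc, e₂, Category.assoc, π₂.naturality, ← Category.assoc, hs₂]
      exact (hs _ hx').trans (congrArg (s ≫ ·) (Category.id_comp _))

/-- A 0-cube has only the initial vertex, so the families are empty. -/
lemma isLimitMap_iff_isIso {A B : Cube C 0} (f : A ⟶ B) : IsLimitMap f ↔ IsIso (f.app ⊥) := by
  have h0 : ∀ x : Fin 0 → Bool, x = ⊥ := fun _ => Subsingleton.elim _ _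
  constructor
  · intro H
    obtain ⟨s, hs, -⟩ := H (𝟙 _) (fun x hx => absurd (h0 x) hx)
      (fun x _ hx => absurd (h0 x) hx) (fun x hx => absurd (h0 x) hx)
    refine ⟨s, ?_, hs.1⟩
    exact (H (f.app ⊥) (fun x hx => absurd (h0 x) hx) (fun x _ hx => absurd (h0 x) hx)
      (fun x hx => absurd (h0 x) hx)).unique
      ⟨by rw [Category.assoc, hs.1, Category.comp_id], fun x hx => absurd (h0 x) hx⟩
      ⟨Category.id_comp _, fun x hx => absurd (h0 x) hx⟩
  · intro _ T b t _ _
    exact ⟨b ≫ inv (f.app ⊥), ⟨by simp, fun x hx => absurd (h0 x) hx⟩,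
      fun s hs => by rw [← hs.1]; simp⟩

/-- The `(n + 1)`-cube given by a morphism `f` of `n`-cubes is a limit cube if and only
if `f` is. -/
lemma isLimitCube_ofArrow_iff [HasTerminal C] (a : Arrow (Cube C n)) :
    ((ofArrow C n).obj a).IsLimitCube ↔ IsLimitMap a.hom := by
  let K : Cube C n := (Functor.const _).obj (⊤_ C)
  let k : ∀ A : Cube C n, A ⟶ K := fun A => { app := fun _ => terminal.from _ }
  have hK : ∀ {A : Cube C n} (l l' : A ⟶ K), l = l' := fun l l' => by
    ext x; exact terminal.hom_ext _ _
  -- For the square from `a` to the identity of the terminal cube, the comparison map is `a.hom`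
  -- itself, so the criterion for squares applies.
  let f : a ⟶ Arrow.mk (𝟙 K) := Arrow.homMk (k _) (k _) (hK _ _)
  rw [isLimitCube_iff ((ofArrow C n).map f)]
  · refine isLimitMap_ofArrow_iff f (P := a.right) (π₁ := 𝟙 _) (π₂ := k _) (p := a.hom)
      (fun x => ?_) (Category.comp_id _) (hK _ _)
    have : IsIso ((𝟙 a.right : a.right ⟶ a.right).app x) := inferInstanceAs (IsIso (𝟙 _))
    have : IsIso ((𝟙 K : K ⟶ K).app x) := inferInstanceAs (IsIso (𝟙 _))
    exact IsPullback.of_horiz_isIso (fst := (𝟙 a.right : a.right ⟶ a.right).app x)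
      (g := (𝟙 K : K ⟶ K).app x)
      ⟨terminal.hom_ext _ _⟩
  · intro x
    obtain ⟨c, x, rfl⟩ : ∃ c y, x = Fin.cons c y := ⟨x 0, Fin.tail x, (Fin.cons_self_tail x).symm⟩
    cases c <;> exact ⟨terminalIsTerminal⟩

end Cube

/-! ### Discrete fibrations as limit cubes -/

namespace NExt

variable {C : Type (max u v)} [Category.{v} C] [Regular C]

lemma isPullback_cube : ∀ {n : ℕ} {κ μ ν π : NExt.{v, u} C n} {a : π ⟶ κ} {b : π ⟶ ν} {f : κ ⟶ μ} {g : ν ⟶ μ},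
    IsPullback a b f g → extensions.{v, u} C n f → ∀ x, IsPullback (((cube.{v, u} C n).map a).app x)
      (((cube.{v, u} C n).map b).app x) (((cube.{v, u} C n).map f).app x)
      (((cube.{v, u} C n).map g).app x)
  | 0, _, _, _, _, _, _, _, _, h, _, _ => h
  | n + 1, _, _, _, _, _, _, _, _, h, hf, x => by
    obtain ⟨c, x, rfl⟩ : ∃ c y, x = Fin.cons c y := ⟨x 0, Fin.tail x, (Fin.cons_self_tail x).symm⟩
    cases c with
    | false => exact isPullback_cube (isPullback_topMap h hf) (topMap_mem hf) x
    | true => exact isPullback_cube (isPullback_botMap h hf) (botMap_mem hf) x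

/-- Both sides pass to the comparison map in the same way, because pullbacks of extensions are
computed at the vertices. -/
lemma discFib_iff_isLimitMap : ∀ {n : ℕ} {κ μ : NExt.{v, u} C n} {f : κ ⟶ μ}, extensions.{v, u} C n f →
    (discFib.{v, u} C n f ↔ Cube.IsLimitMap ((cube.{v, u} C n).map f))
  | 0, _, _, f, _ => (Cube.isLimitMap_iff_isIso ((cube.{v, u} C 0).map f)).symm
  | n + 1, κ, μ, f, hf => by
    obtain ⟨P, p₁, p₂, p, hP, hp₁, hp₂, hp⟩ := exists_comparison hf
    have h := Cube.isLimitMap_ofArrow_iff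
      ((cube.{v, u} C n).mapArrow.map ((NExt.forget.{v, u} C n).map f))
      (P := (cube.{v, u} C n).obj P) (π₁ := (cube.{v, u} C n).map p₁)
      (π₂ := (cube.{v, u} C n).map p₂) (p := (cube.{v, u} C n).map p)
      (isPullback_cube hP (botMap_mem hf))
      (((cube.{v, u} C n).map_comp _ _).symm.trans (congrArg (cube.{v, u} C n).map hp₁))
      (((cube.{v, u} C n).map_comp _ _).symm.trans (congrArg (cube.{v, u} C n).map hp₂))
    refine Iff.trans ?_ h.symm
    refine Iff.trans ?_ (discFib_iff_isLimitMap hp)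
    exact ⟨fun h => discFib_comparison h hP hp₁ hp₂,
      fun h => ⟨hf, P, p₁, p₂, p, hP, hp₁, hp₂, h⟩⟩

lemma isDiscreteFibration_iff {n : ℕ} {κ μ : NExt.{v, u} C n} {f : κ ⟶ μ} :
    IsDiscreteFibration f ↔ discFib.{v, u} C n f := by
  refine ⟨fun ⟨hf, h⟩ => (discFib_iff_isLimitMap hf).2 ?_,
    fun h => ⟨(discFibProps n).mem h, ?_⟩⟩
  · exact (Cube.isLimitCube_ofArrow_iff _).1 h
  · exact (Cube.isLimitCube_ofArrow_iff _).2
      ((discFib_iff_isLimitMap ((discFibProps n).mem h)).1 h)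

end NExt

lemma GaloisTower.liesInBase_iff {C : Type (max u v)} [Category.{v} C] {T : GaloisTower.{v, u} C} :
    ∀ {n : ℕ} {β : NExt.{v, u} C n}, T.LiesInBase β ↔ T.VerticesInBase n β
  | 0, _ => ⟨fun h => h ⊥, fun h _ => h⟩
  | n + 1, β => by
    refine Fin.forall_fin_succ_pi.trans (Bool.forall_bool.trans ?_)
    exact and_congr (GaloisTower.liesInBase_iff (β := NExt.top β))
      (GaloisTower.liesInBase_iff (β := NExt.bot β))

/-! ### Multiple extensions are determined by their cubes -/

namespace NExt

variable {C : Type (max u v)} [Category.{v} C]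

lemma cube_map_injective : ∀ {n : ℕ} {κ μ : NExt.{v, u} C n} {f g : κ ⟶ μ},
    (cube.{v, u} C n).map f = (cube.{v, u} C n).map g → f = g
  | 0, _, _, _, _, h => congrArg (fun φ => φ.app ⊥) h
  | _ + 1, _, _, _, _, h => hom_ext
      (cube_map_injective (NatTrans.ext (funext fun x =>
        congrArg (fun φ => φ.app (Fin.cons false x)) h)))
      (cube_map_injective (NatTrans.ext (funext fun x =>
        congrArg (fun φ => φ.app (Fin.cons true x)) h)))

lemma cube_map_surjective : ∀ {n : ℕ} {κ μ : NExt.{v, u} C n}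
    (φ : (cube.{v, u} C n).obj κ ⟶ (cube.{v, u} C n).obj μ), ∃ f, (cube.{v, u} C n).map f = φ
  | 0, κ, μ, φ => by
    refine ⟨φ.app ⊥, ?_⟩
    ext x
    obtain rfl : x = ⊥ := Subsingleton.elim _ _
    rfl
  | n + 1, κ, μ, φ => by
    let φt : (cube.{v, u} C n).obj (top κ) ⟶ (cube.{v, u} C n).obj (top μ) :=
      { app := fun x => φ.app (Fin.cons false x)
        naturality := fun x y h => by
          have := φ.naturality (Cube.consHom false h)
          erw [Cube.ofArrow_map_false, Cube.ofArrow_map_false] at this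
          exact this }
    let φb : (cube.{v, u} C n).obj (bot κ) ⟶ (cube.{v, u} C n).obj (bot μ) :=
      { app := fun x => φ.app (Fin.cons true x)
        naturality := fun x y h => by
          have := φ.naturality (Cube.consHom true h)
          erw [Cube.ofArrow_map_true, Cube.ofArrow_map_true] at this
          exact this }
    obtain ⟨t, ht⟩ := cube_map_surjective φt
    obtain ⟨b, hb⟩ := cube_map_surjective φb
    -- The square commutes because it does so on cubes, by naturality of `φ` along the edges in the
    -- first direction.
    refine ⟨homMk t b (cube_map_injective ?_), ?_⟩
    · rw [Functor.map_comp, Functor.map_comp, ht, hb]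
      ext x
      exact ((congrArg (φ.app (Fin.cons false x) ≫ ·) (Cube.ofArrow_map_falseTrue _ x)).symm.trans
        (φ.naturality (Cube.falseTrue x)).symm).trans
        (congrArg (· ≫ φ.app (Fin.cons true x)) (Cube.ofArrow_map_falseTrue _ x))
    · ext x
      obtain ⟨c, x, rfl⟩ : ∃ c y, x = Fin.cons c y :=
        ⟨x 0, Fin.tail x, (Fin.cons_self_tail x).symm⟩
      cases c with
      | false => exact congrArg (fun φ => φ.app x) ht
      | true => exact congrArg (fun φ => φ.app x) hb

lemma nonempty_iso_of_cube {n : ℕ} {κ μ : NExt.{v, u} C n}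
    (e : (cube.{v, u} C n).obj κ ≅ (cube.{v, u} C n).obj μ) : Nonempty (κ ≅ μ) := by
  obtain ⟨f, hf⟩ := cube_map_surjective e.hom
  obtain ⟨g, hg⟩ := cube_map_surjective e.inv
  exact ⟨⟨f, g, cube_map_injective (by simp [hf, hg]), cube_map_injective (by simp [hf, hg])⟩⟩

end NExt

/-! ### Morphisms of cubes defined on faces -/

namespace Cube

variable {C : Type u} [Category.{v} C] {n : ℕ}

variable (n) in
/-- The inclusion of a face in the direction of the first coordinate. -/
def consFunctor (c : Bool) : (Fin n → Bool) ⥤ (Fin (n + 1) → Bool) where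
  obj x := Fin.cons c x
  map h := consHom c h

/-- The restriction of a morphism of the cube to the last coordinates. -/
def tailHom {c d : Bool} {x y : Fin n → Bool}
    (h : (Fin.cons c x : Fin (n + 1) → Bool) ⟶ Fin.cons d y) : x ⟶ y := fun i => h i.succ

section

variable {X Y : Cube C (n + 1)} (e : ∀ c x, X.obj (Fin.cons c x) ⟶ Y.obj (Fin.cons c x))

/-- The components of a family of morphisms given on the two opposite faces of a cube. -/
def consApp (x : Fin (n + 1) → Bool) : X.obj x ⟶ Y.obj x :=
  X.map (eqToHom (Fin.cons_self_tail x).symm) ≫ e (x 0) (Fin.tail x) ≫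
    Y.map (eqToHom (Fin.cons_self_tail x))

lemma consApp_cons (c : Bool) (x : Fin n → Bool) : consApp e (Fin.cons c x) = e c x := by
  -- The `eqToHom`s are replaced by arbitrary endomorphisms of the vertex, all of which are
  -- identities.
  have key : ∀ k l : (Fin.cons c x : Fin (n + 1) → Bool) ⟶ Fin.cons c x,
      X.map k ≫ e c x ≫ Y.map l = e c x := fun k l => by
    rw [Subsingleton.elim k (𝟙 _), Subsingleton.elim l (𝟙 _), X.map_id, Y.map_id,
      Category.id_comp, Category.comp_id]
  exact key _ _

/-- A morphism of cubes given on the two opposite faces. -/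
def homOfCons (h₁ : ∀ c {x y : Fin n → Bool} (h : x ⟶ y),
      X.map (consHom c h) ≫ e c y = e c x ≫ Y.map (consHom c h))
    (h₂ : ∀ x, X.map (falseTrue x) ≫ e true x = e false x ≫ Y.map (falseTrue x)) : X ⟶ Y where
  app := consApp e
  naturality x y h := by
    obtain ⟨c, x, rfl⟩ : ∃ c y, x = Fin.cons c y := ⟨x 0, Fin.tail x, (Fin.cons_self_tail x).symm⟩
    obtain ⟨d, y, rfl⟩ : ∃ c z, y = Fin.cons c z := ⟨y 0, Fin.tail y, (Fin.cons_self_tail y).symm⟩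
    rw [consApp_cons, consApp_cons]
    have key : ∀ c (h : (Fin.cons c x : Fin (n + 1) → Bool) ⟶ Fin.cons c y),
        X.map h ≫ e c y = e c x ≫ Y.map h := fun c h => by
      rw [Subsingleton.elim h (consHom c (tailHom h)), h₁]
    cases c <;> cases d
    · exact key _ h
    · rw [Subsingleton.elim h (falseTrue x ≫ consHom true (tailHom h)), X.map_comp,
        Y.map_comp, Category.assoc, h₁, reassoc_of% (h₂ x)]
    · exact absurd (leOfHom (h 0)) (show ¬ true ≤ false by decide)
    · exact key _ h

end

/-- The functor which permutes the directions of the cube. -/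
def reindex (σ : Equiv.Perm (Fin n)) : (Fin n → Bool) ⥤ (Fin n → Bool) where
  obj x i := x (σ.symm i)
  map h i := h (σ.symm i)

variable (C) in
/-- Permutation of the directions of cubes, as a functor. -/
def permuteFunctor (σ : Equiv.Perm (Fin n)) : Cube C n ⥤ Cube C n :=
  (Functor.whiskeringLeft _ _ _).obj (reindex σ)

end Cube

/-! ### Exchanging the first two directions -/

namespace NExt

variable {C : Type (max u v)} [Category.{v} C] [Regular C] {n : ℕ}

/-- The double extension `κ`, viewed as an arrow in the other direction. -/
def flipObj (κ : NExt.{v, u} C (n + 2)) : NExt.{v, u} C (n + 2) :=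
  ofHom (A := ofHom (topMap (arr κ)) (topMap_mem (arr_mem κ)))
    (B := ofHom (botMap (arr κ)) (botMap_mem (arr_mem κ)))
    (homMk (arr (top κ)) (arr (bot κ)) (w (arr κ)).symm) (by
      obtain ⟨P, p₁, p₂, p, hP, hp₁, hp₂, hp⟩ := exists_comparison (arr_mem κ)
      exact mem_of_comparison (P := P) (π₁ := p₂) (π₂ := p₁) (p := p) (arr_mem (bot κ)) hP.flip
        hp₂ hp₁ hp)

/-- The action of `flipObj` on morphisms. -/
def flipMap {κ μ : NExt.{v, u} C (n + 2)} (f : κ ⟶ μ) : flipObj κ ⟶ flipObj μ :=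
  homMk
    (homMk (κ := top (flipObj κ)) (μ := top (flipObj μ))
      (topMap (κ := top κ) (μ := top μ) (topMap f)) (topMap (κ := bot κ) (μ := bot μ) (botMap f))
      (topMap_comm (w f)))
    (homMk (κ := bot (flipObj κ)) (μ := bot (flipObj μ))
      (botMap (κ := top κ) (μ := top μ) (topMap f)) (botMap (κ := bot κ) (μ := bot μ) (botMap f))
      (botMap_comm (w f)))
    (hom_ext (w (κ := top κ) (μ := top μ) (topMap f)) (w (κ := bot κ) (μ := bot μ) (botMap f)))

/-- Viewed as a cube in three directions, `f` has an innermost comparison map `x` into `V`, a limit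
of the cube without its initial vertex. This limit does not see the order of the directions, so
exchanging the first two directions of `κ` and `μ` gives the same `x`; it decides both claims. -/
lemma flipMap_mem {κ μ : NExt.{v, u} C (n + 2)} {f : κ ⟶ μ} (hf : extensions.{v, u} C (n + 2) f) :
    extensions.{v, u} C (n + 2) (flipMap f) ∧ (discFib.{v, u} C (n + 2) f → discFib.{v, u} C (n + 2) (flipMap f)) := by
  obtain ⟨Q, q₁, q₂, q, hQ, hq₁, hq₂, hq⟩ := exists_comparison hf
  have hQt := isPullback_topMap hQ (botMap_mem hf)
  have hQb := isPullback_botMap hQ (botMap_mem hf)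
  obtain ⟨V, v₁, v₂, x, hV, hx₁, hx₂, hx⟩ := exists_comparison hq
  have hb : extensions.{v, u} C (n + 1) (botMap (flipMap f)) :=
    mem_of_comparison (κ := bot (flipObj κ)) (μ := bot (flipObj μ)) (P := bot Q)
      (π₁ := botMap (μ := bot κ) q₁) (π₂ := botMap (μ := top μ) q₂) (p := botMap (κ := top κ) q)
      (botMap_mem (f := botMap (κ := κ) (μ := μ) f) (botMap_mem hf)) hQb
      (congrArg (botMap (κ := top κ)) hq₁) (congrArg (botMap (κ := top κ)) hq₂) (botMap_mem hq)
  obtain ⟨K, k₁, k₂, hK⟩ := (isExtensionClass (n + 1)).exists_pullback hb (arr (flipObj μ))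
  let k : top (flipObj κ) ⟶ K := hK.lift (arr (flipObj κ)) (topMap (flipMap f)) (w _).symm
  have hk₁ : k ≫ k₁ = arr (flipObj κ) := hK.lift_fst _ _ _
  have hk₂ : k ≫ k₂ = topMap (flipMap f) := hK.lift_snd _ _ _
  let t₁ : top K ⟶ bot (top κ) := topMap (μ := bot (flipObj κ)) k₁
  let t₂ : top K ⟶ top (top μ) := topMap (μ := top (flipObj μ)) k₂
  let b₁ : bot K ⟶ bot (bot κ) := botMap (μ := bot (flipObj κ)) k₁
  let b₂ : bot K ⟶ top (bot μ) := botMap (μ := top (flipObj μ)) k₂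
  let kt : top (top κ) ⟶ top K := topMap (κ := top (flipObj κ)) k
  let kb : top (bot κ) ⟶ bot K := botMap (κ := top (flipObj κ)) k
  have hKt : IsPullback t₁ t₂ (botMap (topMap f)) (arr (top μ)) := isPullback_topMap hK hb
  have hKb : IsPullback b₁ b₂ (botMap (botMap f)) (arr (bot μ)) := isPullback_botMap hK hb
  have hkt₁ : kt ≫ t₁ = arr (top κ) := congrArg (topMap (κ := top (flipObj κ))) hk₁
  have hkt₂ : kt ≫ t₂ = topMap (topMap f) := congrArg (topMap (κ := top (flipObj κ))) hk₂
  have hkb₁ : kb ≫ b₁ = arr (bot κ) := congrArg (botMap (κ := top (flipObj κ))) hk₁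
  have hkb₂ : kb ≫ b₂ = topMap (botMap f) := congrArg (botMap (κ := top (flipObj κ))) hk₂
  have hw₁ : t₁ ≫ botMap (arr κ) = arr K ≫ b₁ := w k₁
  have hw₂ : t₂ ≫ topMap (arr μ) = arr K ≫ b₂ := w k₂
  have hkb : extensions.{v, u} C n kb := comparison_mem (botMap_mem hf) hKb hkb₁ hkb₂
  have hV₁ : v₁ ≫ botMap (topMap f) = (v₂ ≫ topMap q₂) ≫ arr (top μ) := by
    rw [Category.assoc, w, ← hV.w_assoc, ← hq₂, botMap_comp]
  let y₂ : V ⟶ top K := hKt.lift v₁ (v₂ ≫ topMap q₂) hV₁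
  have hy₁ : y₂ ≫ t₁ = v₁ := hKt.lift_fst _ _ _
  have hy₂ : y₂ ≫ t₂ = v₂ ≫ topMap q₂ := hKt.lift_snd _ _ _
  -- `V` was built from the comparison `q` of `f`; it is also the comparison object of `k`, hence of
  -- the flipped square.
  have hP : IsPullback (v₂ ≫ topMap q₁) y₂ kb (arr K) := by
    refine IsPullback.mk' ?_ (fun R a b ha hb => ?_) (fun R a b h => ?_)
    · refine hKb.hom_ext ?_ ?_
      · rw [Category.assoc, Category.assoc, Category.assoc, hkb₁, ← hw₁, reassoc_of% hy₁, w,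
          ← hV.w_assoc, ← hq₁, botMap_comp]
      · rw [Category.assoc, Category.assoc, Category.assoc, hkb₂, ← hw₂, reassoc_of% hy₂, hQt.w]
    · refine hV.hom_ext (by rw [← hy₁, reassoc_of% hb]) (hQt.hom_ext ?_ ?_)
      · rw [Category.assoc, Category.assoc, ha]
      · rw [Category.assoc, Category.assoc, ← hy₂, reassoc_of% hb]
    · have h₁ : a ≫ arr (bot κ) = b ≫ t₁ ≫ botMap (arr κ) := by
        rw [hw₁, ← reassoc_of% h, hkb₁]
      have h₂ : a ≫ topMap (botMap f) = (b ≫ t₂) ≫ topMap (arr μ) := by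
        rw [Category.assoc, hw₂, ← reassoc_of% h, hkb₂]
      have h₃ : (b ≫ t₁) ≫ botMap q = hQt.lift a (b ≫ t₂) h₂ ≫ arr Q := by
        refine hQb.hom_ext ?_ ?_
        · rw [Category.assoc, Category.assoc, Category.assoc, ← w, hQt.lift_fst_assoc, h₁,
            ← botMap_comp, hq₁]
        · rw [Category.assoc, Category.assoc, Category.assoc, ← w, hQt.lift_snd_assoc,
            ← botMap_comp, hq₂, hKt.w, Category.assoc]
      refine ⟨hV.lift (b ≫ t₁) (hQt.lift a (b ≫ t₂) h₂) h₃, ?_, hKt.hom_ext ?_ ?_⟩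
      · rw [hV.lift_snd_assoc, hQt.lift_fst]
      · rw [Category.assoc, hy₁, hV.lift_fst]
      · rw [Category.assoc, hy₂, hV.lift_snd_assoc, hQt.lift_snd]
  have hx₁' : x ≫ v₂ ≫ topMap q₁ = topMap (arr κ) := by
    rw [reassoc_of% hx₂, ← topMap_comp, hq₁]
  have hx₂' : x ≫ y₂ = kt := hKt.hom_ext
    (by rw [Category.assoc, hy₁, hx₁, hkt₁])
    (by rw [Category.assoc, hy₂, reassoc_of% hx₂, ← topMap_comp, hq₂, hkt₂])
  have hkE : extensions.{v, u} C (n + 1) k := mem_of_comparison hkb hP hx₁' hx₂' hx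
  have hfE : extensions.{v, u} C (n + 2) (flipMap f) := mem_of_comparison hb hK hk₁ hk₂ hkE
  refine ⟨hfE, fun hD => ⟨hfE, K, k₁, k₂, k, hK, hk₁, hk₂, hkE, V, v₂ ≫ topMap q₁, y₂, x, hP,
    hx₁', hx₂', ?_⟩⟩
  exact discFib_comparison (discFib_comparison hD hQ hq₁ hq₂) hV hx₁ hx₂

end NExt

/-! ### Permuting the directions of a multiple extension -/

namespace NExt

variable {C : Type (max u v)} [Category.{v} C] [Regular C] {n : ℕ}

variable (C n) in
/-- The functor which exchanges the first two directions of a multiple extension. -/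
def flip : ExtFunctor.{v, u} C (n + 2) (n + 2) where
  F :=
    { obj := flipObj
      map := flipMap
      map_id := fun _ => hom_ext (hom_ext rfl rfl) (hom_ext rfl rfl)
      map_comp := fun _ _ => hom_ext (hom_ext rfl rfl) (hom_ext rfl rfl) }
  mem hf := (flipMap_mem hf).1
  isPullback {κ μ ν π a b f g} h hf := by
    have ht := isPullback_topMap h hf
    have hb := isPullback_botMap h hf
    have htt := isPullback_topMap ht (topMap_mem hf)
    have htb := isPullback_botMap ht (topMap_mem hf)
    have hbt := isPullback_topMap hb (botMap_mem hf)
    have hbb := isPullback_botMap hb (botMap_mem hf)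
    exact isPullback_of_components (isPullback_of_components htt hbt)
      (isPullback_of_components htb hbb)

/-- A functor between categories of multiple extensions which preserves discrete fibrations. -/
def ExtFunctor.PreservesDiscFib {m n : ℕ} (G : ExtFunctor.{v, u} C m n) : Prop :=
  ∀ ⦃κ μ : NExt.{v, u} C m⦄ ⦃f : κ ⟶ μ⦄, discFib.{v, u} C m f → discFib.{v, u} C n (G.F.map f)

lemma flip_preservesDiscFib : (flip.{v, u} C n).PreservesDiscFib :=
  fun _ _ _ hf => (flipMap_mem ((discFibProps _).mem hf)).2 hf

lemma ExtFunctor.PreservesDiscFib.lift {m n : ℕ} {G : ExtFunctor.{v, u} C m n}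
    (hG : G.PreservesDiscFib) : G.lift.PreservesDiscFib := by
  rintro κ μ f ⟨hf, P, p₁, p₂, p, hP, hp₁, hp₂, hp⟩
  exact ⟨G.lift.mem hf, G.F.obj P, G.F.map p₁, G.F.map p₂, G.F.map p,
    G.isPullback hP (botMap_mem hf), (G.F.map_comp _ _).symm.trans (congrArg G.F.map hp₁),
    (G.F.map_comp _ _).symm.trans (congrArg G.F.map hp₂), hG hp⟩

end NExt

lemma Cube.map_comm {C : Type u} [Category.{v} C] {n : ℕ} (Z : Cube C n) {x y y' z : Fin n → Bool}
    (a : x ⟶ y) (b : y ⟶ z) (a' : x ⟶ y') (b' : y' ⟶ z) :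
    Z.map a ≫ Z.map b = Z.map a' ≫ Z.map b' := by
  rw [← Z.map_comp, ← Z.map_comp, Subsingleton.elim (a ≫ b)]

/-! ### The cube of a flipped extension -/

namespace NExt

open HigherCoverings.Cube

variable {C : Type (max u v)} [Category.{v} C] [Regular C] {n : ℕ}

omit [Regular C] in
lemma cube_map_falseTrue (κ : NExt.{v, u} C (n + 1)) (x : Fin n → Bool) :
    ((cube.{v, u} C (n + 1)).obj κ).map (falseTrue x) = ((cube.{v, u} C n).map (arr κ)).app x :=
  ofArrow_map_falseTrue _ x

omit [Regular C] in
lemma cube_map_consHom_false (κ : NExt.{v, u} C (n + 1)) {x y : Fin n → Bool} (h : x ⟶ y) :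
    ((cube.{v, u} C (n + 1)).obj κ).map (consHom false h) =
      ((cube.{v, u} C n).obj (top κ)).map h :=
  Category.id_comp _

omit [Regular C] in
lemma cube_map_consHom_true (κ : NExt.{v, u} C (n + 1)) {x y : Fin n → Bool} (h : x ⟶ y) :
    ((cube.{v, u} C (n + 1)).obj κ).map (consHom true h) =
      ((cube.{v, u} C n).obj (bot κ)).map h :=
  Category.id_comp _

lemma reindex_swap_cons (c d : Bool) (y : Fin n → Bool) :
    (Fin.cons d (Fin.cons c y : Fin (n + 1) → Bool) : Fin (n + 2) → Bool) =
      (reindex (Equiv.swap 0 1)).obj (Fin.cons c (Fin.cons d y : Fin (n + 1) → Bool)) := by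
  funext i
  refine Fin.cases ?_ (Fin.cases ?_ fun i => ?_) i
  · simp [reindex]
  · simp [reindex]
  · have h : (Equiv.swap (0 : Fin (n + 2)) 1) i.succ.succ = i.succ.succ :=
      Equiv.swap_apply_of_ne_of_ne (Fin.succ_ne_zero _)
        (fun h => Fin.succ_ne_zero i (Fin.succ_injective _ h))
    simp [reindex, h]

section Flip

variable (κ : NExt.{v, u} C (n + 2))

/-- The identification of the vertices of `flipObj κ` with those of `κ`. -/
def flipCell : ∀ (c d : Bool) (y : Fin n → Bool),
    ((cube.{v, u} C (n + 2)).obj (flipObj κ)).obj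
      (Fin.cons c (Fin.cons d y : Fin (n + 1) → Bool)) ⟶
    ((cube.{v, u} C (n + 2)).obj κ).obj (Fin.cons d (Fin.cons c y : Fin (n + 1) → Bool))
  | false, false, y => 𝟙 (((cube.{v, u} C n).obj (top (top κ))).obj y)
  | false, true, y => 𝟙 (((cube.{v, u} C n).obj (top (bot κ))).obj y)
  | true, false, y => 𝟙 (((cube.{v, u} C n).obj (bot (top κ))).obj y)
  | true, true, y => 𝟙 (((cube.{v, u} C n).obj (bot (bot κ))).obj y)

lemma isIso_flipCell : ∀ (c d : Bool) (y : Fin n → Bool), IsIso (flipCell κ c d y)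
  | false, false, y => IsIso.id (((cube.{v, u} C n).obj (top (top κ))).obj y)
  | false, true, y => IsIso.id (((cube.{v, u} C n).obj (top (bot κ))).obj y)
  | true, false, y => IsIso.id (((cube.{v, u} C n).obj (bot (top κ))).obj y)
  | true, true, y => IsIso.id (((cube.{v, u} C n).obj (bot (bot κ))).obj y)

lemma flipCell_consHom (c d : Bool) {x y : Fin n → Bool} (h : x ⟶ y) :
    ((cube.{v, u} C (n + 2)).obj (flipObj κ)).map (consHom c (consHom d h)) ≫ flipCell κ c d y =
      flipCell κ c d x ≫ ((cube.{v, u} C (n + 2)).obj κ).map (consHom d (consHom c h)) := by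
  cases c <;> cases d <;> exact (Category.comp_id _).trans (Category.id_comp _).symm

lemma flipCell_consHom_falseTrue (c : Bool) (x : Fin n → Bool) :
    ((cube.{v, u} C (n + 2)).obj (flipObj κ)).map (consHom c (falseTrue x)) ≫ flipCell κ c true x =
      flipCell κ c false x ≫
        ((cube.{v, u} C (n + 2)).obj κ).map (falseTrue (Fin.cons c x : Fin (n + 1) → Bool)) := by
  cases c
  · exact (Category.comp_id _).trans (((cube_map_consHom_false (flipObj κ) (falseTrue x)).trans
      ((cube_map_falseTrue (top (flipObj κ)) x).trans (cube_map_falseTrue κ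
        (Fin.cons false x)).symm)).trans (Category.id_comp _).symm)
  · exact (Category.comp_id _).trans (((cube_map_consHom_true (flipObj κ) (falseTrue x)).trans
      ((cube_map_falseTrue (bot (flipObj κ)) x).trans (cube_map_falseTrue κ
        (Fin.cons true x)).symm)).trans (Category.id_comp _).symm)

lemma flipCell_falseTrue_cons (d : Bool) (x : Fin n → Bool) :
    ((cube.{v, u} C (n + 2)).obj (flipObj κ)).map
        (falseTrue (Fin.cons d x : Fin (n + 1) → Bool)) ≫ flipCell κ true d x =
      flipCell κ false d x ≫
        ((cube.{v, u} C (n + 2)).obj κ).map (consHom d (falseTrue x)) := by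
  cases d
  · exact (Category.comp_id _).trans (((cube_map_falseTrue (flipObj κ) (Fin.cons false x)).trans
      ((cube_map_consHom_false κ (falseTrue x)).trans (cube_map_falseTrue (top κ) x)).symm).trans
        (Category.id_comp _).symm)
  · exact (Category.comp_id _).trans (((cube_map_falseTrue (flipObj κ) (Fin.cons true x)).trans
      ((cube_map_consHom_true κ (falseTrue x)).trans (cube_map_falseTrue (bot κ) x)).symm).trans
        (Category.id_comp _).symm)

/-- The components of the comparison between the cube of `flipObj κ` and that of `κ`. -/
def flipApp (c d : Bool) (y : Fin n → Bool) :
    ((cube.{v, u} C (n + 2)).obj (flipObj κ)).obj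
      (Fin.cons c (Fin.cons d y : Fin (n + 1) → Bool)) ⟶
    ((permuteFunctor C (Equiv.swap 0 1)).obj ((cube.{v, u} C (n + 2)).obj κ)).obj
      (Fin.cons c (Fin.cons d y : Fin (n + 1) → Bool)) :=
  flipCell κ c d y ≫ ((cube.{v, u} C (n + 2)).obj κ).map (eqToHom (reindex_swap_cons c d y))

/-- The correction by `eqToHom` is harmless, since parallel paths in a cube have equal images. -/
lemma flipApp_naturality {c d c' d' : Bool} {x y : Fin n → Bool}
    (k : (Fin.cons c (Fin.cons d x : Fin (n + 1) → Bool) : Fin (n + 2) → Bool) ⟶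
      Fin.cons c' (Fin.cons d' y : Fin (n + 1) → Bool))
    (k' : (Fin.cons d (Fin.cons c x : Fin (n + 1) → Bool) : Fin (n + 2) → Bool) ⟶
      Fin.cons d' (Fin.cons c' y : Fin (n + 1) → Bool))
    (hk : ((cube.{v, u} C (n + 2)).obj (flipObj κ)).map k ≫ flipCell κ c' d' y =
      flipCell κ c d x ≫ ((cube.{v, u} C (n + 2)).obj κ).map k') :
    ((cube.{v, u} C (n + 2)).obj (flipObj κ)).map k ≫ flipApp κ c' d' y = flipApp κ c d x ≫
      ((permuteFunctor C (Equiv.swap 0 1)).obj ((cube.{v, u} C (n + 2)).obj κ)).map k := by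
  refine (Category.assoc _ _ _).symm.trans ((congrArg (· ≫ _) hk).trans
    ((Category.assoc _ _ _).trans (Eq.trans ?_ (Category.assoc _ _ _).symm)))
  exact congrArg (flipCell κ c d x ≫ ·) (map_comm _ _ _ _ _)

/-- The comparison between the cubes of `flipObj κ` and of `κ` on a face. -/
def flipFace (c : Bool) :
    Cube.consFunctor (n + 1) c ⋙ (cube.{v, u} C (n + 2)).obj (flipObj κ) ⟶
      Cube.consFunctor (n + 1) c ⋙
        (permuteFunctor C (Equiv.swap 0 1)).obj ((cube.{v, u} C (n + 2)).obj κ) :=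
  homOfCons (X := Cube.consFunctor (n + 1) c ⋙ (cube.{v, u} C (n + 2)).obj (flipObj κ))
    (fun d y => flipApp κ c d y)
    (fun d _ _ h => flipApp_naturality κ _ _ (flipCell_consHom κ c d h))
    (fun x => flipApp_naturality κ _ _ (flipCell_consHom_falseTrue κ c x))

lemma flipFace_app (c d : Bool) (x : Fin n → Bool) :
    (flipFace κ c).app (Fin.cons d x : Fin (n + 1) → Bool) = flipApp κ c d x :=
  consApp_cons (X := Cube.consFunctor (n + 1) c ⋙ (cube.{v, u} C (n + 2)).obj (flipObj κ))
    (Y := Cube.consFunctor (n + 1) c ⋙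
        (permuteFunctor C (Equiv.swap 0 1)).obj ((cube.{v, u} C (n + 2)).obj κ))
    (fun d y => flipApp κ c d y) d x

/-- The comparison between the cubes of `flipObj κ` and of `κ`. -/
def flipHom : (cube.{v, u} C (n + 2)).obj (flipObj κ) ⟶
    (permuteFunctor C (Equiv.swap 0 1)).obj ((cube.{v, u} C (n + 2)).obj κ) :=
  homOfCons (fun c x => (flipFace κ c).app x) (fun c _ _ h => (flipFace κ c).naturality h)
    (fun x => by
      obtain ⟨d, x, rfl⟩ : ∃ c y, x = Fin.cons c y :=
        ⟨x 0, Fin.tail x, (Fin.cons_self_tail x).symm⟩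
      rw [flipFace_app, flipFace_app]
      exact flipApp_naturality κ _ _ (flipCell_falseTrue_cons κ d x))

lemma flipHom_app (c d : Bool) (y : Fin n → Bool) :
    (flipHom κ).app (Fin.cons c (Fin.cons d y : Fin (n + 1) → Bool)) = flipApp κ c d y :=
  (consApp_cons (X := (cube.{v, u} C (n + 2)).obj (flipObj κ))
    (Y := (permuteFunctor C (Equiv.swap 0 1)).obj ((cube.{v, u} C (n + 2)).obj κ))
    (fun c x => (flipFace κ c).app x) c (Fin.cons d y)).trans (flipFace_app κ c d y)

lemma isIso_flipHom : IsIso (flipHom κ) := by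
  have : ∀ x, IsIso ((flipHom κ).app x) := fun x => by
    obtain ⟨c, x, rfl⟩ : ∃ c y, x = Fin.cons c y :=
      ⟨x 0, Fin.tail x, (Fin.cons_self_tail x).symm⟩
    obtain ⟨d, x, rfl⟩ : ∃ c y, x = Fin.cons c y :=
      ⟨x 0, Fin.tail x, (Fin.cons_self_tail x).symm⟩
    rw [flipHom_app]
    have := isIso_flipCell κ c d x
    have := Functor.map_isIso ((cube.{v, u} C (n + 2)).obj κ) (eqToHom (reindex_swap_cons c d x))
    exact IsIso.comp_isIso' (isIso_flipCell κ c d x) this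
  exact NatIso.isIso_of_isIso_app _

lemma flipHom_naturality {κ μ : NExt.{v, u} C (n + 2)} (f : κ ⟶ μ) :
    (cube.{v, u} C (n + 2)).map (flipMap f) ≫ flipHom μ = flipHom κ ≫
      (permuteFunctor C (Equiv.swap 0 1)).map ((cube.{v, u} C (n + 2)).map f) := by
  ext x
  obtain ⟨c, x, rfl⟩ : ∃ c y, x = Fin.cons c y :=
    ⟨x 0, Fin.tail x, (Fin.cons_self_tail x).symm⟩
  obtain ⟨d, x, rfl⟩ : ∃ c y, x = Fin.cons c y :=
    ⟨x 0, Fin.tail x, (Fin.cons_self_tail x).symm⟩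
  have h : ((cube.{v, u} C (n + 2)).map (flipMap f)).app
        (Fin.cons c (Fin.cons d x : Fin (n + 1) → Bool)) ≫ flipCell μ c d x =
      flipCell κ c d x ≫ ((cube.{v, u} C (n + 2)).map f).app
        (Fin.cons d (Fin.cons c x : Fin (n + 1) → Bool)) := by
    cases c <;> cases d <;> exact (Category.comp_id _).trans (Category.id_comp _).symm
  rw [NatTrans.comp_app, NatTrans.comp_app, flipHom_app, flipHom_app]
  refine (Category.assoc _ _ _).symm.trans ((congrArg (· ≫ _) h).trans
    ((Category.assoc _ _ _).trans (Eq.trans ?_ (Category.assoc _ _ _).symm)))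
  exact congrArg (flipCell κ c d x ≫ ·) (((cube.{v, u} C (n + 2)).map f).naturality _).symm

variable (C n) in
/-- Exchanging the first two directions of a multiple extension amounts to exchanging the first two
directions of its cube. -/
noncomputable def flipIso : (flip.{v, u} C n).F ⋙ cube.{v, u} C (n + 2) ≅
    cube.{v, u} C (n + 2) ⋙ permuteFunctor C (Equiv.swap 0 1) :=
  NatIso.ofComponents (fun κ => @asIso _ _ _ _ (flipHom κ) (isIso_flipHom κ)) fun f => flipHom_naturality f

end Flip

end NExt

/-! ### Adjacent transpositions in higher dimensions -/

namespace NExt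

open HigherCoverings.Cube

variable {C : Type (max u v)} [Category.{v} C] [Regular C]

section Lift

variable {n : ℕ} {G : ExtFunctor.{v, u} C n n} {σ : Equiv.Perm (Fin n)}
  {σ' : Equiv.Perm (Fin (n + 1))}
  (ε : G.F ⋙ cube.{v, u} C n ≅ cube.{v, u} C n ⋙ permuteFunctor C σ)
  (hσ : ∀ (c : Bool) (y : Fin n → Bool),
    (Fin.cons c ((reindex σ).obj y) : Fin (n + 1) → Bool) = (reindex σ').obj (Fin.cons c y))
  (κ : NExt.{v, u} C (n + 1))

/-- The components of the comparison between the cube of `G.lift.F.obj κ` and that of `κ`, for a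
functor `G` which permutes directions. -/
def liftCell : ∀ (c : Bool) (y : Fin n → Bool),
    ((cube.{v, u} C (n + 1)).obj (G.lift.F.obj κ)).obj (Fin.cons c y) ⟶
      ((cube.{v, u} C (n + 1)).obj κ).obj (Fin.cons c ((reindex σ).obj y))
  | false, y => (ε.hom.app (top κ)).app y
  | true, y => (ε.hom.app (bot κ)).app y

lemma isIso_liftCell : ∀ (c : Bool) (y : Fin n → Bool), IsIso (liftCell ε κ c y)
  | false, y => inferInstanceAs (IsIso ((ε.hom.app (top κ)).app y))
  | true, y => inferInstanceAs (IsIso ((ε.hom.app (bot κ)).app y))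

lemma liftCell_consHom : ∀ (c : Bool) {x y : Fin n → Bool} (h : x ⟶ y),
    ((cube.{v, u} C (n + 1)).obj (G.lift.F.obj κ)).map (consHom c h) ≫ liftCell ε κ c y =
      liftCell ε κ c x ≫ ((cube.{v, u} C (n + 1)).obj κ).map (consHom c ((reindex σ).map h))
  | false, _, y, h => ((congrArg (· ≫ (ε.hom.app (top κ)).app y)
      (cube_map_consHom_false (G.lift.F.obj κ) h)).trans
        ((ε.hom.app (top κ)).naturality h)).trans
        (congrArg ((ε.hom.app (top κ)).app _ ≫ ·) (cube_map_consHom_false κ _).symm)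
  | true, _, y, h => ((congrArg (· ≫ (ε.hom.app (bot κ)).app y)
      (cube_map_consHom_true (G.lift.F.obj κ) h)).trans
        ((ε.hom.app (bot κ)).naturality h)).trans
        (congrArg ((ε.hom.app (bot κ)).app _ ≫ ·) (cube_map_consHom_true κ _).symm)

lemma liftCell_falseTrue (x : Fin n → Bool) :
    ((cube.{v, u} C (n + 1)).obj (G.lift.F.obj κ)).map (falseTrue x) ≫ liftCell ε κ true x =
      liftCell ε κ false x ≫
        ((cube.{v, u} C (n + 1)).obj κ).map (falseTrue ((reindex σ).obj x)) :=
  ((congrArg (· ≫ (ε.hom.app (bot κ)).app x) (cube_map_falseTrue (G.lift.F.obj κ) x)).trans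
    (congrArg (fun φ => φ.app x) (ε.hom.naturality (arr κ)))).trans
    (congrArg ((ε.hom.app (top κ)).app x ≫ ·) (cube_map_falseTrue κ _).symm)

lemma liftCell_naturality {κ μ : NExt.{v, u} C (n + 1)} (f : κ ⟶ μ) : ∀ (c : Bool) (y : Fin n → Bool),
    ((cube.{v, u} C (n + 1)).map (G.lift.F.map f)).app (Fin.cons c y) ≫ liftCell ε μ c y =
      liftCell ε κ c y ≫ ((cube.{v, u} C (n + 1)).map f).app (Fin.cons c ((reindex σ).obj y))
  | false, y => congrArg (fun φ => φ.app y) (ε.hom.naturality (topMap f))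
  | true, y => congrArg (fun φ => φ.app y) (ε.hom.naturality (botMap f))

/-- The components of the comparison between the cube of `G.lift.F.obj κ` and the permuted cube
of `κ`, for a functor `G` which permutes directions. -/
def liftApp (c : Bool) (y : Fin n → Bool) :
    ((cube.{v, u} C (n + 1)).obj (G.lift.F.obj κ)).obj (Fin.cons c y) ⟶
      ((permuteFunctor C σ').obj ((cube.{v, u} C (n + 1)).obj κ)).obj (Fin.cons c y) :=
  liftCell ε κ c y ≫ ((cube.{v, u} C (n + 1)).obj κ).map (eqToHom (hσ c y))

lemma liftApp_naturality {c d : Bool} {x y : Fin n → Bool}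
    (k : (Fin.cons c x : Fin (n + 1) → Bool) ⟶ Fin.cons d y)
    (k' : (Fin.cons c ((reindex σ).obj x) : Fin (n + 1) → Bool) ⟶
      Fin.cons d ((reindex σ).obj y))
    (hk : ((cube.{v, u} C (n + 1)).obj (G.lift.F.obj κ)).map k ≫ liftCell ε κ d y =
      liftCell ε κ c x ≫ ((cube.{v, u} C (n + 1)).obj κ).map k') :
    ((cube.{v, u} C (n + 1)).obj (G.lift.F.obj κ)).map k ≫ liftApp ε hσ κ d y =
      liftApp ε hσ κ c x ≫
        ((permuteFunctor C σ').obj ((cube.{v, u} C (n + 1)).obj κ)).map k := by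
  refine (Category.assoc _ _ _).symm.trans ((congrArg (· ≫ _) hk).trans
    ((Category.assoc _ _ _).trans (Eq.trans ?_ (Category.assoc _ _ _).symm)))
  exact congrArg (liftCell ε κ c x ≫ ·) (map_comm _ _ _ _ _)

/-- The comparison between the cube of `G.lift.F.obj κ` and the permuted cube of `κ`, for a
functor `G` which permutes directions. -/
def liftHom : (cube.{v, u} C (n + 1)).obj (G.lift.F.obj κ) ⟶
    (permuteFunctor C σ').obj ((cube.{v, u} C (n + 1)).obj κ) :=
  homOfCons (fun c x => liftApp ε hσ κ c x)
    (fun c _ _ h => liftApp_naturality ε hσ κ _ _ (liftCell_consHom ε κ c h))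
    (fun x => liftApp_naturality ε hσ κ _ _ (liftCell_falseTrue ε κ x))

lemma liftHom_app (c : Bool) (y : Fin n → Bool) :
    (liftHom ε hσ κ).app (Fin.cons c y) = liftApp ε hσ κ c y :=
  consApp_cons (X := (cube.{v, u} C (n + 1)).obj (G.lift.F.obj κ))
    (Y := (permuteFunctor C σ').obj ((cube.{v, u} C (n + 1)).obj κ))
    (fun c x => liftApp ε hσ κ c x) c y

lemma isIso_liftHom : IsIso (liftHom ε hσ κ) := by
  have : ∀ x, IsIso ((liftHom ε hσ κ).app x) := fun x => by
    obtain ⟨c, x, rfl⟩ : ∃ c y, x = Fin.cons c y :=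
      ⟨x 0, Fin.tail x, (Fin.cons_self_tail x).symm⟩
    rw [liftHom_app]
    exact IsIso.comp_isIso' (isIso_liftCell ε κ c x)
      (Functor.map_isIso ((cube.{v, u} C (n + 1)).obj κ) (eqToHom (hσ c x)))
  exact NatIso.isIso_of_isIso_app _

lemma liftHom_naturality {κ μ : NExt.{v, u} C (n + 1)} (f : κ ⟶ μ) :
    (cube.{v, u} C (n + 1)).map (G.lift.F.map f) ≫ liftHom ε hσ μ = liftHom ε hσ κ ≫
      (permuteFunctor C σ').map ((cube.{v, u} C (n + 1)).map f) := by
  ext x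
  obtain ⟨c, x, rfl⟩ : ∃ c y, x = Fin.cons c y :=
    ⟨x 0, Fin.tail x, (Fin.cons_self_tail x).symm⟩
  rw [NatTrans.comp_app, NatTrans.comp_app, liftHom_app, liftHom_app]
  refine (Category.assoc _ _ _).symm.trans ((congrArg (· ≫ _) (liftCell_naturality ε f c x)).trans
    ((Category.assoc _ _ _).trans (Eq.trans ?_ (Category.assoc _ _ _).symm)))
  exact congrArg (liftCell ε κ c x ≫ ·) (((cube.{v, u} C (n + 1)).map f).naturality _).symm

/-- If `G` permutes the directions of cubes, then so does `G.lift`. -/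
noncomputable def liftIso : G.lift.F ⋙ cube.{v, u} C (n + 1) ≅
    cube.{v, u} C (n + 1) ⋙ permuteFunctor C σ' :=
  NatIso.ofComponents (fun κ => @asIso _ _ _ _ (liftHom ε hσ κ) (isIso_liftHom ε hσ κ))
    fun f => liftHom_naturality ε hσ f

end Lift

/-- An exchange of adjacent directions of cubes is induced by a functor between categories of
multiple extensions. -/
lemma exists_extFunctor_swap : ∀ (n : ℕ) (i : Fin (n + 1)),
    ∃ G : ExtFunctor.{v, u} C (n + 2) (n + 2), G.PreservesDiscFib ∧
      Nonempty (G.F ⋙ cube.{v, u} C (n + 2) ≅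
        cube.{v, u} C (n + 2) ⋙ permuteFunctor C (Equiv.swap i.castSucc i.succ)) := by
  intro n
  induction n with
  | zero =>
    intro i
    obtain rfl : i = 0 := Fin.fin_one_eq_zero i
    exact ⟨flip C 0, flip_preservesDiscFib, ⟨flipIso C 0⟩⟩
  | succ n ih =>
    intro i
    -- Only the exchange of directions 0 and 1 is new; any other adjacent exchange acts on domain
    -- and codomain, one dimension lower.
    refine Fin.cases ⟨flip C (n + 1), flip_preservesDiscFib, ⟨flipIso C (n + 1)⟩⟩ (fun i => ?_) i
    obtain ⟨G, hG, ⟨ε⟩⟩ := ih i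
    refine ⟨G.lift, hG.lift, ⟨liftIso ε fun c y => ?_⟩⟩
    funext j
    refine Fin.cases ?_ (fun j => ?_) j
    · have h : Equiv.swap i.castSucc.succ i.succ.succ 0 = 0 :=
        Equiv.swap_apply_of_ne_of_ne (Fin.succ_ne_zero _).symm (Fin.succ_ne_zero _).symm
      simp [reindex, h]
    · have h : Equiv.swap i.castSucc.succ i.succ.succ j.succ =
          (Equiv.swap i.castSucc i.succ j).succ :=
        (Fin.succ_injective _).swap_apply i.castSucc i.succ j
      simp [reindex, h]

/-- A permutation of the directions of cubes is induced by a functor between categories of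
multiple extensions. -/
lemma exists_extFunctor_permute (n : ℕ) (σ : Equiv.Perm (Fin (n + 1))) :
    ∃ G : ExtFunctor.{v, u} C (n + 1) (n + 1), G.PreservesDiscFib ∧
      ∀ κ, Nonempty ((cube.{v, u} C (n + 1)).obj (G.F.obj κ) ≅
        ((cube.{v, u} C (n + 1)).obj κ).permute σ) := by
  -- Adjacent transpositions generate the symmetric group, already as a monoid.
  have hσ : σ ∈ Submonoid.closure
      (Set.range fun i : Fin n => Equiv.swap i.castSucc i.succ) := by
    rw [Equiv.Perm.mclosure_swap_castSucc_succ]; trivial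
  induction hσ using Submonoid.closure_induction with
  | mem σ hσ =>
    obtain ⟨i, rfl⟩ := hσ
    obtain - | n := n
    · exact i.elim0
    · obtain ⟨G, hG, ⟨ε⟩⟩ := exists_extFunctor_swap.{v, u} (C := C) n i
      exact ⟨G, hG, fun κ => ⟨ε.app κ⟩⟩
  | one =>
    exact ⟨⟨𝟭 _, fun h => h, fun h _ => h⟩, fun _ _ _ h => h, fun κ => ⟨Iso.refl _⟩⟩
  | mul σ τ _ _ hσ hτ =>
    obtain ⟨G, hG, hG'⟩ := hσ
    obtain ⟨H, hH, hH'⟩ := hτ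
    -- The functor for `σ` is applied first: permuting by `σ` and then by `τ` is permuting by `σ *
    -- τ`, as `reindex` uses inverses.
    refine ⟨⟨G.F ⋙ H.F, fun h => H.mem (G.mem h), fun h hf => H.isPullback (G.isPullback h hf)
      (G.mem hf)⟩, fun _ _ _ h => hH (hG h), fun κ => ?_⟩
    obtain ⟨e⟩ := hG' κ
    obtain ⟨e'⟩ := hH' (G.F.obj κ)
    exact ⟨e' ≪≫ (permuteFunctor C τ).mapIso e⟩

end NExt

/-! ### Invariance of coverings under permutations -/

namespace GaloisTower

open NExt

variable {C : Type (max u v)} [Category.{v} C] [Regular C] {T : GaloisTower.{v, u} C} {n : ℕ}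

lemma isCovering_iff_of_iso {κ μ : NExt.{v, u} C (n + 1)} (e : κ ≅ μ) : T.IsCovering κ ↔ T.IsCovering μ :=
  isCovering_iff_of_discFib ((discFibProps (n + 1)).of_isIso e.hom)

omit [Regular C] in
lemma LiesInBase.of_permute {σ : Equiv.Perm (Fin n)} {β β' : NExt.{v, u} C n} (h : T.LiesInBase β)
    (e : (cube.{v, u} C n).obj β' ≅ ((cube.{v, u} C n).obj β).permute σ) : T.LiesInBase β' :=
  fun x => (T.Γ 0).replete.of_iso (e.app x).symm (h _)

/-- The functor permuting directions carries the whole span along: it preserves discrete fibrations,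
and the vertices of a permuted cube are, up to isomorphism, vertices of the original one. -/
lemma IsCovering.of_permute {σ : Equiv.Perm (Fin (n + 1))} {α α' : NExt.{v, u} C (n + 1)}
    (h : T.IsCovering α)
    (e : (cube.{v, u} C (n + 1)).obj α' ≅ ((cube.{v, u} C (n + 1)).obj α).permute σ) :
    T.IsCovering α' := by
  obtain ⟨G, hG, hG'⟩ := exists_extFunctor_permute.{v, u} (C := C) n σ
  obtain ⟨β, τ, φ, ψ, hφ, hψ, hβ⟩ := (isCovering_iff_exists_span α).1 h
  obtain ⟨e₁⟩ := hG' α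
  obtain ⟨e₂⟩ := hG' β
  -- A multiple extension is determined up to isomorphism by its cube, so `α'` is the image of `α`
  -- under `G`.
  obtain ⟨i⟩ := nonempty_iso_of_cube (e₁ ≪≫ e.symm)
  refine (isCovering_iff_of_iso i).1 ((isCovering_iff_exists_span _).2
    ⟨_, _, _, _, hG hφ, hG hψ, ?_⟩)
  exact liesInBase_iff.1 ((liesInBase_iff.2 hβ).of_permute e₂)

/-- Being a covering does not depend on the order of the directions of the cube. -/
lemma isCovering_iff_of_permute {σ : Equiv.Perm (Fin (n + 1))} {α α' : NExt.{v, u} C (n + 1)}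
    (e : (cube.{v, u} C (n + 1)).obj α' ≅ ((cube.{v, u} C (n + 1)).obj α).permute σ) :
    T.IsCovering α ↔ T.IsCovering α' := by
  refine ⟨fun h => h.of_permute e, fun h => h.of_permute (σ := σ⁻¹) ?_⟩
  have : (((cube.{v, u} C (n + 1)).obj α).permute σ).permute σ⁻¹ =
      (cube.{v, u} C (n + 1)).obj α := by
    have h : (Cube.permuteFunctor C (σ * σ⁻¹)).obj ((cube.{v, u} C (n + 1)).obj α) =
        (cube.{v, u} C (n + 1)).obj α := by
      rw [mul_inv_cancel]
      rfl
    exact h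
  exact (eqToIso this).symm ≪≫ ((Cube.permuteFunctor C σ⁻¹).mapIso e).symm

end GaloisTower

end HigherCoverings

open CategoryTheory HigherCoverings in
/-- Here `α` is an `(n + 1)`-fold extension, with `n + 1 ≥ 2`. The last part says that permuting the
directions of the underlying cube of `α` yields again an `(n + 1)`-fold extension (unique up to
isomorphism), and that this is a covering if and only if `α` is one. -/
theorem mainTheorem1 {C : Type (max u v)} [Category.{v} C] [BarrExact C]
    (T : GaloisTower.{v, u} C) (n : ℕ) (hn : 2 ≤ n + 1) (α : NExt.{v, u} C (n + 1)) :
    (T.IsCovering α ↔ T.IsSymmetricCovering α) ∧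
    (T.IsCovering α ↔
      ∃ (β τ : NExt.{v, u} C (n + 1)) (φ : τ ⟶ β) (ψ : τ ⟶ α),
        IsDiscreteFibration φ ∧ IsDiscreteFibration ψ ∧ T.LiesInBase β) ∧
    (∀ σ : Equiv.Perm (Fin (n + 1)),
      (∃ α' : NExt.{v, u} C (n + 1),
        Nonempty ((cube.{v, u} C (n + 1)).obj α' ≅
          ((cube.{v, u} C (n + 1)).obj α).permute σ)) ∧
      ∀ α' : NExt.{v, u} C (n + 1),
        Nonempty ((cube.{v, u} C (n + 1)).obj α' ≅
          ((cube.{v, u} C (n + 1)).obj α).permute σ) →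
        (T.IsCovering α ↔ T.IsCovering α')) := by
  have h : T.IsCovering α ↔ ∃ (β τ : NExt.{v, u} C (n + 1)) (φ : τ ⟶ β) (ψ : τ ⟶ α),
      IsDiscreteFibration φ ∧ IsDiscreteFibration ψ ∧ T.LiesInBase β := by
    simp only [NExt.isDiscreteFibration_iff, GaloisTower.liesInBase_iff]
    exact GaloisTower.isCovering_iff_exists_span α
  refine ⟨h.trans ⟨?_, ?_⟩, h, fun σ => ⟨?_, fun α' ⟨e⟩ =>
    GaloisTower.isCovering_iff_of_permute e⟩⟩
  · rintro ⟨β, τ, φ, ψ, hφ, hψ, hβ⟩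
    exact ⟨τ, ψ, hψ, β, φ, hφ, hβ⟩
  · rintro ⟨τ, ψ, hψ, β, φ, hφ, hβ⟩
    exact ⟨β, τ, φ, ψ, hφ, hψ, hβ⟩
  · obtain ⟨G, -, hG⟩ := NExt.exists_extFunctor_permute.{v, u} (C := C) n σ
    exact ⟨G.F.obj α, hG α⟩
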